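/- Let $p$ be a prime, $k$ a perfect field of characteristic $p$, and $K$ a finite totally ramified extension of $K_0=W(k)[1/p]$ with ring of integers $\mathcal O_K$, uniformizer $\pi$, and let $E(u)\in W(k)[u]$ be the minimal polynomial of $\pi$. Let $d\ge 0$, let $R_0$ be the $p$-adic completion of an étale algebra over $W(k)\langle T_1^{\pm1},\dots,T_d^{\pm1}\rangle$ (the $p$-adic completion of $W(k)[T_1^{\pm1},\dots,T_d^{\pm1}]$) such that $(p)\subset R_0$ is a prime ideal, and let $\varphi$ be the lift of Frobenius on $R_0$ with $\varphi(T_i)=T_i^p$. Put $R=R_0\otimes_{W(k)}\mathcal O_K$. Let $\mathcal O_{L_0}$ be the $p$-adic completion of the localization $(R_0)_{(p)}$, with the induced Frobenius, and $\mathcal O_L=\mathcal O_{L_0}\otimes_{W(k)}\mathcal O_K$. Let $\mathfrak S=R_0[\![u]\!]$ and $\mathfrak S_L=\mathcal O_{L_0}[\![u]\!]$, with Frobenius extended by $\varphi(u)=u^p$. These Frobenius lifts define $\delta$-structures, and with $u\mapsto\pi$ one has $\mathfrak S/(E)\cong R$ and $\mathfrak S_L/(E)\cong\mathcal O_L$,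 so that $(\mathfrak S,(E))$ and $(\mathfrak S_L,(E))$ are bounded prisms over $R$ and over $\mathcal O_L$, respectively. Let $(\mathfrak S^{(2)},(E))$ be the self-product of $(\mathfrak S,(E))$ in the absolute prismatic site of $\mathrm{Spf}\,R$, that is, its coproduct with itself in the category of bounded prisms $(A,I)$ equipped with a ring map $R\to A/I$; let $(\mathfrak S_L^{(2)},(E))$ be the self-product of $(\mathfrak S_L,(E))$ in the absolute prismatic site of $\mathrm{Spf}\,\mathcal O_L$. The image of $E$ in $\mathfrak S^{(2)}$ and in $\mathfrak S_L^{(2)}$ is taken along the first structure map, and $(-)^\wedge_p$ denotes classical $p$-adic completion. Then these two self-products exist, and the natural maps $$\mathfrak S^{(2)}\to\mathfrak S_L^{(2)},\quad \mathfrak S^{(2)}\to\mathfrak S^{(2)}[1/E]^\wedge_p,\quad \mathfrak S_L^{(2)}\to\mathfrak S_L^{(2)}[1/E]^\wedge_p,\quad \mathfrak S^{(2)}[1/E]^\wedge_p\to\mathfrak S_L^{(2)}[1/E]^\wedge_p$$ are injective, and, as subrings of $\mathfrak S_L^{(2)}[1/E]^\wedge_p$, $$\mathfrak S^{(2)}=\mathfrak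 S_L^{(2)}\cap\mathfrak S^{(2)}[1/E]^\wedge_p .$$ -/

import Mathlib

open scoped TensorProduct PowerSeries

universe u

namespace PrismIntersection

/-! ### `p`-adic completion -/

/-- The (classical) `p`-adic completion `lim A / p ^ n` of a commutative ring `A`. -/
abbrev PCompl (p : ℕ) (A : Type u) [CommRing A] : Type u :=
  AdicCompletion (Ideal.span {(p : A)}) A

theorem span_pow_le_comap (p : ℕ) {A B : Type u} [CommRing A] [CommRing B] (f : A →+* B) (n : ℕ) :
    Ideal.span {(p : A)} ^ n ≤ (Ideal.span {(p : B)} ^ n).comap f := by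
  rw [← Ideal.map_le_iff_le_comap, Ideal.map_pow, Ideal.map_span]
  simp

/-- The system of maps `lim A / p ^ n → A / p ^ n → B / p ^ n` induced by a ring map `A → B`. -/
noncomputable def PCompl.mapAux (p : ℕ) {A B : Type u} [CommRing A] [CommRing B] (f : A →+* B)
    (n : ℕ) : PCompl p A →+* B ⧸ Ideal.span {(p : B)} ^ n :=
  (Ideal.quotientMap (Ideal.span {(p : B)} ^ n) f (span_pow_le_comap p f n)).comp
    (AdicCompletion.evalₐ (Ideal.span {(p : A)}) n).toRingHom

theorem PCompl.mapAux_compat (p : ℕ) {A B : Type u} [CommRing A] [CommRing B] (f : A →+* B)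
    {m n : ℕ} (hle : m ≤ n) :
    (Ideal.Quotient.factorPow (Ideal.span {(p : B)}) hle).comp (PCompl.mapAux p f n) =
      PCompl.mapAux p f m := by
  ext x
  obtain ⟨x, rfl⟩ := AdicCompletion.mk_surjective _ _ x
  simp only [PCompl.mapAux, RingHom.comp_apply, AlgHom.toRingHom_eq_coe, RingHom.coe_coe,
    AdicCompletion.evalₐ_mk, Ideal.quotientMap_mk]
  have h := AdicCompletion.Ideal.mk_eq_mk _ hle x
  rw [Ideal.Quotient.eq] at h
  change Ideal.Quotient.mk _ (f (x.val n)) = Ideal.Quotient.mk _ (f (x.val m))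
  rw [Ideal.Quotient.eq, ← map_sub]
  exact span_pow_le_comap p f m h

/-- The ring map induced on `p`-adic completions by a ring map. -/
noncomputable def PCompl.map (p : ℕ) {A B : Type u} [CommRing A] [CommRing B] (f : A →+* B) :
    PCompl p A →+* PCompl p B :=
  AdicCompletion.liftRingHom (Ideal.span {(p : B)}) (PCompl.mapAux p f)
    (PCompl.mapAux_compat p f)

theorem PCompl.map_algebraMap (p : ℕ) {A B : Type u} [CommRing A] [CommRing B] (f : A →+* B)
    (a : A) : PCompl.map p f (algebraMap A (PCompl p A) a) = algebraMap B (PCompl p B) (f a) := by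
  refine AdicCompletion.ext_evalₐ fun n => ?_
  rw [PCompl.map, AdicCompletion.evalₐ_liftRingHom _ _ (PCompl.mapAux_compat p f)]
  simp only [PCompl.mapAux, RingHom.comp_apply, AlgHom.toRingHom_eq_coe, RingHom.coe_coe, AlgHom.commutes,
    Ideal.Quotient.algebraMap_eq, Ideal.quotientMap_mk]

/-! ### `δ`-rings and bounded prisms -/

/-- A `δ`-ring (with respect to `p`). Since `p` is prime, `p` divides `p.choose i` for `0 < i < p`,
so the last term of `delta_add` is `(x ^ p + y ^ p - (x + y) ^ p) / p`. -/
class DeltaRing (p : ℕ) (A : Type u) [CommRing A] where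
  delta : A → A
  delta_zero : delta 0 = 0
  delta_one : delta 1 = 0
  delta_mul : ∀ x y, delta (x * y) = x ^ p * delta y + y ^ p * delta x + p * delta x * delta y
  delta_add : ∀ x y, delta (x + y) = delta x + delta y
    - ∑ i ∈ Finset.Ioo 0 p, ((p.choose i / p : ℕ) : A) * x ^ i * y ^ (p - i)

/-- The Frobenius `x ↦ x ^ p + p δ(x)` of a `δ`-ring. -/
def DeltaRing.frob (p : ℕ) {A : Type u} [CommRing A] [DeltaRing p A] (x : A) : A :=
  x ^ p + p * DeltaRing.delta p x

/-- `A` is derived `J`-complete: for every `f ∈ J`, the derived limit of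
`⋯ → A → A → A` (multiplication by `f`) vanishes, that is, both its `lim` and its `lim¹` vanish;
these are the kernel and the cokernel of the map below. -/
def IsDerivedComplete {A : Type u} [CommRing A] (J : Ideal A) : Prop :=
  ∀ f ∈ J, Function.Bijective (fun (x : ℕ → A) (n : ℕ) => x n - f * x (n + 1))

/-- `(A, I)` is a bounded prism. -/
structure IsBoundedPrism (p : ℕ) (A : Type u) [CommRing A] [DeltaRing p A] (I : Ideal A) :
    Prop where
  /-- `I` defines a Cartier divisor -/
  invertible : Module.Invertible A I
  derivedComplete : IsDerivedComplete (I ⊔ Ideal.span {(p : A)})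
  mem : (p : A) ∈ I ⊔ Ideal.span (DeltaRing.frob p '' (I : Set A))
  /-- `A / I` has bounded `p`-power torsion -/
  bounded : ∃ n : ℕ, ∀ (m : ℕ) (x : A ⧸ I), (p : A ⧸ I) ^ m * x = 0 → (p : A ⧸ I) ^ n * x = 0

/-- An object of the absolute prismatic site of `Spf R`: a bounded prism `(A, I)` with a
structure map `R → A / I`. -/
structure PrismOver (p : ℕ) (R : Type u) [CommRing R] : Type (u + 1) where
  carrier : Type u
  [commRing : CommRing carrier]
  [deltaRing : DeltaRing p carrier]
  ideal : Ideal carrier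
  isBoundedPrism : IsBoundedPrism p carrier ideal
  str : R →+* carrier ⧸ ideal

attribute [instance] PrismOver.commRing PrismOver.deltaRing

/-- A map of bounded prisms over `R` (a morphism of the absolute prismatic site, reversed). -/
structure PrismOver.Hom {p : ℕ} {R : Type u} [CommRing R] (X Y : PrismOver p R) where
  toRingHom : X.carrier →+* Y.carrier
  map_delta : ∀ x, toRingHom (DeltaRing.delta p x) = DeltaRing.delta p (toRingHom x)
  map_ideal : X.ideal ≤ Y.ideal.comap toRingHom
  map_str : ∀ r, Ideal.quotientMap Y.ideal toRingHom map_ideal (X.str r) = Y.str r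

/-- A prism over `R'`, seen as a prism over `R` along a ring map `R → R'`. -/
abbrev PrismOver.restrict {p : ℕ} {R R' : Type u} [CommRing R] [CommRing R'] (g : R →+* R')
    (Y : PrismOver p R') : PrismOver p R where
  carrier := Y.carrier
  ideal := Y.ideal
  isBoundedPrism := Y.isBoundedPrism
  str := Y.str.comp g

/-! ### The Breuil–Kisin prism and its self-product

Here `W = W(k)`, `O = 𝒪_K`, `π` is a uniformizer of `O` with minimal polynomial `E` over `W`, and
`R₀` is a `p`-torsion free `W`-algebra with a lift `φ` of Frobenius. The Breuil–Kisin prism is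
`(R₀⟦u⟧, (E))`, living over `R = R₀ ⊗[W] O`. -/

/-- `φ` lifts the Frobenius of `A / p`. -/
def IsFrobeniusLift (p : ℕ) {A : Type u} [CommRing A] (φ : A →+* A) : Prop :=
  ∀ x, φ x - x ^ p ∈ Ideal.span {(p : A)}

/-- The Frobenius of `R₀⟦u⟧`: it extends `φ` and sends `u` to `u ^ p`. -/
noncomputable def powerSeriesFrob (p : ℕ) [Fact p.Prime] {R₀ : Type u} [CommRing R₀]
    (φ : R₀ →+* R₀) : R₀⟦X⟧ →+* R₀⟦X⟧ :=
  (PowerSeries.expand p (Fact.out : p.Prime).ne_zero).toRingHom.comp (PowerSeries.map φ)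

/-- The image in `R₀⟦u⟧` of the minimal polynomial `E(u)` of `π` over `W`. -/
noncomputable def eisenstein (W : Type u) [CommRing W] {O : Type u} [CommRing O] [Algebra W O]
    (π : O) (R₀ : Type u) [CommRing R₀] [Algebra W R₀] : R₀⟦X⟧ :=
  (((minpoly W π).map (algebraMap W R₀) : Polynomial R₀) : R₀⟦X⟧)

/-- A map, over `R = R₀ ⊗[W] O`, from the Breuil–Kisin prism `(R₀⟦u⟧, (E))` to a bounded prism.

* `map_delta`: compatibility with `δ`. As `R₀⟦u⟧` is `p`-torsion free, its `δ`-structure is given by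
  its Frobenius: `δ(x)` is the unique `y` with `φ(x) = x ^ p + p y`.
* `map_str_C`, `map_str_X`: compatibility with the structure maps. The isomorphism
  `R₀⟦u⟧ / (E) ≃ R₀ ⊗[W] O` is the one with `a ↦ a ⊗ 1` for `a ∈ R₀` and `u ↦ 1 ⊗ π`; as
  `R₀⟦u⟧ / (E) = R₀[u] / (E)`, it suffices to compare on `R₀` and on `u`. -/
structure BKHom {p : ℕ} [Fact p.Prime] {W O : Type u} [CommRing W] [CommRing O] [Algebra W O]
    (π : O) {R₀ : Type u} [CommRing R₀] [Algebra W R₀] (φ : R₀ →+* R₀)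
    (Y : PrismOver p (R₀ ⊗[W] O)) where
  toRingHom : R₀⟦X⟧ →+* Y.carrier
  map_delta : ∀ x y, powerSeriesFrob p φ x = x ^ p + p * y →
    toRingHom y = DeltaRing.delta p (toRingHom x)
  map_ideal : toRingHom (eisenstein W π R₀) ∈ Y.ideal
  map_str_C : ∀ a : R₀, Ideal.Quotient.mk Y.ideal (toRingHom (PowerSeries.C a)) = Y.str (a ⊗ₜ 1)
  map_str_X : Ideal.Quotient.mk Y.ideal (toRingHom PowerSeries.X) = Y.str (1 ⊗ₜ π)

section

variable {p : ℕ} [Fact p.Prime] {W O : Type u} [CommRing W] [CommRing O] [Algebra W O] {π : O}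
  {R₀ R₁ : Type u} [CommRing R₀] [Algebra W R₀] [CommRing R₁] [Algebra W R₁]
  {φ : R₀ →+* R₀} {φ₁ : R₁ →+* R₁}

/-- `P`, with `i₁` and `i₂`, is the self-product of the Breuil–Kisin prism in the absolute
prismatic site of `Spf (R₀ ⊗[W] O)`, that is, its self-coproduct among bounded prisms over
`R₀ ⊗[W] O`. -/
def IsSelfProduct {P : PrismOver p (R₀ ⊗[W] O)} (i₁ i₂ : BKHom π φ P) : Prop :=
  ∀ (Y : PrismOver p (R₀ ⊗[W] O)) (q₁ q₂ : BKHom π φ Y), ∃! f : P.Hom Y,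
    f.toRingHom.comp i₁.toRingHom = q₁.toRingHom ∧ f.toRingHom.comp i₂.toRingHom = q₂.toRingHom

theorem map_powerSeriesFrob (g : R₀ →+* R₁) (hg : g.comp φ = φ₁.comp g) (x : R₀⟦X⟧) :
    PowerSeries.map g (powerSeriesFrob p φ x) = powerSeriesFrob p φ₁ (PowerSeries.map g x) := by
  have hp : p ≠ 0 := (Fact.out : p.Prime).ne_zero
  have hg' : ∀ a, g (φ a) = φ₁ (g a) := fun a => RingHom.congr_fun hg a
  ext n
  simp only [powerSeriesFrob, RingHom.comp_apply, AlgHom.toRingHom_eq_coe, RingHom.coe_coe,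
    PowerSeries.coeff_map, PowerSeries.expand_apply, PowerSeries.coeff_subst_X_pow hp]
  split_ifs <;> simp [hg']

theorem map_eisenstein (g : R₀ →ₐ[W] R₁) :
    PowerSeries.map (g : R₀ →+* R₁) (eisenstein W π R₀) = eisenstein W π R₁ := by
  ext n
  simp [eisenstein]

/-- A map from the Breuil–Kisin prism of `R₁` to a prism, restricted along the map of
Breuil–Kisin prisms induced by a Frobenius-compatible map `R₀ → R₁`. -/
noncomputable def BKHom.restrict (g : R₀ →ₐ[W] R₁)
    (hg : (g : R₀ →+* R₁).comp φ = φ₁.comp (g : R₀ →+* R₁))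
    {Y : PrismOver p (R₁ ⊗[W] O)} (q : BKHom π φ₁ Y) :
    BKHom π φ (Y.restrict (Algebra.TensorProduct.map g (AlgHom.id W O)).toRingHom) where
  toRingHom := q.toRingHom.comp (PowerSeries.map (g : R₀ →+* R₁))
  map_delta x y h := by
    refine q.map_delta _ _ ?_
    rw [← map_powerSeriesFrob (g : R₀ →+* R₁) hg, h]
    simp
  map_ideal := by
    rw [RingHom.comp_apply, map_eisenstein]
    exact q.map_ideal
  map_str_C a := by
    simpa using q.map_str_C (g a)
  map_str_X := by
    simpa using q.map_str_X

/-- The natural map from the self-product of the Breuil–Kisin prism of `R₀` to that of `R₁`,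
given by the universal property. -/
noncomputable def selfProductMap (g : R₀ →ₐ[W] R₁)
    (hg : (g : R₀ →+* R₁).comp φ = φ₁.comp (g : R₀ →+* R₁))
    {P : PrismOver p (R₀ ⊗[W] O)} {i₁ i₂ : BKHom π φ P} (hP : IsSelfProduct i₁ i₂)
    {Q : PrismOver p (R₁ ⊗[W] O)} (j₁ j₂ : BKHom π φ₁ Q) : P.carrier →+* Q.carrier :=
  (hP _ (j₁.restrict g hg) (j₂.restrict g hg)).choose.toRingHom

theorem selfProductMap_eisenstein (g : R₀ →ₐ[W] R₁)
    (hg : (g : R₀ →+* R₁).comp φ = φ₁.comp (g : R₀ →+* R₁))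
    {P : PrismOver p (R₀ ⊗[W] O)} {i₁ i₂ : BKHom π φ P} (hP : IsSelfProduct i₁ i₂)
    {Q : PrismOver p (R₁ ⊗[W] O)} (j₁ j₂ : BKHom π φ₁ Q) :
    selfProductMap g hg hP j₁ j₂ (i₁.toRingHom (eisenstein W π R₀)) =
      j₁.toRingHom (eisenstein W π R₁) := by
  have h := (hP _ (j₁.restrict g hg) (j₂.restrict g hg)).choose_spec.1.1
  refine (RingHom.congr_fun h (eisenstein W π R₀)).trans ?_
  change j₁.toRingHom (PowerSeries.map (g : R₀ →+* R₁) (eisenstein W π R₀)) = _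
  rw [map_eisenstein]

end

/-! ### The rings `A[1/a]^∧_p` -/

/-- The `p`-adic completion of `A[1/a]`. -/
abbrev AwayCompl (p : ℕ) {A : Type u} [CommRing A] (a : A) : Type u :=
  PCompl p (Localization.Away a)

/-- The natural map from `A` to the `p`-adic completion of `A[1/a]`. -/
noncomputable def AwayCompl.of (p : ℕ) {A : Type u} [CommRing A] (a : A) : A →+* AwayCompl p a :=
  (algebraMap (Localization.Away a) (AwayCompl p a)).comp (algebraMap A (Localization.Away a))

/-- The map `A[1/a]^∧_p → B[1/b]^∧_p` induced by a ring map `A → B` with `a ↦ b`. -/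
noncomputable def AwayCompl.map (p : ℕ) {A B : Type u} [CommRing A] [CommRing B] (f : A →+* B)
    {a : A} {b : B} (h : f a = b) : AwayCompl p a →+* AwayCompl p b :=
  PCompl.map p (IsLocalization.Away.lift a
    (g := (algebraMap B (Localization.Away b)).comp f)
    (by rw [RingHom.comp_apply, h]; exact IsLocalization.Away.algebraMap_isUnit b))

/-! ### The base rings -/

/-- `A⟨T₁^{±1}, …, T_d^{±1}⟩`, the `p`-adic completion of the ring of Laurent polynomials in `d`
variables (the group ring of `ℤ^d`). -/
abbrev TateLaurent (p : ℕ) (A : Type u) [CommRing A] (d : ℕ) : Type u :=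
  PCompl p (AddMonoidAlgebra A (Fin d → ℤ))

/-- The coordinate `T_i`. -/
noncomputable def TateLaurent.coord (p : ℕ) (A : Type u) [CommRing A] {d : ℕ} (i : Fin d) :
    TateLaurent p A d :=
  algebraMap (AddMonoidAlgebra A (Fin d → ℤ)) _ (AddMonoidAlgebra.single (Pi.single i 1) 1)

/-- A finite extension `L` of the fraction field of `A` is totally ramified at `ϖ`: in the integral
closure of `A` in `L`, the ideal `(ϖ)` is the `[L : Frac A]`-th power of a prime ideal. -/
def IsTotallyRamified (A : Type u) [CommRing A] [IsDomain A] (ϖ : A) (L : Type u) [Field L]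
    [Algebra A L] [Algebra (FractionRing A) L] : Prop :=
  ∃ P : Ideal (integralClosure A L), P.IsPrime ∧
    Ideal.span {algebraMap A (integralClosure A L) ϖ} = P ^ Module.finrank (FractionRing A) L

section

variable (p : ℕ) [Fact p.Prime] (R₀ : Type u) [CommRing R₀]
  [hprime : (Ideal.span {(p : R₀)}).IsPrime]

/-- `𝒪_{L₀}`, the `p`-adic completion of the localization of `R₀` at the prime ideal `(p)`. -/
abbrev OL₀ : Type u := PCompl p (Localization.AtPrime (Ideal.span {(p : R₀)}))

variable {R₀}

theorem IsFrobeniusLift.span_eq_comap {φ : R₀ →+* R₀} (hφ : IsFrobeniusLift p φ) :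
    Ideal.span {(p : R₀)} = (Ideal.span {(p : R₀)}).comap φ := by
  ext x
  rw [Ideal.mem_comap, ← hprime.pow_mem_iff_mem p (Fact.out : p.Prime).pos]
  constructor
  · intro h
    simpa using add_mem (hφ x) h
  · intro h
    simpa using sub_mem h (hφ x)

/-- The Frobenius of `𝒪_{L₀}` induced by that of `R₀`. -/
noncomputable def frobL {φ : R₀ →+* R₀} (hφ : IsFrobeniusLift p φ) : OL₀ p R₀ →+* OL₀ p R₀ :=
  PCompl.map p (Localization.localRingHom _ _ φ (hφ.span_eq_comap p))

variable (W : Type u) [CommRing W] [Algebra W R₀]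

variable (R₀) in
/-- The natural map `R₀ → 𝒪_{L₀}`. -/
noncomputable def toOL₀ : R₀ →ₐ[W] OL₀ p R₀ :=
  { (algebraMap (Localization.AtPrime (Ideal.span {(p : R₀)})) (OL₀ p R₀)).comp
      (algebraMap R₀ (Localization.AtPrime (Ideal.span {(p : R₀)}))) with
    commutes' := fun w => by
      change algebraMap (Localization.AtPrime (Ideal.span {(p : R₀)})) (OL₀ p R₀)
        (algebraMap R₀ (Localization.AtPrime (Ideal.span {(p : R₀)})) (algebraMap W R₀ w)) = _
      rw [← IsScalarTower.algebraMap_apply W R₀]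
      rfl }

theorem toOL₀_comp {φ : R₀ →+* R₀} (hφ : IsFrobeniusLift p φ) :
    (toOL₀ p R₀ W : R₀ →+* OL₀ p R₀).comp φ =
      (frobL p hφ).comp (toOL₀ p R₀ W : R₀ →+* OL₀ p R₀) := by
  refine RingHom.ext fun x => ?_
  change algebraMap (Localization.AtPrime (Ideal.span {(p : R₀)})) (OL₀ p R₀)
      (algebraMap R₀ (Localization.AtPrime (Ideal.span {(p : R₀)})) (φ x)) =
    frobL p hφ (algebraMap (Localization.AtPrime (Ideal.span {(p : R₀)})) (OL₀ p R₀)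
      (algebraMap R₀ (Localization.AtPrime (Ideal.span {(p : R₀)})) x))
  rw [frobL, PCompl.map_algebraMap, Localization.localRingHom_to_map]

end

end PrismIntersection

/-!
Why the intersection formula holds.

Let `S = R₀⟦u⟧`, with coordinates `x_j` (namely `u, T_1, …, T_d`) on which the Frobenius is the `p`-th
power map. The prism `(S, (E))` is transversal: `(p, E)` is a regular sequence. The self-product is
constructed by hand. In the free `δ`-ring over `S` on variables `z_j`, which is the polynomial ring in
the `z_{j,n} = δ^n(z_j)`, one imposes that the second copy `y_j = x_j + E z_j` of each coordinate
satisfies `δ(y_j) = 0`, that is, the equations `δ^(n+1)(x_j + E z_j) = 0`, and then one completes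
`(p, E)`-adically (`TransversalPrism.Env`). As `δ(E)` is a unit, modulo `(p, E)` the `n`-th equation
reads, up to a unit, `z_{j,n} ^ p + s z_{j,n} + t = 0` with `s`, `t` involving only earlier variables
(`TransversalPrism.exists_rel_eq`). For such a triangular system the monomials with exponents less
than `p` are a basis of the quotient modulo every power of `(p, E)`
(`TransversalPrism.exists_reducedPoly_sub_mem`, `TransversalPrism.toEnv_mem_iff_of_reducedPoly`).
Hence the self-product is again transversal, and the formation of its basis is compatible with
`S → S_L`, so that the map of self-products is injective modulo `(p, E)`
(`TransversalPrism.mem_envJ_of_map_mem`).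

For the universal property (`IsBKBase.isSelfProduct`) one needs that maps out of `R₀` are determined
by the images of the `T_i` and a reduction, and exist for prescribed lifts of the `T_i`. This follows
from unique lifting along nilpotent thickenings (`LiftsUniquely`), which passes from Laurent
polynomials to completions, étale algebras and localizations. In a target `(Y, I)`, the ideal `I` is
generated by the image of `E` by rigidity (`IsBoundedPrism.eq_span`), and `Y` is classically complete,
so that the differences of the two images of `x_j` are uniquely divisible by `E`; these quotients are
the images of the `z_j`.

Finally let `A → B` be the map of self-products. It is injective modulo `(p, E)`, hence modulo `p` as
`A / p` is `E`-adically separated and `E` is a nonzerodivisor on `B / p`, hence modulo every `p ^ n`.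
If `E b = f(a) + p ^ n c`, then injectivity modulo `(p, E)` permits to divide by `E`, so that
`b ∈ f(A) + p ^ n B`. Thus an element of `B` which lies in `A[1/E]^∧_p` is approximated `p`-adically by
elements of `A`, and `A` is `p`-adically complete (`intersection_of_injective_mod`).
-/

namespace PrismIntersection

/-! ### `δ`-rings -/

section Delta

variable {p : ℕ}

/-- The polynomial `((x + y) ^ p - x ^ p - y ^ p) / p`, which measures the failure of additivity
of `δ`. -/
def deltaCross (p : ℕ) {A : Type u} [CommRing A] (x y : A) : A :=
  ∑ i ∈ Finset.Ioo 0 p, ((p.choose i / p : ℕ) : A) * x ^ i * y ^ (p - i)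

theorem add_pow_eq_deltaCross (hp : p.Prime) {A : Type u} [CommRing A] (x y : A) :
    (x + y) ^ p = x ^ p + y ^ p + p * deltaCross p x y := by
  obtain ⟨q, rfl⟩ : ∃ q, p = q + 1 := ⟨p - 1, (Nat.succ_pred_prime hp).symm⟩
  have hI : Finset.Ioo 0 (q + 1) = Finset.Ico 1 (q + 1) := by
    ext; simp [Nat.succ_le_iff]
  rw [add_pow, Finset.sum_range_succ, Finset.range_eq_Ico,
    Finset.sum_eq_sum_Ico_succ_bot (Nat.succ_pos q), deltaCross, hI, Finset.mul_sum]
  have : ∀ i ∈ Finset.Ico 1 (q + 1), x ^ i * y ^ (q + 1 - i) * ((q + 1).choose i : A) =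
      ((q + 1 : ℕ) : A) * ((((q + 1).choose i / (q + 1) : ℕ) : A) * x ^ i * y ^ (q + 1 - i)) := by
    intro i hi
    rw [Finset.mem_Ico] at hi
    have hd : (q + 1) ∣ (q + 1).choose i := hp.dvd_choose_self (by omega) hi.2
    have : ((q + 1).choose i : A) = ((q + 1 : ℕ) : A) * (((q + 1).choose i / (q + 1) : ℕ) : A) := by
      rw [← Nat.cast_mul, Nat.mul_div_cancel' hd]
    rw [this]
    ring
  rw [show (0 + 1 : ℕ) = 1 from rfl, Finset.sum_congr rfl this]
  simp
  ring

theorem deltaCross_mem_left {A : Type u} [CommRing A] (J : Ideal A) {x : A} (hx : x ∈ J) (y : A) :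
    deltaCross p x y ∈ J := by
  refine Ideal.sum_mem _ fun i hi => ?_
  rw [Finset.mem_Ioo] at hi
  exact J.mul_mem_right _ (J.mul_mem_left _ (J.pow_mem_of_mem hx _ hi.1))

theorem deltaCross_mem_right {A : Type u} [CommRing A] (J : Ideal A) (x : A) {y : A} (hy : y ∈ J) :
    deltaCross p x y ∈ J := by
  refine Ideal.sum_mem _ fun i hi => ?_
  rw [Finset.mem_Ioo] at hi
  exact J.mul_mem_left _ (J.pow_mem_of_mem hy _ (by omega))

theorem map_deltaCross {A B : Type u} [CommRing A] [CommRing B] (f : A →+* B) (x y : A) :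
    f (deltaCross p x y) = deltaCross p (f x) (f y) := by
  simp [deltaCross]

theorem deltaCross_mem_subring {A : Type u} [CommRing A] (U : Subring A) {x y : A}
    (hx : x ∈ U) (hy : y ∈ U) : deltaCross p x y ∈ U :=
  sum_mem fun _ _ => mul_mem (mul_mem (natCast_mem _ _) (pow_mem hx _)) (pow_mem hy _)

namespace DeltaRing

variable {A B : Type u} [CommRing A] [CommRing B]

/-- A `p`-torsion free ring with a lift of Frobenius `φ` is a `δ`-ring, with
`δ(x) = (φ(x) - x ^ p) / p`. -/
@[reducible]
noncomputable def ofFrobeniusLift (hp : p.Prime) (htf : ∀ x : A, (p : A) * x = 0 → x = 0)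
    (φ : A →+* A) (hφ : IsFrobeniusLift p φ) : DeltaRing p A :=
  have hc : ∀ x, ∃ y, φ x - x ^ p = p * y := fun x => Ideal.mem_span_singleton'.1 (hφ x) |>.imp
    fun y hy => by rw [← hy, mul_comm]
  have hcan : ∀ x y : A, (p : A) * x = p * y → x = y := fun x y h =>
    sub_eq_zero.1 (htf _ (by rw [mul_sub, h, sub_self]))
  { delta := fun x => (hc x).choose
    delta_zero := hcan _ _ (by rw [← (hc 0).choose_spec]; simp [hp.ne_zero])
    delta_one := hcan _ _ (by rw [← (hc 1).choose_spec]; simp)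
    delta_mul := fun x y => hcan _ _ (by
      have h1 := (hc x).choose_spec
      have h2 := (hc y).choose_spec
      rw [← (hc (x * y)).choose_spec, map_mul]
      generalize (hc x).choose = a at h1 ⊢
      generalize (hc y).choose = b at h2 ⊢
      linear_combination φ y * h1 + (x ^ p + p * a) * h2)
    delta_add := fun x y => hcan _ _ (by
      change _ = _ * (_ - deltaCross p x y)
      rw [← (hc (x + y)).choose_spec, mul_sub, mul_add, ← (hc x).choose_spec, ← (hc y).choose_spec,
        map_add, add_pow_eq_deltaCross hp]
      ring) }

theorem mul_delta_ofFrobeniusLift (hp : p.Prime) (htf : ∀ x : A, (p : A) * x = 0 → x = 0)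
    (φ : A →+* A) (hφ : IsFrobeniusLift p φ) (x : A) :
    letI := ofFrobeniusLift hp htf φ hφ
    (p : A) * delta p x = φ x - x ^ p := by
  have hc : ∃ y, φ x - x ^ p = p * y := Ideal.mem_span_singleton'.1 (hφ x) |>.imp
    fun y hy => by rw [← hy, mul_comm]
  exact hc.choose_spec.symm

variable [DeltaRing p A] [DeltaRing p B]

theorem delta_add' (x y : A) : delta p (x + y) = delta p x + delta p y - deltaCross p x y :=
  delta_add x y

theorem delta_mul' (x y : A) : delta p (x * y) = frob p x * delta p y + y ^ p * delta p x := by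
  rw [delta_mul, frob]
  ring

theorem frob_mem {J : Ideal A} (hp : p ≠ 0) (hpJ : (p : A) ∈ J) {x : A} (hx : x ∈ J) :
    frob p x ∈ J :=
  J.add_mem (J.pow_mem_of_mem hx _ (Nat.pos_of_ne_zero hp)) (J.mul_mem_right _ hpJ)

/-- If `p ∈ J`, then `δ` maps `J ^ (n + 1)` into `J ^ n`. -/
theorem delta_mem_pow (hp : p ≠ 0) {J : Ideal A} (hpJ : (p : A) ∈ J) (n : ℕ) :
    ∀ {x : A}, x ∈ J ^ (n + 1) → delta p x ∈ J ^ n := by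
  induction n with
  | zero => simp
  | succ n ih =>
    intro x hx
    rw [pow_succ'] at hx
    -- both `x` and `δ(x)` are tracked, as the cross term of a sum involves the summands themselves
    refine (Submodule.mul_induction_on hx (C := fun x => x ∈ J ^ (n + 1) ∧ delta p x ∈ J ^ (n + 1))
      ?_ ?_).2
    · intro j hj m hm
      refine ⟨Ideal.mul_mem_left _ _ hm, ?_⟩
      rw [delta_mul']
      refine add_mem ?_ ?_
      · rw [pow_succ']
        exact Ideal.mul_mem_mul (frob_mem hp hpJ hj) (ih hm)
      · exact Ideal.mul_mem_right _ _ (Ideal.pow_mem_of_mem _ hm _ (Nat.pos_of_ne_zero hp))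
    · rintro x y ⟨hx, hx'⟩ ⟨hy, hy'⟩
      refine ⟨add_mem hx hy, ?_⟩
      rw [delta_add']
      exact sub_mem (add_mem hx' hy') (deltaCross_mem_left _ hx _)

theorem delta_sub_mem_pow (hp : p ≠ 0) {J : Ideal A} (hpJ : (p : A) ∈ J) (n : ℕ) {x y : A}
    (h : x - y ∈ J ^ (n + 1)) : delta p x - delta p y ∈ J ^ n := by
  have h1 : delta p x = delta p (y + (x - y)) := by rw [add_sub_cancel]
  rw [h1, delta_add', show delta p y + delta p (x - y) - deltaCross p y (x - y) - delta p y =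
    delta p (x - y) - deltaCross p y (x - y) by ring]
  exact sub_mem (delta_mem_pow hp hpJ n h)
    (deltaCross_mem_right _ _ (Ideal.pow_le_pow_right n.le_succ h))

theorem delta_neg_one : delta p (-1 : A) = deltaCross p 1 (-1) := by
  have h := delta_add' (p := p) (1 : A) (-1)
  rw [add_neg_cancel, delta_zero, delta_one, zero_add] at h
  exact (sub_eq_zero.1 h.symm)

/-- The elements on which a ring map between `δ`-rings commutes with `δ` form a subring. -/
def eqSubring (p : ℕ) [DeltaRing p A] [DeltaRing p B] (f : A →+* B) : Subring A where
  carrier := {x | f (delta p x) = delta p (f x)}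
  mul_mem' {x y} (hx : _ = _) (hy : _ = _) := by
    simp [delta_mul, hx, hy]
  one_mem' := by simp [delta_one]
  add_mem' {x y} (hx : _ = _) (hy : _ = _) := by
    simp [delta_add', hx, hy, map_deltaCross]
  zero_mem' := by simp [delta_zero]
  neg_mem' {x} (hx : _ = _) := by
    change f (delta p (-x)) = delta p (f (-x))
    rw [neg_eq_neg_one_mul, delta_mul, map_mul f (-1) x, delta_mul, ← hx, map_neg, map_one,
      delta_neg_one, delta_neg_one]
    simp [map_deltaCross]

theorem mem_eqSubring (f : A →+* B) (x : A) :
    x ∈ eqSubring p f ↔ f (delta p x) = delta p (f x) := Iff.rfl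

/-- A ring map between `δ`-rings which is continuous for the adic topologies commutes with `δ` if
it does so on a dense set. -/
theorem map_delta_of_dense (hp : p ≠ 0) (f : A →+* B) {J : Ideal A} {J' : Ideal B}
    (hJ : (p : A) ∈ J) (hJ' : (p : B) ∈ J') [IsHausdorff J' B] (hf : J ≤ J'.comap f) (s : Set A)
    (hs : ∀ x ∈ s, f (delta p x) = delta p (f x))
    (hd : ∀ (x : A) (n : ℕ), ∃ y ∈ s, x - y ∈ J ^ n) (x : A) :
    f (delta p x) = delta p (f x) := by
  refine sub_eq_zero.1 (IsHausdorff.haus (I := J') inferInstance _ fun n => ?_)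
  rw [SModEq.zero, smul_eq_mul, Ideal.mul_top]
  obtain ⟨y, hy, hxy⟩ := hd x (n + 1)
  have hmap : ∀ {n : ℕ} {a : A}, a ∈ J ^ n → f a ∈ J' ^ n := fun {n a} ha => by
    have := Ideal.mem_map_of_mem f ha
    rw [Ideal.map_pow] at this
    exact Ideal.pow_right_mono (Ideal.map_le_iff_le_comap.2 hf) n this
  have h1 := hmap (delta_sub_mem_pow hp hJ n hxy)
  have h2 := delta_sub_mem_pow (p := p) hp hJ' n (x := f x) (y := f y)
    (by rw [← map_sub]; exact hmap hxy)
  rw [map_sub, hs y hy] at h1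
  simpa using sub_mem h1 h2

end DeltaRing

end Delta

/-! ### Classical and derived completeness -/

section Complete

variable {A : Type u} [CommRing A]

theorem eq_zero_of_forall_mem_pow (J : Ideal A) [IsHausdorff J A] {x : A}
    (h : ∀ n, x ∈ J ^ n) : x = 0 :=
  IsHausdorff.haus (I := J) inferInstance _ fun n => by
    simpa [SModEq.zero] using h n

theorem exists_limit (J : Ideal A) [IsPrecomplete J A] (y : ℕ → A)
    (h : ∀ n, y (n + 1) - y n ∈ J ^ n) : ∃ L, ∀ n, L - y n ∈ J ^ n := by
  have hc : ∀ {m n}, m ≤ n → y n - y m ∈ J ^ m := by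
    intro m n hmn
    induction n, hmn using Nat.le_induction with
    | base => simp
    | succ n hmn ih =>
      rw [← sub_add_sub_cancel]
      exact add_mem (Ideal.pow_le_pow_right hmn (h n)) ih
  obtain ⟨L, hL⟩ := IsPrecomplete.prec (I := J) inferInstance (f := y) fun {m n} hmn => by
    rw [SModEq.comm, SModEq.sub_mem]
    simpa using hc hmn
  refine ⟨L, fun n => ?_⟩
  have := (hL n).symm
  rw [SModEq.sub_mem] at this
  simpa using this

theorem isPrecomplete_of_exists_limit (J : Ideal A)
    (h : ∀ y : ℕ → A, (∀ n, y (n + 1) - y n ∈ J ^ n) → ∃ L, ∀ n, L - y n ∈ J ^ n) :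
    IsPrecomplete J A := by
  refine ⟨fun f hf => ?_⟩
  obtain ⟨L, hL⟩ := h f fun n => by
    have := (hf n.le_succ).symm
    rw [SModEq.sub_mem] at this
    simpa using this
  refine ⟨L, fun n => ?_⟩
  rw [SModEq.comm, SModEq.sub_mem]
  simpa using hL n

theorem isHausdorff_of_forall (J : Ideal A) (h : ∀ x : A, (∀ n, x ∈ J ^ n) → x = 0) :
    IsHausdorff J A :=
  ⟨fun x hx => h x fun n => by simpa [SModEq.zero] using hx n⟩

/-- `A` is derived complete with respect to the element `f`. -/
def IsDerivedCompleteAt (f : A) : Prop :=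
  Function.Bijective (fun (x : ℕ → A) (n : ℕ) => x n - f * x (n + 1))

theorem isDerivedCompleteAt_of_isAdicComplete (J : Ideal A) [IsAdicComplete J A] {f : A}
    (hf : f ∈ J) : IsDerivedCompleteAt f := by
  constructor
  · intro x y hxy
    have hz : ∀ k n, x n - y n = f ^ k * (x (n + k) - y (n + k)) := by
      intro k
      induction k with
      | zero => simp
      | succ k ih =>
        intro n
        have h := congr_fun hxy (n + k)
        simp only at h
        rw [ih n, ← add_assoc]
        linear_combination f ^ k * h
    funext n
    refine sub_eq_zero.1 (eq_zero_of_forall_mem_pow J fun k => ?_)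
    rw [hz k n]
    exact Ideal.mul_mem_right _ _ (Ideal.pow_mem_pow hf k)
  · intro c
    have hl : ∀ n, ∃ L, ∀ m, L - ∑ k ∈ Finset.range m, f ^ k * c (n + k) ∈ J ^ m := fun n =>
      exists_limit J _ fun m => by
        rw [Finset.sum_range_succ, add_sub_cancel_left]
        exact Ideal.mul_mem_right _ _ (Ideal.pow_mem_pow hf m)
    choose x hx using hl
    refine ⟨x, funext fun n => sub_eq_zero.1 (eq_zero_of_forall_mem_pow J fun m => ?_)⟩
    have h1 := Ideal.pow_le_pow_right m.le_succ (hx n (m + 1))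
    have h2 := Ideal.mul_mem_left _ f (hx (n + 1) m)
    rw [Finset.sum_range_succ'] at h1
    have h3 := sub_mem h1 h2
    rw [mul_sub, Finset.mul_sum] at h3
    have h4 : ∀ k, f * (f ^ k * c (n + 1 + k)) = f ^ (k + 1) * c (n + (k + 1)) := fun k => by
      rw [pow_succ', mul_assoc, add_assoc, add_comm 1 k]
    simp only [h4] at h3
    convert h3 using 1
    simp
    ring

namespace IsDerivedCompleteAt

variable {f : A} (hf : IsDerivedCompleteAt f)
include hf

/-- Geometric sums `∑ f ^ k c_k` exist in a derived `f`-complete ring. -/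
theorem exists_sum (c : ℕ → A) :
    ∃ s, ∀ n, ∃ t, s = ∑ k ∈ Finset.range n, f ^ k * c k + f ^ n * t := by
  obtain ⟨x, hx⟩ := hf.2 c
  refine ⟨x 0, fun n => ⟨x n, ?_⟩⟩
  induction n with
  | zero => simp
  | succ n ih =>
    rw [Finset.sum_range_succ, ih, ← congr_fun hx n]
    ring

theorem eq_zero_of_forall_dvd (h0 : ∀ x : A, f * x = 0 → x = 0) {x : A}
    (h : ∀ n, f ^ n ∣ x) : x = 0 := by
  have hpow : ∀ n, ∀ x : A, f ^ n * x = 0 → x = 0 := by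
    intro n
    induction n with
    | zero => simp
    | succ n ih => exact fun x hx => h0 x (ih _ (by rw [← hx]; ring))
  choose y hy using h
  have : y = 0 := by
    refine hf.1 (funext fun n => ?_)
    simp only [Pi.zero_apply, mul_zero, sub_zero]
    refine hpow n _ ?_
    rw [mul_sub, ← hy n, ← mul_assoc, ← pow_succ, ← hy (n + 1), sub_self]
  rw [hy 0, this]
  simp

end IsDerivedCompleteAt

theorem mem_sup_span_singleton {a b x : A} :
    x ∈ Ideal.span {a} ⊔ Ideal.span {b} ↔ ∃ s t, x = a * s + b * t := by
  rw [← Ideal.span_union, Set.singleton_union, Ideal.mem_span_pair]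
  constructor
  · rintro ⟨s, t, rfl⟩
    exact ⟨s, t, by ring⟩
  · rintro ⟨s, t, rfl⟩
    exact ⟨s, t, by ring⟩

theorem left_mem_sup_span (a b : A) : a ∈ Ideal.span {a} ⊔ Ideal.span {b} :=
  Ideal.mem_sup_left (Ideal.mem_span_singleton_self a)

theorem right_mem_sup_span (a b : A) : b ∈ Ideal.span {a} ⊔ Ideal.span {b} :=
  Ideal.mem_sup_right (Ideal.mem_span_singleton_self b)

theorem exists_of_mem_sup_span_pow (a b : A) (n : ℕ) :
    ∀ x ∈ (Ideal.span {a} ⊔ Ideal.span {b}) ^ (n + 1),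
      ∃ y ∈ (Ideal.span {a} ⊔ Ideal.span {b}) ^ n, ∃ c, x = a * y + b ^ (n + 1) * c := by
  induction n with
  | zero =>
    intro x hx
    rw [zero_add, pow_one, mem_sup_span_singleton] at hx
    obtain ⟨s, t, rfl⟩ := hx
    exact ⟨s, by simp, t, by ring⟩
  | succ n ih =>
    intro x hx
    rw [pow_succ'] at hx
    refine Submodule.mul_induction_on hx ?_ ?_
    · intro j hj m hm
      obtain ⟨s, t, rfl⟩ := mem_sup_span_singleton.1 hj
      obtain ⟨y, hy, c, hc⟩ := ih m hm
      refine ⟨s * m + t * (b * y), add_mem (Ideal.mul_mem_left _ _ hm)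
        (Ideal.mul_mem_left _ _ ?_), t * c, by rw [hc]; ring⟩
      rw [pow_succ']
      exact Ideal.mul_mem_mul (right_mem_sup_span a b) hy
    · rintro x y ⟨x', hx', c, rfl⟩ ⟨y', hy', d, rfl⟩
      exact ⟨x' + y', add_mem hx' hy', c + d, by ring⟩

/-- If `a` is a nonzerodivisor modulo the nonzerodivisor `b`, then multiplication by `b` is strict
for the `(a, b)`-adic filtration. -/
theorem mem_pow_of_mul_mem_pow {a b : A} (hb : ∀ x, b * x = 0 → x = 0)
    (hab : ∀ x y, a * x = b * y → ∃ z, x = b * z) (n : ℕ) {x : A}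
    (h : b * x ∈ (Ideal.span {a} ⊔ Ideal.span {b}) ^ (n + 1)) :
    x ∈ (Ideal.span {a} ⊔ Ideal.span {b}) ^ n := by
  have hpow : ∀ m x y, a ^ m * x = b * y → ∃ z, x = b * z := by
    intro m
    induction m with
    | zero => exact fun x y h => ⟨y, by simpa using h⟩
    | succ m ih =>
      intro x y h
      obtain ⟨z, hz⟩ := hab (a ^ m * x) y (by rw [← h]; ring)
      exact ih x z hz
  rw [sup_comm] at h ⊢
  obtain ⟨y, hy, c, hc⟩ := exists_of_mem_sup_span_pow b a n _ h
  obtain ⟨z, rfl⟩ := hpow (n + 1) c (x - y) (by linear_combination -hc)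
  have : x = y + a ^ (n + 1) * z :=
    sub_eq_zero.1 (hb _ (by linear_combination hc))
  rw [this]
  exact add_mem hy (Ideal.mul_mem_right _ _ (Ideal.pow_le_pow_right n.le_succ
    (Ideal.pow_mem_pow (right_mem_sup_span b a) _)))

theorem mem_pow_of_mul_mem_pow' {a b : A} (hb : ∀ x, b * x = 0 → x = 0)
    (hab : ∀ x y, a * x = b * y → ∃ z, x = b * z) (n : ℕ) {x : A}
    (h : a * x ∈ (Ideal.span {a} ⊔ Ideal.span {b}) ^ (n + 1)) :
    x ∈ (Ideal.span {a} ⊔ Ideal.span {b}) ^ n := by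
  obtain ⟨y, hy, c, hc⟩ := exists_of_mem_sup_span_pow a b n _ h
  obtain ⟨z, hz⟩ := hab (x - y) (b ^ n * c) (by rw [pow_succ] at hc; linear_combination hc)
  -- `a z = b ^ n c`, and one descends through the powers of `b`
  have key : ∀ (m : ℕ) (x c : A), a * x = b ^ m * c → ∃ z, x = b ^ m * z := by
    intro m
    induction m with
    | zero => exact fun x c _ => ⟨x, by simp⟩
    | succ m ih =>
      intro x c h
      obtain ⟨w, rfl⟩ := hab x (b ^ m * c) (by rw [h]; ring)
      obtain ⟨v, rfl⟩ := ih w c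
        (sub_eq_zero.1 (hb _ (by rw [pow_succ] at h; linear_combination h)))
      exact ⟨v, by ring⟩
  obtain ⟨v, hv⟩ := key (n + 1) (x - y) c (by linear_combination hc)
  rw [sub_eq_iff_eq_add.1 hv]
  exact add_mem (Ideal.mul_mem_right _ _ (Ideal.pow_le_pow_right n.le_succ
    (Ideal.pow_mem_pow (right_mem_sup_span a b) _))) hy

/-- A ring which is derived `(a, b)`-complete, with `a` a nonzerodivisor and `A / a` of bounded
`b`-power torsion, is classically `(a, b)`-complete. -/
theorem isAdicComplete_of_isDerivedCompleteAt {a b : A} (ha : ∀ x, a * x = 0 → x = 0)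
    (hda : IsDerivedCompleteAt a) (hdb : IsDerivedCompleteAt b) (n₀ : ℕ)
    (hbd : ∀ m x, a ∣ b ^ m * x → a ∣ b ^ n₀ * x) :
    IsAdicComplete (Ideal.span {a} ⊔ Ideal.span {b}) A := by
  set J := Ideal.span {a} ⊔ Ideal.span {b} with hJ
  have haJ : a ∈ J := left_mem_sup_span a b
  have hbJ : b ∈ J := right_mem_sup_span a b
  have hK : ∀ x, (∀ n, x ∈ J ^ n) → ∃ y, (∀ n, y ∈ J ^ n) ∧ x = a * y := by
    intro x hx
    have h := fun n => exists_of_mem_sup_span_pow a b n x (hx _)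
    choose y hy c hc using h
    have h1 : ∀ n, a ∣ b ^ n₀ * (c n - b * c (n + 1)) := fun n =>
      hbd (n + 1) _ ⟨y (n + 1) - y n, by linear_combination hc (n + 1) - hc n⟩
    choose d hd using h1
    obtain ⟨e, he⟩ := hdb.2 d
    have h2 : (fun n => b ^ n₀ * c n - a * e n) = 0 := by
      refine hdb.1 (funext fun n => ?_)
      have := congr_fun he n
      simp only [Pi.zero_apply, mul_zero, sub_zero] at this ⊢
      linear_combination hd n - a * this
    obtain ⟨z, hz⟩ : ∃ z, x = a * z := by
      refine ⟨y n₀ + b * e n₀, ?_⟩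
      have := congr_fun h2 n₀
      simp only [Pi.zero_apply] at this
      rw [hc n₀]
      linear_combination b * this
    refine ⟨z, fun n => ?_, hz⟩
    obtain ⟨y, hy, c, hc⟩ := exists_of_mem_sup_span_pow a b (n + n₀) x (hx _)
    obtain ⟨d, hd⟩ := hbd (n + n₀ + 1) c ⟨z - y, by linear_combination hz - hc⟩
    have : z = y + b ^ (n + 1) * d := by
      refine sub_eq_zero.1 (ha _ ?_)
      have h3 : b ^ (n + n₀ + 1) * c = b ^ (n + 1) * (b ^ n₀ * c) := by ring
      rw [h3, hd] at hc
      linear_combination hc - hz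
    rw [this]
    exact add_mem (Ideal.pow_le_pow_right (by omega) hy)
      (Ideal.mul_mem_right _ _ (Ideal.pow_le_pow_right n.le_succ (Ideal.pow_mem_pow hbJ _)))
  have hH : IsHausdorff J A := isHausdorff_of_forall J fun x hx => by
    refine hda.eq_zero_of_forall_dvd ha fun n => ?_
    suffices ∀ x, (∀ n, x ∈ J ^ n) → a ^ n ∣ x from this x hx
    induction n with
    | zero => simp
    | succ n ih =>
      intro x hx
      obtain ⟨y, hy, rfl⟩ := hK x hx
      rw [pow_succ']
      exact mul_dvd_mul_left _ (ih y hy)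
  have hP : IsPrecomplete J A := isPrecomplete_of_exists_limit J fun y hy => by
    have hc : ∀ {m n}, m ≤ n → y n - y m ∈ J ^ m := by
      intro m n hmn
      induction n, hmn using Nat.le_induction with
      | base => simp
      | succ n hmn ih =>
        rw [← sub_add_sub_cancel]
        exact add_mem (Ideal.pow_le_pow_right hmn (hy n)) ih
    have h : ∀ n, ∃ s t, y (2 * (n + 1)) - y (2 * n) = a ^ n * s + b ^ n * t := by
      intro n
      have h1 : y (2 * (n + 1)) - y (2 * n) ∈ J ^ (n + n) := by
        rw [← two_mul]
        exact hc (by omega)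
      have h2 := Ideal.sup_pow_add_le_pow_sup_pow h1
      rw [Ideal.span_singleton_pow, Ideal.span_singleton_pow] at h2
      exact mem_sup_span_singleton.1 h2
    choose s t hst using h
    obtain ⟨S, hS⟩ := hda.exists_sum s
    obtain ⟨T, hT⟩ := hdb.exists_sum t
    have hsum : ∀ n, y (2 * n) = y 0 + ∑ k ∈ Finset.range n, a ^ k * s k +
        ∑ k ∈ Finset.range n, b ^ k * t k := by
      intro n
      induction n with
      | zero => simp
      | succ n ih =>
        rw [Finset.sum_range_succ, Finset.sum_range_succ]
        linear_combination hst n + ih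
    refine ⟨y 0 + S + T, fun n => ?_⟩
    obtain ⟨S', hS'⟩ := hS n
    obtain ⟨T', hT'⟩ := hT n
    have : y 0 + S + T - y n = (a ^ n * S' + b ^ n * T') + (y (2 * n) - y n) := by
      rw [hS', hT', hsum n]
      ring
    rw [this]
    exact add_mem (add_mem (Ideal.mul_mem_right _ _ (Ideal.pow_mem_pow haJ _))
      (Ideal.mul_mem_right _ _ (Ideal.pow_mem_pow hbJ _))) (hc (by omega))
  exact { haus' := hH.haus', prec' := hP.prec' }

/-- If multiplication by `t` is strict for the `J`-adic filtration of the `J`-adically complete ring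
`A`, then the ideal `(t)` is closed. -/
theorem dvd_of_forall_mem_sup_pow (J : Ideal A) [IsAdicComplete J A] {t : A}
    (ht : ∀ n x, t * x ∈ J ^ (n + 1) → x ∈ J ^ n) {x : A}
    (hx : ∀ n, ∃ y, x - t * y ∈ J ^ n) : t ∣ x := by
  choose y hy using fun n => hx (n + 1)
  obtain ⟨L, hL⟩ := exists_limit J y fun n => ht n _ (by
    have := sub_mem (hy n) (Ideal.pow_le_pow_right n.succ.le_succ (hy (n + 1)))
    convert this using 1
    ring)
  refine ⟨L, sub_eq_zero.1 (eq_zero_of_forall_mem_pow J fun n => ?_)⟩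
  have := sub_mem (Ideal.pow_le_pow_right n.le_succ (hy n)) (Ideal.mul_mem_left _ t (hL n))
  convert this using 1
  ring

theorem map_mem_pow {B : Type u} [CommRing B] {f : A →+* B} {J : Ideal A} {J' : Ideal B}
    (hf : J ≤ J'.comap f) {n : ℕ} {a : A} (ha : a ∈ J ^ n) : f a ∈ J' ^ n := by
  have := Ideal.mem_map_of_mem f ha
  rw [Ideal.map_pow] at this
  exact Ideal.pow_right_mono (Ideal.map_le_iff_le_comap.2 hf) n this

/-- Two continuous maps to an adically separated ring which agree on a dense set are equal. -/
theorem ringHom_ext_of_dense {B : Type u} [CommRing B] {f g : A →+* B} {J : Ideal A} {J' : Ideal B}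
    [IsHausdorff J' B] (hf : J ≤ J'.comap f) (hg : J ≤ J'.comap g) (s : Set A)
    (hs : ∀ x ∈ s, f x = g x) (hd : ∀ (x : A) (n : ℕ), ∃ y ∈ s, x - y ∈ J ^ n) : f = g := by
  refine RingHom.ext fun x => sub_eq_zero.1 (eq_zero_of_forall_mem_pow J' fun n => ?_)
  obtain ⟨y, hy, hxy⟩ := hd x n
  have := sub_mem (map_mem_pow hf hxy) (map_mem_pow hg hxy)
  rw [map_sub, map_sub, hs y hy] at this
  simpa using this

end Complete

/-! ### Adic completions of rings -/

section Completion

variable {D Y : Type u} [CommRing D] [CommRing Y]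

theorem mem_map_pow_iff_evalₐ_eq_zero {I : Ideal D} (hI : I.FG) (x : AdicCompletion I D) (n : ℕ) :
    x ∈ (I.map (algebraMap D (AdicCompletion I D))) ^ n ↔ AdicCompletion.evalₐ I n x = 0 := by
  have h1 := AdicCompletion.pow_smul_top_eq_ker_eval (M := D) (n := n) hI
  rw [Ideal.smul_top_eq_map] at h1
  have h2 := SetLike.ext_iff.1 h1 x
  rw [Submodule.restrictScalars_mem, LinearMap.mem_ker, Ideal.map_pow] at h2
  rw [h2]
  have h3 := AdicCompletion.factor_eval_eq_evalₐ (I := I) x (n := n) (by simp)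
  have h4 := AdicCompletion.factor_evalₐ_eq_eval (I := I) x (n := n) (by simp)
  constructor
  · intro h
    rw [← h3, h, map_zero]
  · intro h
    rw [← h4, h, map_zero]

theorem isAdicComplete_map_completion {I : Ideal D} (hI : I.FG) :
    IsAdicComplete (I.map (algebraMap D (AdicCompletion I D))) (AdicCompletion I D) :=
  (IsAdicComplete.map_algebraMap_iff _ _).2 (AdicCompletion.isAdicComplete hI)

theorem algebraMap_mem_map_pow_iff {I : Ideal D} (hI : I.FG) (x : D) (n : ℕ) :
    algebraMap D (AdicCompletion I D) x ∈ (I.map (algebraMap D (AdicCompletion I D))) ^ n ↔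
      x ∈ I ^ n := by
  rw [mem_map_pow_iff_evalₐ_eq_zero hI, AlgHom.commutes, Ideal.Quotient.algebraMap_eq,
    Ideal.Quotient.eq_zero_iff_mem]

theorem exists_sub_algebraMap_mem {I : Ideal D} (hI : I.FG) (x : AdicCompletion I D) (n : ℕ) :
    ∃ d : D, x - algebraMap D (AdicCompletion I D) d ∈
      (I.map (algebraMap D (AdicCompletion I D))) ^ n := by
  obtain ⟨d, hd⟩ := Ideal.Quotient.mk_surjective (AdicCompletion.evalₐ I n x)
  refine ⟨d, ?_⟩
  rw [mem_map_pow_iff_evalₐ_eq_zero hI, map_sub, AlgHom.commutes, Ideal.Quotient.algebraMap_eq, hd,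
    sub_self]

/-- The continuous extension to the completion of a map to an adically complete ring. -/
theorem exists_extension {I : Ideal D} {J : Ideal Y} [IsAdicComplete J Y] (f : D →+* Y)
    (hf : I ≤ J.comap f) :
    ∃ g : AdicCompletion I D →+* Y, ∀ d, g (algebraMap D (AdicCompletion I D) d) = f d := by
  have hle : ∀ n, I ^ n ≤ (J ^ n).comap f := fun n x hx => map_mem_pow hf hx
  have hcompat : ∀ {m n : ℕ} (hle' : m ≤ n), (Ideal.Quotient.factorPow J hle').comp
      ((Ideal.quotientMap (J ^ n) f (hle n)).comp (AdicCompletion.evalₐ I n).toRingHom) =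
      (Ideal.quotientMap (J ^ m) f (hle m)).comp (AdicCompletion.evalₐ I m).toRingHom := by
    intro m n hmn
    ext x
    obtain ⟨x, rfl⟩ := AdicCompletion.mk_surjective _ _ x
    simp only [RingHom.comp_apply, AlgHom.toRingHom_eq_coe, RingHom.coe_coe,
      AdicCompletion.evalₐ_mk, Ideal.quotientMap_mk]
    have h := AdicCompletion.Ideal.mk_eq_mk _ hmn x
    rw [Ideal.Quotient.eq] at h
    change Ideal.Quotient.mk _ (f (x.val n)) = Ideal.Quotient.mk _ (f (x.val m))
    rw [Ideal.Quotient.eq, ← map_sub]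
    exact hle m h
  refine ⟨IsAdicComplete.liftRingHom J _ hcompat, fun d => ?_⟩
  refine sub_eq_zero.1 (eq_zero_of_forall_mem_pow J fun n => ?_)
  rw [← Ideal.Quotient.eq, IsAdicComplete.mk_liftRingHom]
  simp [Ideal.quotientMap_mk]

end Completion

/-! ### Unique lifting along nilpotent thickenings -/

section Lifting

/-- `R₀` is formally étale over `W[T_i]`, as far as `p`-nilpotent test rings are concerned: maps
of `W`-algebras from `R₀` lift uniquely along square-zero extensions of `W`-algebras in which `p`
is nilpotent, once lifts of the images of the `T_i` have been chosen. -/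
def LiftsUniquely (p : ℕ) (W : Type u) [CommRing W] {R₀ : Type u} [CommRing R₀] [Algebra W R₀]
    {ι : Type*} (T : ι → R₀) : Prop :=
  ∀ (C C' : Type u) [CommRing C] [CommRing C'] [Algebra W C] [Algebra W C'] (q : C →ₐ[W] C')
    (m : ℕ), Function.Surjective q → (RingHom.ker q) ^ 2 = ⊥ → (p : C) ^ m = 0 →
    ∀ (g : R₀ →ₐ[W] C') (t : ι → C), (∀ i, q (t i) = g (T i)) →
      ∃! h : R₀ →ₐ[W] C, q.comp h = g ∧ ∀ i, h (T i) = t i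

variable {p : ℕ} {W : Type u} [CommRing W] {R₀ : Type u} [CommRing R₀] [Algebra W R₀]
  {ι : Type*} {T : ι → R₀}

theorem isUnit_of_map_isUnit {C C' : Type u} [CommRing C] [CommRing C'] (q : C →+* C')
    (hq : Function.Surjective q) (hker : (RingHom.ker q) ^ 2 = ⊥) {x : C} (hx : IsUnit (q x)) :
    IsUnit x := by
  obtain ⟨y, hy⟩ := hx.exists_right_inv
  obtain ⟨y, rfl⟩ := hq y
  have h1 : x * y - 1 ∈ RingHom.ker q := by
    rw [RingHom.mem_ker, map_sub, map_mul, hy, map_one, sub_self]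
  have h2 : (x * y - 1) * (x * y - 1) = 0 := by
    have := Ideal.mul_mem_mul h1 h1
    rwa [← pow_two, hker] at this
  refine IsUnit.of_mul_eq_one (y * (2 - x * y)) ?_
  linear_combination -h2

theorem liftsUniquely_laurent (p : ℕ) (W : Type u) [CommRing W] (d : ℕ) :
    LiftsUniquely p W (R₀ := AddMonoidAlgebra W (Fin d → ℤ))
      (fun i : Fin d => AddMonoidAlgebra.single (Pi.single i 1) 1) := by
  -- maps from the Laurent polynomial ring are determined by the images of the variables
  have hext : ∀ {C : Type u} [CommRing C] [Algebra W C]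
      (h₁ h₂ : AddMonoidAlgebra W (Fin d → ℤ) →ₐ[W] C),
      (∀ i, h₁ (AddMonoidAlgebra.single (Pi.single i 1) 1) =
        h₂ (AddMonoidAlgebra.single (Pi.single i 1) 1)) → h₁ = h₂ := by
    intro C _ _ h₁ h₂ h
    refine AddMonoidAlgebra.algHom_ext' ?_ (Subsingleton.elim _ _)
    -- it suffices to compare the group homomorphisms to the units of `C`
    have hu : ∀ h : AddMonoidAlgebra W (Fin d → ℤ) →ₐ[W] C,
        ((h : _ →* C).comp (AddMonoidAlgebra.of W (Fin d → ℤ))) =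
        (Units.coeHom C).comp (MonoidHom.toHomUnits
          ((h : _ →* C).comp (AddMonoidAlgebra.of W (Fin d → ℤ)))) := fun h => by
      ext; rfl
    rw [hu h₁, hu h₂]
    congr 1
    refine MonoidHom.toAdditiveRight.injective ?_
    refine AddMonoidHom.functions_ext _ _ _ fun i n => ?_
    have hs : ∀ (f : (Fin d → ℤ) →+ Additive Cˣ), f (Pi.single i n) = n • f (Pi.single i 1) := by
      intro f
      rw [← map_zsmul, ← Pi.single_smul]
      simp
    rw [hs, hs]
    congr 1
    apply Additive.toMul.injective
    ext
    exact h i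
  intro C C' _ _ _ _ q m hq hker _ g t ht
  have hunit : ∀ i, IsUnit (t i) := fun i => by
    refine isUnit_of_map_isUnit (q : C →+* C') hq hker ?_
    change IsUnit (q (t i))
    rw [ht i]
    refine IsUnit.map g (IsUnit.of_mul_eq_one (AddMonoidAlgebra.single (Pi.single i (-1)) 1) ?_)
    rw [AddMonoidAlgebra.single_mul_single, ← Pi.single_add]
    simp [AddMonoidAlgebra.one_def]
  let F : Multiplicative (Fin d → ℤ) →* C := (Units.coeHom C).comp
    { toFun := fun n => ∏ i, (hunit i).unit ^ (Multiplicative.toAdd n i)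
      map_one' := by simp
      map_mul' := fun a b => by
        rw [← Finset.prod_mul_distrib]
        exact Finset.prod_congr rfl fun i _ => by rw [toAdd_mul, Pi.add_apply, zpow_add] }
  have hF : ∀ i, AddMonoidAlgebra.lift W C (Fin d → ℤ) F
      (AddMonoidAlgebra.single (Pi.single i 1) 1) = t i := fun i => by
    rw [AddMonoidAlgebra.lift_single, one_smul]
    change ((∏ j, (hunit j).unit ^ ((Pi.single i 1 : Fin d → ℤ) j) : Cˣ) : C) = t i
    rw [Finset.prod_eq_single i]
    · simp
    · intro j _ hj
      simp [Pi.single_eq_of_ne hj]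
    · simp
  refine ⟨AddMonoidAlgebra.lift W C (Fin d → ℤ) F, ⟨hext _ _ fun i => ?_, hF⟩, ?_⟩
  · rw [AlgHom.comp_apply, hF, ht]
  · rintro h ⟨-, hh⟩
    exact hext _ _ fun i => by rw [hh, hF]

theorem fg_span_singleton {A : Type u} [CommRing A] (a : A) : (Ideal.span {a}).FG :=
  ⟨{a}, by simp⟩

theorem map_span_natCast {A B : Type u} [CommRing A] [CommRing B] (f : A →+* B) (p : ℕ) :
    (Ideal.span {(p : A)}).map f = Ideal.span {(p : B)} := by
  rw [Ideal.map_span]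
  simp

theorem PCompl.exists_eq_add {X : Type u} [CommRing X] (x : PCompl p X) (n : ℕ) :
    ∃ (a : X) (z : PCompl p X), x = algebraMap X (PCompl p X) a + p ^ n * z := by
  obtain ⟨a, ha⟩ := exists_sub_algebraMap_mem (fg_span_singleton _) x n
  rw [map_span_natCast, Ideal.span_singleton_pow, Ideal.mem_span_singleton] at ha
  obtain ⟨z, hz⟩ := ha
  exact ⟨a, z, by rw [← hz]; ring⟩

theorem LiftsUniquely.pCompl (hT : LiftsUniquely p W T) :
    LiftsUniquely p W (fun i => algebraMap R₀ (PCompl p R₀) (T i)) := by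
  have hext : ∀ {C : Type u} [CommRing C] [Algebra W C] (m : ℕ) (_ : (p : C) ^ m = 0)
      (h₁ h₂ : PCompl p R₀ →ₐ[W] C),
      (∀ x, h₁ (algebraMap R₀ _ x) = h₂ (algebraMap R₀ _ x)) → h₁ = h₂ := by
    intro C _ _ m hm h₁ h₂ h
    refine AlgHom.ext fun x => ?_
    obtain ⟨a, z, rfl⟩ := PCompl.exists_eq_add x m
    simp [hm, h a]
  let ι₀ : R₀ →ₐ[W] PCompl p R₀ := IsScalarTower.toAlgHom W R₀ (PCompl p R₀)
  intro C C' _ _ _ _ q m hq hker hm g t ht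
  have hm' : (p : C') ^ m = 0 := by
    rw [← map_natCast q, ← map_pow, hm, map_zero]
  obtain ⟨h, ⟨hh, hht⟩, huniq⟩ := hT C C' q m hq hker hm (g.comp ι₀) t ht
  let ev : PCompl p R₀ →ₐ[W] R₀ ⧸ Ideal.span {(p : R₀)} ^ m :=
    (AdicCompletion.evalₐ (Ideal.span {(p : R₀)}) m).restrictScalars W
  let hbar : (R₀ ⧸ Ideal.span {(p : R₀)} ^ m) →ₐ[W] C :=
    Ideal.Quotient.liftₐ _ h fun a ha => by
      rw [Ideal.span_singleton_pow, Ideal.mem_span_singleton] at ha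
      obtain ⟨b, rfl⟩ := ha
      simp [hm]
  have hbar_of : ∀ x, hbar (ev (algebraMap R₀ _ x)) = h x := fun x => by
    change hbar (AdicCompletion.evalₐ _ m (algebraMap R₀ _ x)) = _
    rw [AlgHom.commutes]
    rfl
  refine ⟨hbar.comp ev, ⟨hext m hm' _ _ fun x => ?_, fun i => ?_⟩, ?_⟩
  · rw [AlgHom.comp_apply, AlgHom.comp_apply, hbar_of]
    exact DFunLike.congr_fun hh x
  · rw [AlgHom.comp_apply, hbar_of, hht]
  · rintro h' ⟨hh', hht'⟩
    refine hext m hm _ _ fun x => ?_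
    rw [AlgHom.comp_apply, hbar_of,
      ← huniq (h'.comp ι₀) ⟨by rw [← hh', AlgHom.comp_assoc], fun i => hht' i⟩]
    rfl

theorem LiftsUniquely.etale (hT : LiftsUniquely p W T) {S : Type u} [CommRing S] [Algebra W S]
    [Algebra R₀ S] [IsScalarTower W R₀ S] [Algebra.FormallyEtale R₀ S] :
    LiftsUniquely p W (fun i => algebraMap R₀ S (T i)) := by
  intro C C' _ _ _ _ q m hq hker hm g t ht
  obtain ⟨h, ⟨hh, hht⟩, huniq⟩ := hT C C' q m hq hker hm
    (g.comp (IsScalarTower.toAlgHom W R₀ S)) t ht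
  let _ := h.toRingHom.toAlgebra
  let _ := (q.comp h).toRingHom.toAlgebra
  have : IsScalarTower W R₀ C := .of_algebraMap_eq fun w => (h.commutes w).symm
  have : IsScalarTower W R₀ C' := .of_algebraMap_eq fun w => ((q.comp h).commutes w).symm
  let q' : C →ₐ[R₀] C' := { q with commutes' := fun _ => rfl }
  let g' : S →ₐ[R₀] C' := { g with commutes' := fun r => (DFunLike.congr_fun hh r).symm }
  have hnil : IsNilpotent (RingHom.ker (q' : C →+* C')) := ⟨2, hker⟩
  let l : S →ₐ[R₀] C := Algebra.FormallySmooth.liftOfSurjective g' q' hq hnil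
  have hl : ∀ x, q (l x) = g x := Algebra.FormallySmooth.liftOfSurjective_apply g' q' hq hnil
  refine ⟨l.restrictScalars W, ⟨AlgHom.ext hl, fun i => ?_⟩, ?_⟩
  · change l (algebraMap R₀ S (T i)) = t i
    rw [l.commutes]
    exact hht i
  · rintro h' ⟨hh', hht'⟩
    have hr : h'.comp (IsScalarTower.toAlgHom W R₀ S) = h :=
      huniq _ ⟨by rw [← AlgHom.comp_assoc, hh'], hht'⟩
    let l' : S →ₐ[R₀] C := { h' with commutes' := fun r => DFunLike.congr_fun hr r }
    have : l' = l := by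
      refine Algebra.FormallyUnramified.comp_injective (RingHom.ker (q' : C →+* C')) hker ?_
      refine AlgHom.ext fun x => ?_
      change Ideal.Quotient.mk _ (h' x) = Ideal.Quotient.mk _ (l x)
      rw [Ideal.Quotient.eq, RingHom.mem_ker, map_sub, sub_eq_zero]
      exact (DFunLike.congr_fun hh' x).trans (hl x).symm
    exact AlgHom.ext fun x => DFunLike.congr_fun this x

theorem LiftsUniquely.localization (hT : LiftsUniquely p W T) (M : Submonoid R₀) (L : Type u)
    [CommRing L] [Algebra W L] [Algebra R₀ L] [IsScalarTower W R₀ L] [IsLocalization M L] :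
    LiftsUniquely p W (fun i => algebraMap R₀ L (T i)) := by
  have : Algebra.FormallyEtale R₀ L := Algebra.FormallyEtale.of_isLocalization M
  exact hT.etale

end Lifting

/-! ### Unique lifting along adic thickenings -/

section AdicLifting

variable {p : ℕ}

theorem pow_sub_pow_mem {Y : Type u} [CommRing Y] (hp : p.Prime) {J : Ideal Y} (hJ : (p : Y) ∈ J)
    {x y : Y} {n : ℕ} (hn : 1 ≤ n) (h : x - y ∈ J ^ n) : x ^ p - y ^ p ∈ J ^ (n + 1) := by
  have h1 : x ^ p = (y + (x - y)) ^ p := by rw [add_sub_cancel]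
  rw [h1, add_pow_eq_deltaCross hp, show y ^ p + (x - y) ^ p + p * deltaCross p y (x - y) - y ^ p =
    (x - y) ^ p + p * deltaCross p y (x - y) by ring]
  refine add_mem ?_ ?_
  · have h2 := Ideal.pow_mem_pow h p
    rw [← pow_mul] at h2
    exact Ideal.pow_le_pow_right (by nlinarith [hp.two_le]) h2
  · rw [pow_succ']
    exact Ideal.mul_mem_mul hJ (deltaCross_mem_right _ _ h)

theorem WittVector.exists_eq_pow_add_mul [hp : Fact p.Prime] {k : Type u} [Field k] [CharP k p]
    [PerfectRing k p] (w : WittVector p k) : ∃ v r : WittVector p k, w = v ^ p + p * r := by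
  obtain ⟨v, hv⟩ := (PerfectRing.bijective_frobenius (R := k) (p := p)).2 (w.coeff 0)
  obtain ⟨v, rfl⟩ : ∃ x : WittVector p k, WittVector.constantCoeff x = v :=
    ⟨WittVector.teichmuller p v, WittVector.teichmuller_coeff_zero p v⟩
  have h : w - v ^ p ∈ RingHom.ker (WittVector.constantCoeff : WittVector p k →+* k) := by
    rw [RingHom.mem_ker, map_sub, map_pow, sub_eq_zero]
    exact hv.symm
  rw [WittVector.ker_constantCoeff, Ideal.mem_span_singleton] at h
  obtain ⟨r, hr⟩ := h
  exact ⟨v, r, by rw [← hr]; ring⟩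

/-- Since `k` is perfect, a map from `W(k)` to a `J`-adically separated ring, where `p ∈ J`, is
determined by its reduction modulo `J`. -/
theorem WittVector.ringHom_ext_of_sub_mem [hp : Fact p.Prime] {k : Type u} [Field k] [CharP k p]
    [PerfectRing k p] {Y : Type u} [CommRing Y] (J : Ideal Y) [IsHausdorff J Y] (hJ : (p : Y) ∈ J)
    (f g : WittVector p k →+* Y) (h : ∀ w, f w - g w ∈ J) : f = g := by
  refine RingHom.ext fun w => sub_eq_zero.1 (eq_zero_of_forall_mem_pow J fun n => ?_)
  suffices ∀ n w, f w - g w ∈ J ^ (n + 1) from Ideal.pow_le_pow_right n.le_succ (this n w)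
  intro n
  induction n with
  | zero => simpa using h
  | succ n ih =>
    intro w
    obtain ⟨v, r, rfl⟩ := WittVector.exists_eq_pow_add_mul w
    have h1 : f (v ^ p + p * r) - g (v ^ p + p * r) =
        (f v ^ p - g v ^ p) + p * (f r - g r) := by
      simp only [map_add, map_pow, map_mul, map_natCast]
      ring
    rw [h1]
    refine add_mem (pow_sub_pow_mem hp.out hJ (by omega) (ih v)) ?_
    rw [pow_succ']
    exact Ideal.mul_mem_mul hJ (ih r)

variable {W : Type u} [CommRing W] {R₀ : Type u} [CommRing R₀] [Algebra W R₀]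
  {ι : Type*} {T : ι → R₀} {Y : Type u} [CommRing Y] [Algebra W Y]

theorem ker_factorPow_sq (J : Ideal Y) {n : ℕ} (hn : 1 ≤ n) :
    (RingHom.ker (Ideal.Quotient.factorₐ W (Ideal.pow_le_pow_right (I := J) n.le_succ))) ^ 2 =
      ⊥ := by
  rw [eq_bot_iff, pow_two, Ideal.mul_le]
  intro x hx y hy
  obtain ⟨x, rfl⟩ := Ideal.Quotient.mk_surjective x
  obtain ⟨y, rfl⟩ := Ideal.Quotient.mk_surjective y
  rw [RingHom.mem_ker] at hx hy
  have hx' := Ideal.Quotient.eq_zero_iff_mem.1 hx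
  have hy' := Ideal.Quotient.eq_zero_iff_mem.1 hy
  rw [Ideal.mem_bot, ← map_mul, Ideal.Quotient.eq_zero_iff_mem]
  have := Ideal.mul_mem_mul hx' hy'
  rw [← pow_add] at this
  exact Ideal.pow_le_pow_right (by omega) this

theorem natCast_pow_eq_zero (J : Ideal Y) (hJ : (p : Y) ∈ J) (n : ℕ) :
    (p : Y ⧸ J ^ n) ^ n = 0 := by
  rw [← map_natCast (Ideal.Quotient.mk (J ^ n)), ← map_pow, Ideal.Quotient.eq_zero_iff_mem]
  exact Ideal.pow_mem_pow hJ n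

namespace LiftsUniquely

theorem algHom_ext (hT : LiftsUniquely p W T) (J : Ideal Y) [IsHausdorff J Y] (hJ : (p : Y) ∈ J)
    (f g : R₀ →ₐ[W] Y) (h : ∀ x, f x - g x ∈ J) (hfg : ∀ i, f (T i) = g (T i)) : f = g := by
  refine AlgHom.ext fun x => sub_eq_zero.1 (eq_zero_of_forall_mem_pow J fun n => ?_)
  suffices ∀ n x, f x - g x ∈ J ^ (n + 1) from Ideal.pow_le_pow_right n.le_succ (this n x)
  intro n
  induction n with
  | zero => simpa using h
  | succ n ih =>
    let π := Ideal.Quotient.mkₐ W (J ^ (n + 1 + 1))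
    have huniq := hT (Y ⧸ J ^ (n + 1 + 1)) (Y ⧸ J ^ (n + 1))
      (Ideal.Quotient.factorₐ W (Ideal.pow_le_pow_right (n + 1).le_succ)) (n + 1 + 1)
      (Ideal.Quotient.factor_surjective (Ideal.pow_le_pow_right (n + 1).le_succ))
        (ker_factorPow_sq J (by omega))
      (natCast_pow_eq_zero J hJ _) ((Ideal.Quotient.mkₐ W (J ^ (n + 1))).comp f)
      (fun i => π (f (T i))) (fun i => rfl)
    have := huniq.unique (y₁ := π.comp f) (y₂ := π.comp g) ⟨rfl, fun i => rfl⟩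
      ⟨AlgHom.ext fun x => ?_, fun i => by rw [hfg]; rfl⟩
    · intro x
      exact Ideal.Quotient.eq.1 (DFunLike.congr_fun this x)
    · exact (Ideal.Quotient.eq.2 (ih x)).symm

/-- A map `i : R₀ → Y` to a `J`-adically complete ring may be deformed modulo `J` so that the `T_i`
take prescribed values. -/
theorem exists_algHom (hT : LiftsUniquely p W T) (J : Ideal Y) [IsAdicComplete J Y]
    (hJ : (p : Y) ∈ J) (i : R₀ →ₐ[W] Y) (t : ι → Y) (ht : ∀ j, t j - i (T j) ∈ J) :
    ∃ h : R₀ →ₐ[W] Y, (∀ x, h x - i x ∈ J) ∧ ∀ j, h (T j) = t j := by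
  let H : ∀ n : ℕ, {h : R₀ →ₐ[W] Y ⧸ J ^ (n + 1) // ∀ j, h (T j) = Ideal.Quotient.mk _ (t j)} :=
    fun n => n.rec
      ⟨(Ideal.Quotient.mkₐ W _).comp i, fun j => (Ideal.Quotient.eq.2 (by simpa using ht j)).symm⟩
      fun n h =>
        have hex := hT (Y ⧸ J ^ (n + 1 + 1)) (Y ⧸ J ^ (n + 1))
          (Ideal.Quotient.factorₐ W (Ideal.pow_le_pow_right (n + 1).le_succ)) (n + 1 + 1)
          (Ideal.Quotient.factor_surjective (Ideal.pow_le_pow_right (n + 1).le_succ))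
            (ker_factorPow_sq J (by omega))
          (natCast_pow_eq_zero J hJ _) h.1 (fun j => Ideal.Quotient.mk _ (t j))
          (fun j => (h.2 j).symm)
        ⟨hex.choose, hex.choose_spec.1.2⟩
  have hH : ∀ n, (Ideal.Quotient.factorₐ W (Ideal.pow_le_pow_right (n + 1).le_succ)).comp
      (H (n + 1)).1 = (H n).1 := fun n =>
    (hT (Y ⧸ J ^ (n + 1 + 1)) (Y ⧸ J ^ (n + 1))
          (Ideal.Quotient.factorₐ W (Ideal.pow_le_pow_right (n + 1).le_succ)) (n + 1 + 1)
          (Ideal.Quotient.factor_surjective (Ideal.pow_le_pow_right (n + 1).le_succ))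
            (ker_factorPow_sq J (by omega))
          (natCast_pow_eq_zero J hJ _) (H n).1 (fun j => Ideal.Quotient.mk _ (t j))
          (fun j => ((H n).2 j).symm)).choose_spec.1.1
  have hmono : StrictMono (fun n : ℕ => n + 1) := fun a b h => Nat.succ_lt_succ h
  have hcompat : ∀ {m}, (Ideal.Quotient.factorPow J (hmono.monotone m.le_succ)).comp
      ((H (m + 1)).1 : R₀ →+* Y ⧸ J ^ (m + 1 + 1)) = (H m).1 := fun {m} =>
    RingHom.ext fun x => DFunLike.congr_fun (hH m) x
  let h := IsAdicComplete.StrictMono.liftRingHom J hmono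
    (fun n => ((H n).1 : R₀ →+* Y ⧸ J ^ (n + 1))) hcompat
  have hmk : ∀ n x, Ideal.Quotient.mk (J ^ (n + 1)) (h x) = (H n).1 x := fun n x =>
    IsAdicComplete.StrictMono.mk_liftRingHom J hmono _ hcompat x
  have hzero : ∀ y : Y, (∀ n, y ∈ J ^ (n + 1)) → y = 0 := fun y hy =>
    eq_zero_of_forall_mem_pow J fun n => Ideal.pow_le_pow_right n.le_succ (hy n)
  refine ⟨{ h with commutes' := fun w => ?_ }, fun x => ?_, fun j => ?_⟩
  · refine sub_eq_zero.1 (hzero _ fun n => Ideal.Quotient.eq.1 ?_)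
    exact (hmk n _).trans ((H n).1.commutes w)
  · have := hmk 0 x
    simpa using Ideal.Quotient.eq.1 this
  · refine sub_eq_zero.1 (hzero _ fun n => Ideal.Quotient.eq.1 ?_)
    exact (hmk n _).trans ((H n).2 j)

/-- Over `W(k)` with `k` perfect, linearity over `W(k)` need not be assumed in
`LiftsUniquely.algHom_ext`. -/
theorem ringHom_ext [hp : Fact p.Prime] {k : Type u} [Field k] [CharP k p] [PerfectRing k p]
    {R₀ : Type u} [CommRing R₀] [Algebra (WittVector p k) R₀] {T : ι → R₀}
    (hT : LiftsUniquely p (WittVector p k) T) {Y : Type u} [CommRing Y] (J : Ideal Y)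
    [IsHausdorff J Y] (hJ : (p : Y) ∈ J)
    (f g : R₀ →+* Y) (h : ∀ x, f x - g x ∈ J) (hfg : ∀ i, f (T i) = g (T i)) : f = g := by
  have hW := WittVector.ringHom_ext_of_sub_mem J hJ (f.comp (algebraMap (WittVector p k) R₀))
    (g.comp (algebraMap (WittVector p k) R₀)) fun w => h _
  let _ := (f.comp (algebraMap (WittVector p k) R₀)).toAlgebra
  let f' : R₀ →ₐ[WittVector p k] Y := { f with commutes' := fun _ => rfl }
  let g' : R₀ →ₐ[WittVector p k] Y := { g with commutes' := fun w => (RingHom.congr_fun hW w).symm }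
  have := hT.algHom_ext J hJ f' g' h hfg
  exact RingHom.ext fun x => DFunLike.congr_fun this x

end LiftsUniquely

end AdicLifting

/-! ### Quotients of polynomial rings by triangular systems of equations -/

section Triangular

open MvPolynomial

section ModNilpotent

variable {S M : Type*} [CommRing S] [AddCommGroup M] [Module S M] {κ : Type*}

theorem exists_linearMap_sub_mem (b : Module.Basis κ S M) (𝔪 : Ideal S) (Ψ : M →ₗ[S] M)
    (hsurj : ∀ f, ∃ g, f - Ψ g ∈ 𝔪 • (⊤ : Submodule S M)) :
    ∃ Θ : M →ₗ[S] M, ∀ f, f - Ψ (Θ f) ∈ 𝔪 • (⊤ : Submodule S M) := by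
  choose θ hθ using fun i => hsurj (b i)
  refine ⟨b.constr S θ, fun f => ?_⟩
  have hr : LinearMap.range (LinearMap.id - Ψ ∘ₗ b.constr S θ : M →ₗ[S] M) ≤
      𝔪 • (⊤ : Submodule S M) := by
    rw [LinearMap.range_eq_map, ← b.span_eq, Submodule.map_span_le]
    rintro _ ⟨i, rfl⟩
    rw [b.span_eq]
    simpa [b.constr_basis] using hθ i
  exact hr ⟨f, rfl⟩

theorem map_mem_pow_succ_smul (𝔪 : Ideal S) (ε : M →ₗ[S] M)
    (hε : ∀ f, ε f ∈ 𝔪 • (⊤ : Submodule S M)) {n : ℕ} {f : M}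
    (hf : f ∈ 𝔪 ^ n • (⊤ : Submodule S M)) : ε f ∈ 𝔪 ^ (n + 1) • (⊤ : Submodule S M) := by
  have h := Submodule.mem_map_of_mem (f := ε) hf
  rw [Submodule.map_smul''] at h
  rw [pow_succ, Submodule.mul_smul]
  refine Submodule.smul_mono le_rfl ?_ h
  rintro _ ⟨f, -, rfl⟩
  exact hε f

/-- An endomorphism of a free module which is surjective modulo `𝔪` is surjective modulo every power
of `𝔪`. -/
theorem exists_sub_mem_pow_smul (b : Module.Basis κ S M) (𝔪 : Ideal S) (Ψ : M →ₗ[S] M)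
    (hsurj : ∀ f, ∃ g, f - Ψ g ∈ 𝔪 • (⊤ : Submodule S M)) (n : ℕ) (f : M) :
    ∃ g, f - Ψ g ∈ 𝔪 ^ n • (⊤ : Submodule S M) := by
  obtain ⟨Θ, hΘ⟩ := exists_linearMap_sub_mem b 𝔪 Ψ hsurj
  induction n with
  | zero => exact ⟨0, by simp⟩
  | succ n ih =>
    obtain ⟨g, hg⟩ := ih
    refine ⟨g + Θ (f - Ψ g), ?_⟩
    rw [map_add, ← sub_sub]
    exact map_mem_pow_succ_smul 𝔪 (LinearMap.id - Ψ ∘ₗ Θ : M →ₗ[S] M) hΘ hg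

/-- An endomorphism of a free module which is bijective modulo `𝔪` is injective modulo every power
of `𝔪`. -/
theorem mem_pow_smul_of_map_mem (b : Module.Basis κ S M) (𝔪 : Ideal S) (Ψ : M →ₗ[S] M)
    (hsurj : ∀ f, ∃ g, f - Ψ g ∈ 𝔪 • (⊤ : Submodule S M))
    (hinj : ∀ f, Ψ f ∈ 𝔪 • (⊤ : Submodule S M) → f ∈ 𝔪 • (⊤ : Submodule S M)) (n : ℕ) {f : M}
    (hf : Ψ f ∈ 𝔪 ^ n • (⊤ : Submodule S M)) : f ∈ 𝔪 ^ n • (⊤ : Submodule S M) := by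
  obtain ⟨Θ, hΘ⟩ := exists_linearMap_sub_mem b 𝔪 Ψ hsurj
  have hε : ∀ f, f - Θ (Ψ f) ∈ 𝔪 • (⊤ : Submodule S M) := fun f =>
    hinj _ (by simpa using hΘ (Ψ f))
  suffices ∀ k ≤ n, f ∈ 𝔪 ^ k • (⊤ : Submodule S M) from this n le_rfl
  intro k
  induction k with
  | zero => simp
  | succ k ih =>
    intro hk
    rw [← sub_add_cancel f (Θ (Ψ f))]
    refine add_mem (map_mem_pow_succ_smul 𝔪 (LinearMap.id - Θ ∘ₗ Ψ : M →ₗ[S] M) hε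
      (ih (by omega))) ?_
    have h2 := Submodule.mem_map_of_mem (f := Θ) hf
    rw [Submodule.map_smul''] at h2
    exact Submodule.smul_mono (Ideal.pow_le_pow_right hk) le_top h2

end ModNilpotent

variable {V : Type*}

/-- A linear endomorphism of a polynomial ring which maps each monomial to a monic polynomial with
this leading monomial is bijective. -/
theorem bijective_of_monic (m : MonomialOrder V) {k : Type*} [CommRing k]
    (Φ : MvPolynomial V k →ₗ[k] MvPolynomial V k)
    (hmon : ∀ e, m.Monic (Φ (monomial e 1))) (hdeg : ∀ e, m.degree (Φ (monomial e 1)) = e) :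
    Function.Bijective Φ := by
  have hsum : ∀ f, Φ f = ∑ e ∈ f.support, coeff e f • Φ (monomial e 1) := fun f => by
    conv_lhs => rw [f.as_sum]
    rw [map_sum]
    exact Finset.sum_congr rfl fun e _ => by rw [← map_smul, smul_monomial, smul_eq_mul, mul_one]
  constructor
  · rw [injective_iff_map_eq_zero]
    intro f hf
    by_contra h0
    have h1 : coeff (m.degree f) (Φ f) = coeff (m.degree f) f := by
      rw [hsum, coeff_sum, Finset.sum_eq_single (m.degree f)]
      · have := (hmon (m.degree f)).coeff_degree
        rw [hdeg] at this
        rw [coeff_smul, this, smul_eq_mul, mul_one]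
      · intro e he hne
        have hlt : m.toSyn (m.degree (Φ (monomial e 1))) < m.toSyn (m.degree f) := by
          rw [hdeg]
          exact lt_of_le_of_ne (m.le_degree he) fun h => hne (m.toSyn.injective h)
        rw [coeff_smul, m.coeff_eq_zero_of_lt hlt, smul_zero]
      · intro h
        rw [coeff_smul, notMem_support_iff.1 h, zero_smul]
    rw [hf, coeff_zero] at h1
    exact (m.coeff_degree_ne_zero_iff.2 h0) h1.symm
  · have hrange : ∀ s : m.syn, monomial (m.toSyn.symm s) (1 : k) ∈ LinearMap.range Φ := by
      intro s
      classical
      induction s using WellFoundedLT.induction with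
      | ind s ih =>
        set e := m.toSyn.symm s with he
        have h1 : (monomial e (1 : k)) = Φ (monomial e 1) - (Φ (monomial e 1) - monomial e 1) := by
          simp
        rw [h1]
        refine sub_mem ⟨_, rfl⟩ ?_
        rw [(Φ (monomial e 1) - monomial e (1 : k)).as_sum]
        refine sum_mem fun e' he' => ?_
        rw [← mul_one (coeff e' _), ← smul_eq_mul, ← smul_monomial]
        refine Submodule.smul_mem _ _ ?_
        have h2 := ih (m.toSyn e') ?_
        · simpa using h2
        · have hle : m.toSyn e' ≤ m.toSyn e := by
            by_contra hlt
            rw [not_le] at hlt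
            rw [mem_support_iff] at he'
            refine he' ?_
            rw [coeff_sub, m.coeff_eq_zero_of_lt (by rwa [hdeg]), coeff_monomial,
              if_neg (by rintro rfl; exact lt_irrefl _ hlt), sub_zero]
          have hne : e' ≠ e := by
            intro hee
            rw [mem_support_iff, hee] at he'
            refine he' ?_
            have := (hmon e).coeff_degree
            rw [hdeg] at this
            rw [coeff_sub, this, coeff_monomial, if_pos rfl, sub_self]
          have := lt_of_le_of_ne hle fun h => hne (m.toSyn.injective h)
          simpa [he] using this
    rw [← LinearMap.range_eq_top, eq_top_iff]
    intro f _
    rw [f.as_sum]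
    refine sum_mem fun e _ => ?_
    rw [← mul_one (coeff e _), ← smul_eq_mul, ← smul_monomial]
    exact Submodule.smul_mem _ _ (by simpa using hrange (m.toSyn e))

/-- The monomial `∏ X_v ^ (e_v)` with the `p`-th powers `X_v ^ p` replaced by polynomials `r_v`. -/
noncomputable def substPow (p : ℕ) {S : Type*} [CommRing S] (r : V → MvPolynomial V S)
    (e : V →₀ ℕ) : MvPolynomial V S :=
  e.prod fun v n => X v ^ (n % p) * r v ^ (n / p)

/-- The linear map replacing `X_v ^ p` by `r_v` in every monomial. It identifies the polynomial
ring in the `r_v` with coefficients in the span of the monomials of degree less than `p` in each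
variable with the whole polynomial ring, as soon as `X_v ^ p` is the leading term of `r_v`. -/
noncomputable def substPowLinear (p : ℕ) {S : Type*} [CommRing S] (r : V → MvPolynomial V S) :
    MvPolynomial V S →ₗ[S] MvPolynomial V S :=
  (basisMonomials V S).constr S (substPow p r)

section

variable {p : ℕ} {S : Type*} [CommRing S] (r : V → MvPolynomial V S)

theorem substPowLinear_monomial (e : V →₀ ℕ) (s : S) :
    substPowLinear p r (monomial e s) = s • substPow p r e := by
  have h1 : monomial e s = s • basisMonomials V S e := by
    rw [coe_basisMonomials, smul_monomial, smul_eq_mul, mul_one]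
  rw [h1, map_smul, substPowLinear, Module.Basis.constr_basis]

theorem substPow_of_lt {e : V →₀ ℕ} (he : ∀ v, e v < p) : substPow p r e = monomial e 1 := by
  rw [monomial_eq, map_one, one_mul, substPow]
  refine Finsupp.prod_congr fun v _ => ?_
  rw [Nat.mod_eq_of_lt (he v), Nat.div_eq_of_lt (he v), pow_zero, mul_one]

theorem substPow_single_add (hp : 0 < p) (v : V) (e : V →₀ ℕ) :
    substPow p r (Finsupp.single v p + e) = r v * substPow p r e := by
  classical
  have h : ∀ e' : V →₀ ℕ, e'.support ⊆ insert v e.support →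
      substPow p r e' = ∏ w ∈ insert v e.support, X w ^ (e' w % p) * r w ^ (e' w / p) := fun e' he' =>
    Finsupp.prod_of_support_subset e' he' _ (by simp)
  rw [h e (Finset.subset_insert _ _), h _ ?_]
  · rw [← Finset.mul_prod_erase _ _ (Finset.mem_insert_self v e.support),
      ← Finset.mul_prod_erase _ _ (Finset.mem_insert_self v e.support), ← mul_assoc]
    congr 1
    · rw [Finsupp.add_apply, Finsupp.single_eq_same, Nat.add_mod_left, Nat.add_div_left _ hp,
        pow_succ]
      ring
    · refine Finset.prod_congr rfl fun w hw => ?_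
      rw [Finsupp.add_apply, Finsupp.single_eq_of_ne (Finset.ne_of_mem_erase hw), zero_add]
  · refine Finsupp.support_add.trans (Finset.union_subset ?_ (Finset.subset_insert _ _))
    exact Finsupp.support_single_subset.trans (by simp)

theorem substPowLinear_monomial_mul (hp : 0 < p) (v : V) (g : MvPolynomial V S) :
    substPowLinear p r (monomial (Finsupp.single v p) 1 * g) = r v * substPowLinear p r g := by
  induction g using MvPolynomial.induction_on' with
  | monomial e s =>
    rw [monomial_mul, one_mul, substPowLinear_monomial, substPowLinear_monomial,
      substPow_single_add r hp, mul_smul_comm]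
  | add f g hf hg => rw [mul_add, map_add, hf, hg, map_add, mul_add]

theorem map_substPowLinear {k : Type*} [CommRing k] (f : S →+* k) (g : MvPolynomial V S) :
    MvPolynomial.map f (substPowLinear p r g) =
      substPowLinear p (fun v => MvPolynomial.map f (r v)) (MvPolynomial.map f g) := by
  induction g using MvPolynomial.induction_on' with
  | monomial e s =>
    rw [map_monomial, substPowLinear_monomial, substPowLinear_monomial, smul_eq_C_mul, map_mul,
      map_C, smul_eq_C_mul, substPow, substPow, Finsupp.prod, map_prod]
    simp [Finsupp.prod]
  | add f g hf hg => rw [map_add, map_add, hf, hg, map_add, map_add]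

theorem bijective_substPowLinear (m : MonomialOrder V) [Nontrivial S]
    (hmon : ∀ v, m.Monic (r v)) (hdeg : ∀ v, m.degree (r v) = Finsupp.single v p) :
    Function.Bijective (substPowLinear p r) := by
  have hpow : ∀ (f : MvPolynomial V S), m.Monic f → ∀ n : ℕ, m.degree (f ^ n) = n • m.degree f :=
    fun f hf n => m.degree_pow_of_pow_leadingCoeff_ne_zero (by simp [hf.leadingCoeff_eq_one])
  have hmul : ∀ (f g : MvPolynomial V S), m.Monic f → m.Monic g →
      m.degree (f * g) = m.degree f + m.degree g := fun f g hf hg =>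
    m.degree_mul_of_mul_leadingCoeff_ne_zero
      (by simp [hf.leadingCoeff_eq_one, hg.leadingCoeff_eq_one])
  have hX : ∀ v, m.Monic (X v : MvPolynomial V S) := fun v => m.monic_X
  have hfac : ∀ v (n : ℕ), m.Monic (X v ^ (n % p) * r v ^ (n / p)) := fun v n =>
    MonomialOrder.Monic.mul (MonomialOrder.Monic.pow (hX v)) (MonomialOrder.Monic.pow (hmon v))
  have hfacdeg : ∀ v (n : ℕ), m.degree (X v ^ (n % p) * r v ^ (n / p)) = Finsupp.single v n := by
    intro v n
    rw [hmul _ _ (MonomialOrder.Monic.pow (hX v)) (MonomialOrder.Monic.pow (hmon v)), hpow _ (hX v),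
      hpow _ (hmon v), hdeg, m.degree_X, Finsupp.smul_single, Finsupp.smul_single,
      ← Finsupp.single_add, smul_eq_mul, smul_eq_mul, mul_one, mul_comm, Nat.mod_add_div]
  refine bijective_of_monic m _ (fun e => ?_) fun e => ?_
  · rw [substPowLinear_monomial, one_smul, substPow, Finsupp.prod]
    exact MonomialOrder.Monic.prod fun v _ => hfac v _
  · rw [substPowLinear_monomial, one_smul, substPow, Finsupp.prod, m.degree_prod_of_regular]
    · rw [Finset.sum_congr rfl fun v _ => hfacdeg v (e v)]
      exact Finsupp.sum_single e
    · intro v _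
      rw [(hfac v _).leadingCoeff_eq_one]
      exact isRegular_one

end

section Reduced

variable {p : ℕ} {S : Type*} [CommRing S] {𝔪 : Ideal S} {r : V → MvPolynomial V S}

/-- The polynomials which are of degree less than `p` in each variable. -/
def reducedPoly (V : Type*) (p : ℕ) (S : Type*) [CommRing S] : Submodule S (MvPolynomial V S) where
  carrier := {f | ∀ e, (∃ v, p ≤ e v) → coeff e f = 0}
  add_mem' hf hg e he := by rw [coeff_add, hf e he, hg e he, add_zero]
  zero_mem' e _ := coeff_zero e
  smul_mem' c f hf e he := by rw [coeff_smul, hf e he, smul_zero]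

theorem mem_map_C_pow_iff {f : MvPolynomial V S} {n : ℕ} :
    f ∈ (𝔪.map (C : S →+* MvPolynomial V S)) ^ n ↔ ∀ e, coeff e f ∈ 𝔪 ^ n := by
  rw [← Ideal.map_pow, mem_map_C_iff]

theorem mem_map_C_pow_iff_mem_smul {f : MvPolynomial V S} {n : ℕ} :
    f ∈ (𝔪.map (C : S →+* MvPolynomial V S)) ^ n ↔
      f ∈ 𝔪 ^ n • (⊤ : Submodule S (MvPolynomial V S)) := by
  rw [Ideal.smul_top_eq_map, Submodule.restrictScalars_mem, ← Ideal.map_pow, algebraMap_eq]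

theorem map_mk_eq_zero_iff {f : MvPolynomial V S} :
    MvPolynomial.map (Ideal.Quotient.mk 𝔪) f = 0 ↔
      f ∈ 𝔪 • (⊤ : Submodule S (MvPolynomial V S)) := by
  rw [← pow_one 𝔪, ← mem_map_C_pow_iff_mem_smul, mem_map_C_pow_iff, MvPolynomial.ext_iff, pow_one]
  simp [coeff_map, Ideal.Quotient.eq_zero_iff_mem]

variable {m : MonomialOrder V} [Nontrivial (S ⧸ 𝔪)]
  (hmon : ∀ v, m.Monic (MvPolynomial.map (Ideal.Quotient.mk 𝔪) (r v)))
  (hdeg : ∀ v, m.degree (MvPolynomial.map (Ideal.Quotient.mk 𝔪) (r v)) = Finsupp.single v p)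

include hmon hdeg

theorem exists_sub_substPowLinear_mem (f : MvPolynomial V S) :
    ∃ g, f - substPowLinear p r g ∈ 𝔪 • (⊤ : Submodule S (MvPolynomial V S)) := by
  obtain ⟨g, hg⟩ := (bijective_substPowLinear _ m hmon hdeg).2
    (MvPolynomial.map (Ideal.Quotient.mk 𝔪) f)
  obtain ⟨g, rfl⟩ := MvPolynomial.map_surjective _ Ideal.Quotient.mk_surjective g
  refine ⟨g, map_mk_eq_zero_iff.1 ?_⟩
  rw [map_sub, map_substPowLinear, hg, sub_self]

theorem mem_of_substPowLinear_mem (f : MvPolynomial V S)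
    (hf : substPowLinear p r f ∈ 𝔪 • (⊤ : Submodule S (MvPolynomial V S))) :
    f ∈ 𝔪 • (⊤ : Submodule S (MvPolynomial V S)) := by
  rw [← map_mk_eq_zero_iff] at hf ⊢
  refine (bijective_substPowLinear _ m hmon hdeg).1 ?_
  rw [← map_substPowLinear, hf, map_zero]

/-- Modulo the equations `r_v = 0`, whose leading terms modulo `𝔪` are the `X_v ^ p`, and up to a
power of `𝔪`, every polynomial is congruent to one of degree less than `p` in each variable. -/
theorem exists_reducedPoly (hp : 0 < p) (n : ℕ) (f : MvPolynomial V S) :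
    ∃ l ∈ reducedPoly V p S,
      f - l ∈ Ideal.span (Set.range r) ⊔ (𝔪.map (C : S →+* MvPolynomial V S)) ^ n := by
  obtain ⟨g, hg⟩ := exists_sub_mem_pow_smul (basisMonomials V S) 𝔪 (substPowLinear p r)
    (exists_sub_substPowLinear_mem hmon hdeg) n f
  rw [← mem_map_C_pow_iff_mem_smul] at hg
  suffices ∃ l ∈ reducedPoly V p S, substPowLinear p r g - l ∈ Ideal.span (Set.range r) by
    obtain ⟨l, hl, hgl⟩ := this
    refine ⟨l, hl, ?_⟩
    rw [← sub_add_sub_cancel]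
    exact add_mem (Ideal.mem_sup_right hg) (Ideal.mem_sup_left hgl)
  clear hg
  induction g using MvPolynomial.induction_on' with
  | monomial e s =>
    classical
    rw [substPowLinear_monomial]
    by_cases he : ∃ v, p ≤ e v
    · refine ⟨0, zero_mem _, ?_⟩
      obtain ⟨v, hv⟩ := he
      have h1 : e = Finsupp.single v p + (e - Finsupp.single v p) := by
        rw [add_tsub_cancel_of_le]
        simpa using hv
      rw [sub_zero, h1, substPow_single_add r hp, ← mul_smul_comm]
      exact Ideal.mul_mem_right _ _ (Ideal.subset_span ⟨v, rfl⟩)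
    · refine ⟨monomial e s, fun e' he' => ?_, ?_⟩
      · rw [coeff_monomial, if_neg]
        rintro rfl
        exact he he'
      · push Not at he
        rw [substPow_of_lt r he, smul_monomial, smul_eq_mul, mul_one, sub_self]
        exact zero_mem _
  | add f g hf hg =>
    obtain ⟨l, hl, hfl⟩ := hf
    obtain ⟨l', hl', hgl⟩ := hg
    refine ⟨l + l', add_mem hl hl', ?_⟩
    rw [map_add, add_sub_add_comm]
    exact add_mem hfl hgl

/-- The polynomials of degree less than `p` in each variable are linearly independent modulo the
equations `r_v = 0`, also up to a power of `𝔪`. -/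
theorem coeff_mem_of_reducedPoly (hp : 0 < p) (n : ℕ) {l : MvPolynomial V S} (hl : l ∈ reducedPoly V p S)
    (h : l ∈ Ideal.span (Set.range r) ⊔ (𝔪.map (C : S →+* MvPolynomial V S)) ^ n) :
    l ∈ (𝔪.map (C : S →+* MvPolynomial V S)) ^ n := by
  have hsurj := exists_sub_mem_pow_smul (basisMonomials V S) 𝔪 (substPowLinear p r)
    (exists_sub_substPowLinear_mem hmon hdeg) n
  obtain ⟨i, hi, j, hj, rfl⟩ := Submodule.mem_sup.1 h
  -- up to `𝔪 ^ n`, an element of the ideal is the image of a combination of nonreduced monomials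
  have hy : ∃ y, (∀ e : V →₀ ℕ, (∀ v, e v < p) → coeff e y = 0) ∧
      i - substPowLinear p r y ∈ (𝔪.map (C : S →+* MvPolynomial V S)) ^ n := by
    obtain ⟨c, rfl⟩ := Finsupp.mem_ideal_span_range_iff_exists_finsupp.1 hi
    choose g hg using hsurj
    refine ⟨c.sum fun v a => monomial (Finsupp.single v p) 1 * g a, fun e he => ?_, ?_⟩
    · rw [Finsupp.sum, coeff_sum]
      refine Finset.sum_eq_zero fun v _ => ?_
      rw [coeff_monomial_mul', if_neg]
      intro hle
      have := hle v
      rw [Finsupp.single_eq_same] at this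
      exact absurd (he v) (not_lt.2 this)
    · rw [Finsupp.sum, Finsupp.sum, map_sum, ← Finset.sum_sub_distrib]
      refine sum_mem fun v _ => ?_
      rw [substPowLinear_monomial_mul r hp, mul_comm (c v), ← mul_sub]
      exact Ideal.mul_mem_left _ _ (mem_map_C_pow_iff_mem_smul.2 (hg _))
  obtain ⟨y, hy0, hy⟩ := hy
  have hΨl : substPowLinear p r (i + j) = i + j := by
    conv_rhs => rw [(i + j).as_sum]
    conv_lhs => rw [(i + j).as_sum]
    rw [map_sum]
    refine Finset.sum_congr rfl fun e he => ?_
    have : ∀ v, e v < p := by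
      by_contra hcon
      push Not at hcon
      exact mem_support_iff.1 he (hl e hcon)
    rw [substPowLinear_monomial, substPow_of_lt r this, smul_monomial, smul_eq_mul, mul_one]
  have h1 : i + j - y ∈ (𝔪.map (C : S →+* MvPolynomial V S)) ^ n := by
    rw [mem_map_C_pow_iff_mem_smul]
    refine mem_pow_smul_of_map_mem (basisMonomials V S) 𝔪 (substPowLinear p r)
      (exists_sub_substPowLinear_mem hmon hdeg) (mem_of_substPowLinear_mem hmon hdeg) n ?_
    rw [← mem_map_C_pow_iff_mem_smul, map_sub, hΨl]
    have := add_mem hy hj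
    convert this using 1
    ring
  rw [mem_map_C_pow_iff] at h1 ⊢
  intro e
  by_cases he : ∃ v, p ≤ e v
  · rw [hl e he]
    exact zero_mem _
  · push Not at he
    have := h1 e
    rwa [coeff_sub, hy0 e he, sub_zero] at this

end Reduced

end Triangular

/-! ### The free `δ`-ring and the equations of the self-product -/

/-- A transversal prism `(S, (E))`, given as a `p`-torsion free ring `S` with a Frobenius lift `φ`
and a distinguished element `E` which is a nonzerodivisor modulo `p`, together with coordinates
`x_j` on which `φ` is the `p`-th power map. -/
structure TransversalPrism (p : ℕ) (S : Type u) [CommRing S] (ι : Type) where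
  φ : S →+* S
  frobeniusLift : IsFrobeniusLift p φ
  torsionFree : ∀ s : S, (p : S) * s = 0 → s = 0
  x : ι → S
  φ_x : ∀ j, φ (x j) = x j ^ p
  E : S
  /-- the element `δ(E)` -/
  b : S
  isUnit_b : IsUnit b
  φ_E : φ E = E ^ p + p * b
  regular : ∀ s t, E * s = p * t → ∃ z, s = p * z
  nontrivial : Nontrivial (S ⧸ (Ideal.span {E} ⊔ Ideal.span {(p : S)}))

/-- The variables `z_{j,n}` of the free `δ`-ring on generators `z_j`. The order is chosen so that, in
the lexicographic order of monomials, `z_{j,n}` dominates all `z_{j,i}` with `i < n`. -/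
abbrev DeltaVar (ι : Type) : Type := ι ×ₗ ℕᵒᵈ

/-- The index of the variable `z_{j,n} = δ^n(z_j)`. -/
def DeltaVar.mk {ι : Type} (j : ι) (n : ℕ) : DeltaVar ι := toLex (j, OrderDual.toDual n)

theorem DeltaVar.ext_iff {ι : Type} {j j' : ι} {n n' : ℕ} :
    DeltaVar.mk j n = DeltaVar.mk j' n' ↔ j = j' ∧ n = n' := by
  simp [DeltaVar.mk]

namespace TransversalPrism

open MvPolynomial

variable {p : ℕ} {S : Type u} [CommRing S] {ι : Type} (D : TransversalPrism p S ι)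

/-- The ideal `(p, E)`. -/
def J : Ideal S := Ideal.span {D.E} ⊔ Ideal.span {(p : S)}

theorem E_mem : D.E ∈ D.J := left_mem_sup_span _ _

theorem p_mem : (p : S) ∈ D.J := right_mem_sup_span _ _

theorem φ_mem_J (hp : p.Prime) {s : S} (hs : s ∈ D.J) : D.φ s ∈ D.J := by
  obtain ⟨a, b, rfl⟩ := mem_sup_span_singleton.1 hs
  rw [map_add, map_mul, map_mul, D.φ_E, map_natCast]
  exact add_mem (Ideal.mul_mem_right _ _ (add_mem (Ideal.pow_mem_of_mem _ D.E_mem _ hp.pos)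
    (Ideal.mul_mem_right _ _ D.p_mem))) (Ideal.mul_mem_right _ _ D.p_mem)

theorem iterate_φ_mem_J (hp : p.Prime) {s : S} (hs : s ∈ D.J) (n : ℕ) : D.φ^[n] s ∈ D.J := by
  induction n with
  | zero => exact hs
  | succ n ih =>
    rw [Function.iterate_succ_apply']
    exact D.φ_mem_J hp ih

/-- The Frobenius of the free `δ`-ring over `S`, with `φ(z_{j,n}) = z_{j,n} ^ p + p z_{j,n+1}`. -/
noncomputable def freeφ : MvPolynomial (DeltaVar ι) S →+* MvPolynomial (DeltaVar ι) S :=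
  eval₂Hom (C.comp D.φ) fun v =>
    X v ^ p + (p : MvPolynomial (DeltaVar ι) S) *
      X (DeltaVar.mk (ofLex v).1 (OrderDual.ofDual (ofLex v).2 + 1))

theorem freeφ_C (s : S) : D.freeφ (C s) = C (D.φ s) := by
  simp [freeφ]

theorem freeφ_X (j : ι) (n : ℕ) : D.freeφ (X (DeltaVar.mk j n)) =
    X (DeltaVar.mk j n) ^ p + (p : MvPolynomial (DeltaVar ι) S) * X (DeltaVar.mk j (n + 1)) := by
  rw [freeφ, coe_eval₂Hom, eval₂_X]
  rfl

theorem natCast_eq_C (n : ℕ) : ((n : ℕ) : MvPolynomial (DeltaVar ι) S) = C (n : S) := by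
  simp

theorem isFrobeniusLift_freeφ (hp : p.Prime) : IsFrobeniusLift p D.freeφ := by
  intro f
  rw [Ideal.mem_span_singleton]
  induction f using MvPolynomial.induction_on with
  | C s =>
    obtain ⟨t, ht⟩ := Ideal.mem_span_singleton.1 (D.frobeniusLift s)
    exact ⟨C t, by rw [freeφ_C, ← C_pow, ← C_sub, ht, C_mul, natCast_eq_C]⟩
  | add f g hf hg =>
    obtain ⟨a, ha⟩ := hf
    obtain ⟨b, hb⟩ := hg
    refine ⟨a + b - deltaCross p f g, ?_⟩
    rw [map_add, add_pow_eq_deltaCross hp]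
    linear_combination ha + hb
  | mul_X f v hf =>
    obtain ⟨a, ha⟩ := hf
    obtain ⟨j, n, rfl⟩ : ∃ j n, v = DeltaVar.mk j n := ⟨(ofLex v).1, OrderDual.ofDual (ofLex v).2, rfl⟩
    refine ⟨D.freeφ f * X (DeltaVar.mk j (n + 1)) + a * X (DeltaVar.mk j n) ^ p, ?_⟩
    rw [map_mul, freeφ_X, mul_pow]
    linear_combination X (DeltaVar.mk j n) ^ p * ha

theorem free_torsionFree (D : TransversalPrism p S ι) (f : MvPolynomial (DeltaVar ι) S)
    (hf : (p : MvPolynomial (DeltaVar ι) S) * f = 0) : f = 0 := by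
  ext e
  rw [natCast_eq_C] at hf
  have := congrArg (coeff e) hf
  rw [coeff_C_mul, coeff_zero] at this
  rw [D.torsionFree _ this, coeff_zero]

theorem free_cancel (D : TransversalPrism p S ι) {f g : MvPolynomial (DeltaVar ι) S}
    (h : (p : MvPolynomial (DeltaVar ι) S) * f = p * g) : f = g :=
  sub_eq_zero.1 (D.free_torsionFree _ (by rw [mul_sub, h, sub_self]))

/-- The polynomials in the variables `z_{j,i}` with `i < n`. -/
noncomputable def below (S : Type u) [CommRing S] {ι : Type} (j : ι) (n : ℕ) :
    Subalgebra S (MvPolynomial (DeltaVar ι) S) :=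
  supported S {v | ∃ i < n, v = DeltaVar.mk j i}

theorem X_mem_below {j : ι} {i n : ℕ} (h : i < n) :
    (X (DeltaVar.mk j i) : MvPolynomial (DeltaVar ι) S) ∈ below S j n :=
  Algebra.subset_adjoin ⟨_, ⟨i, h, rfl⟩, rfl⟩

theorem below_mono {j : ι} {m n : ℕ} (h : m ≤ n) : below S j m ≤ below S j n :=
  supported_mono fun _ ⟨i, hi, hv⟩ => ⟨i, hi.trans_le h, hv⟩

theorem deltaCross_mem_below {j : ι} {n : ℕ} {f g : MvPolynomial (DeltaVar ι) S}
    (hf : f ∈ below S j n) (hg : g ∈ below S j n) : deltaCross p f g ∈ below S j n :=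
  deltaCross_mem_subring (below S j n).toSubring hf hg

/-- The second copy `x_j + E z_j` of the coordinate `x_j`. -/
noncomputable def y (j : ι) : MvPolynomial (DeltaVar ι) S :=
  C (D.x j) + C D.E * X (DeltaVar.mk j 0)

theorem φ_iterate_E (n : ℕ) : D.φ (D.φ^[n] D.E) = D.φ^[n] D.E ^ p + p * D.φ^[n] D.b := by
  rw [← Function.iterate_succ_apply' (f := D.φ), Function.iterate_succ_apply, D.φ_E]
  simp only [← RingHom.coe_pow, map_add, map_pow, map_mul, map_natCast]

theorem isUnit_iterate_b (n : ℕ) : IsUnit (D.φ^[n] D.b) := by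
  rw [← RingHom.coe_pow]
  exact D.isUnit_b.map _

section Order

variable [LinearOrder ι] [Finite ι]

instance : WellFoundedGT (DeltaVar ι) := by
  have h := WellFounded.prod_lex (wellFounded_gt (α := ι)) (wellFounded_gt (α := ℕᵒᵈ))
  refine ⟨Subrelation.wf (r := InvImage (Prod.Lex (· > ·) (· > ·)) ofLex) ?_ (InvImage.wf _ h)⟩
  intro a b hab
  rw [InvImage, Prod.lex_def]
  rcases Prod.Lex.lt_iff.1 hab with h | ⟨h1, h2⟩
  · exact Or.inl h
  · exact Or.inr ⟨h1.symm, h2⟩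

theorem lex_lt_of_mem_support {k : Type u} [CommRing k] (hp : 1 < p) {j : ι} {n : ℕ}
    {s t : MvPolynomial (DeltaVar ι) k} (hs : s ∈ below k j n) (ht : t ∈ below k j n)
    {e : DeltaVar ι →₀ ℕ} (he : e ∈ (s * X (DeltaVar.mk j n) + t).support) :
    MonomialOrder.lex.toSyn e <
      MonomialOrder.lex.toSyn (Finsupp.single (DeltaVar.mk j n) p) := by
  classical
  have hbelow : ∀ {f : MvPolynomial (DeltaVar ι) k}, f ∈ below k j n → ∀ {e}, e ∈ f.support →
      ∀ v, e v ≠ 0 → ∃ i < n, v = DeltaVar.mk j i := fun {f} hf {e} he v hv =>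
    mem_supported.1 hf ((mem_vars_iff_mem_support v).2 ⟨e, he, Finsupp.mem_support_iff.2 hv⟩)
  have key : (∀ v, e v ≠ 0 → ∃ i ≤ n, v = DeltaVar.mk j i) ∧ e (DeltaVar.mk j n) ≤ 1 := by
    rcases Finset.mem_union.1 (support_add he) with h | h
    · rw [support_mul_X, Finset.mem_map] at h
      obtain ⟨e', he', rfl⟩ := h
      simp only [addRightEmbedding_apply]
      constructor
      · intro v hv
        by_cases hv' : e' v = 0
        · rw [Finsupp.add_apply, hv', zero_add, Finsupp.single_apply_ne_zero] at hv
          exact ⟨n, le_rfl, hv.1⟩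
        · obtain ⟨i, hi, h⟩ := hbelow hs he' v hv'
          exact ⟨i, hi.le, h⟩
      · have : e' (DeltaVar.mk j n) = 0 := by
          by_contra h0
          obtain ⟨i, hi, h⟩ := hbelow hs he' _ h0
          exact hi.ne (DeltaVar.ext_iff.1 h).2.symm
        simp [this]
    · constructor
      · intro v hv
        obtain ⟨i, hi, h⟩ := hbelow ht h v hv
        exact ⟨i, hi.le, h⟩
      · by_contra h0
        obtain ⟨i, hi, h⟩ := hbelow ht h (DeltaVar.mk j n) (by omega)
        exact hi.ne (DeltaVar.ext_iff.1 h).2.symm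
  change toLex e < toLex (Finsupp.single (DeltaVar.mk j n) p)
  rw [Finsupp.Lex.lt_iff]
  refine ⟨DeltaVar.mk j n, fun v hv => ?_, ?_⟩
  · change e v = Finsupp.single (DeltaVar.mk j n) p v
    rw [Finsupp.single_eq_of_ne (hv.ne)]
    by_contra h0
    obtain ⟨i, hi, rfl⟩ := key.1 v h0
    rw [DeltaVar.mk, DeltaVar.mk, Prod.Lex.toLex_lt_toLex] at hv
    simp at hv
    omega
  · change e (DeltaVar.mk j n) < Finsupp.single (DeltaVar.mk j n) p (DeltaVar.mk j n)
    rw [Finsupp.single_eq_same]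
    exact key.2.trans_lt hp

end Order

variable [hp : Fact p.Prime]

/-- The `δ`-structure of the free `δ`-ring over `S`. -/
@[reducible]
noncomputable def freeDeltaRing : DeltaRing p (MvPolynomial (DeltaVar ι) S) :=
  DeltaRing.ofFrobeniusLift hp.out D.free_torsionFree D.freeφ (D.isFrobeniusLift_freeφ hp.out)

/-- The operation `δ` of the free `δ`-ring over `S`. -/
noncomputable def δ : MvPolynomial (DeltaVar ι) S → MvPolynomial (DeltaVar ι) S :=
  D.freeDeltaRing.delta

theorem p_mul_δ (f : MvPolynomial (DeltaVar ι) S) :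
    (p : MvPolynomial (DeltaVar ι) S) * D.δ f = D.freeφ f - f ^ p :=
  DeltaRing.mul_delta_ofFrobeniusLift hp.out D.free_torsionFree D.freeφ
    (D.isFrobeniusLift_freeφ hp.out) f

theorem δ_add (f g : MvPolynomial (DeltaVar ι) S) :
    D.δ (f + g) = D.δ f + D.δ g - deltaCross p f g :=
  D.freeDeltaRing.delta_add f g

theorem δ_mul (f g : MvPolynomial (DeltaVar ι) S) :
    D.δ (f * g) = f ^ p * D.δ g + g ^ p * D.δ f + p * D.δ f * D.δ g :=
  D.freeDeltaRing.delta_mul f g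

theorem δ_C {s t : S} (h : D.φ s = s ^ p + p * t) : D.δ (C s) = C t := by
  refine D.free_cancel ?_
  rw [p_mul_δ, freeφ_C, h, natCast_eq_C]
  simp

theorem δ_X (j : ι) (n : ℕ) : D.δ (X (DeltaVar.mk j n)) = X (DeltaVar.mk j (n + 1)) := by
  refine D.free_cancel ?_
  rw [p_mul_δ, freeφ_X]
  ring

theorem δ_C_mul {s t : S} (h : D.φ s = s ^ p + p * t) (f : MvPolynomial (DeltaVar ι) S) :
    D.δ (C s * f) = C (D.φ s) * D.δ f + f ^ p * C t := by
  rw [δ_mul, D.δ_C h, h, natCast_eq_C]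
  simp only [map_add, map_mul, map_pow]
  ring

/-- Modulo `p`, the operation `δ` introduces the next variable at most linearly. -/
theorem exists_δ_eq (j : ι) (n : ℕ) {f : MvPolynomial (DeltaVar ι) S}
    (hf : f ∈ below S j (n + 1)) :
    ∃ s ∈ below S j (n + 1), ∃ t ∈ below S j (n + 1), ∃ c ∈ below S j (n + 2),
      D.δ f = s * X (DeltaVar.mk j (n + 1)) + t + (p : MvPolynomial (DeltaVar ι) S) * c := by
  have hle : below S j (n + 1) ≤ below S j (n + 2) := below_mono (by omega)
  have hX : X (DeltaVar.mk j (n + 1)) ∈ below S j (n + 2) := X_mem_below (by omega)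
  have hpn : ((p : ℕ) : MvPolynomial (DeltaVar ι) S) ∈ below S j (n + 2) := natCast_mem _ _
  induction hf using Algebra.adjoin_induction with
  | mem f hf =>
    obtain ⟨_, ⟨i, hi, rfl⟩, rfl⟩ := hf
    rw [δ_X]
    by_cases h : i = n
    · exact ⟨1, one_mem _, 0, zero_mem _, 0, zero_mem _, by rw [h]; ring⟩
    · exact ⟨0, zero_mem _, X (DeltaVar.mk j (i + 1)), X_mem_below (n := n + 1) (by omega), 0, zero_mem _, by ring⟩
  | algebraMap s =>
    obtain ⟨t, ht⟩ := Ideal.mem_span_singleton.1 (D.frobeniusLift s)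
    rw [algebraMap_eq, D.δ_C (t := t) (by rw [← ht]; ring)]
    exact ⟨0, zero_mem _, C t, (below S j (n + 1)).algebraMap_mem t, 0, zero_mem _, by ring⟩
  | add f g hf hg ihf ihg =>
    obtain ⟨s, hs, t, ht, c, hc, h⟩ := ihf
    obtain ⟨s', hs', t', ht', c', hc', h'⟩ := ihg
    refine ⟨s + s', add_mem hs hs', t + t' - deltaCross p f g,
      sub_mem (add_mem ht ht') (deltaCross_mem_below hf hg), c + c', add_mem hc hc', ?_⟩
    rw [δ_add, h, h']
    ring
  | mul f g hf hg ihf ihg =>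
    obtain ⟨s, hs, t, ht, c, hc, h⟩ := ihf
    obtain ⟨s', hs', t', ht', c', hc', h'⟩ := ihg
    have hfp : f ^ p ∈ below S j (n + 1) := pow_mem hf _
    have hgp : g ^ p ∈ below S j (n + 1) := pow_mem hg _
    have hδf : D.δ f ∈ below S j (n + 2) := by
      rw [h]
      exact add_mem (add_mem (mul_mem (hle hs) hX) (hle ht)) (mul_mem hpn hc)
    have hδg : D.δ g ∈ below S j (n + 2) := by
      rw [h']
      exact add_mem (add_mem (mul_mem (hle hs') hX) (hle ht')) (mul_mem hpn hc')
    refine ⟨f ^ p * s' + g ^ p * s, add_mem (mul_mem hfp hs') (mul_mem hgp hs),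
      f ^ p * t' + g ^ p * t, add_mem (mul_mem hfp ht') (mul_mem hgp ht),
      f ^ p * c' + g ^ p * c + D.δ f * D.δ g, add_mem (add_mem (mul_mem (hle hfp) hc')
        (mul_mem (hle hgp) hc)) (mul_mem hδf hδg), ?_⟩
    rw [δ_mul]
    linear_combination f ^ p * h' + g ^ p * h

/-- The equations `δ^(n+1)(x_j + E z_j) = 0` of the self-product. -/
noncomputable def rel (j : ι) (n : ℕ) : MvPolynomial (DeltaVar ι) S :=
  D.δ^[n + 1] (D.y j)

/-- The shape of the equations of the self-product: modulo `(p, E)` the `n`-th equation for the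
`j`-th coordinate is, up to a unit, of the form `z_{j,n} ^ p + s z_{j,n} + t = 0` with `s` and `t`
polynomials in the `z_{j,i}` with `i < n`. -/
theorem exists_rel_eq (j : ι) (n : ℕ) :
    ∃ w ∈ below S j (n + 1), D.rel j n = C (D.φ^[n + 1] D.E) * X (DeltaVar.mk j (n + 1)) + w ∧
      ∃ s ∈ below S j n, ∃ t ∈ below S j n, ∃ c ∈ D.J.map (C : S →+* MvPolynomial (DeltaVar ι) S),
        w = C (D.φ^[n] D.b) * X (DeltaVar.mk j n) ^ p + s * X (DeltaVar.mk j n) + t + c := by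
  have hC : ∀ (n : ℕ) (s : S), C s ∈ below S j n := fun n s => (below S j n).algebraMap_mem s
  induction n with
  | zero =>
    have hX0 : (X (DeltaVar.mk j 0) : MvPolynomial (DeltaVar ι) S) ∈ below S j (0 + 1) :=
      X_mem_below (by omega)
    refine ⟨C D.b * X (DeltaVar.mk j 0) ^ p - deltaCross p (C (D.x j)) (C D.E * X (DeltaVar.mk j 0)),
      ?_, ?_, 0, zero_mem _, 0, zero_mem _,
      -deltaCross p (C (D.x j)) (C D.E * X (DeltaVar.mk j 0)), ?_, ?_⟩
    · exact sub_mem (mul_mem (hC _ _) (pow_mem hX0 _))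
        (deltaCross_mem_below (hC _ _) (mul_mem (hC _ _) hX0))
    · rw [rel, y, zero_add, Function.iterate_one, δ_add, D.δ_C (t := 0) (by rw [D.φ_x]; ring),
        D.δ_C_mul D.φ_E, δ_X, Function.iterate_one, map_zero]
      ring
    · exact neg_mem (deltaCross_mem_right _ _
        (Ideal.mul_mem_right _ _ (Ideal.mem_map_of_mem _ D.E_mem)))
    · simp only [Function.iterate_zero, id]
      ring
  | succ n ih =>
    obtain ⟨w, hw, hrel, -⟩ := ih
    obtain ⟨s, hs, t, ht, c, hc, hδ⟩ := D.exists_δ_eq j n hw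
    set X1 : MvPolynomial (DeltaVar ι) S := X (DeltaVar.mk j (n + 1)) with hX1
    set cr := deltaCross p (C (D.φ^[n + 1] D.E) * X1) w with hcr
    have hX1' : X1 ∈ below S j (n + 1 + 1) := X_mem_below (by omega)
    have hle : below S j (n + 1) ≤ below S j (n + 1 + 1) := below_mono (by omega)
    have hcr' : cr ∈ below S j (n + 1 + 1) :=
      deltaCross_mem_below (mul_mem (hC _ _) hX1') (hle hw)
    refine ⟨C (D.φ^[n + 1] D.b) * X1 ^ p + s * X1 + t +
      ((p : MvPolynomial (DeltaVar ι) S) * c - cr), ?_, ?_, s, hs, t, ht, _, ?_, rfl⟩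
    · exact add_mem (add_mem (add_mem (mul_mem (hC _ _) (pow_mem hX1' _)) (mul_mem (hle hs) hX1'))
        (hle ht)) (sub_mem (mul_mem (natCast_mem _ _) hc) hcr')
    · have h1 : D.rel j (n + 1) = D.δ (D.rel j n) := Function.iterate_succ_apply' _ _ _
      rw [h1, hrel, δ_add, D.δ_C_mul (D.φ_iterate_E (n + 1)), hX1, δ_X, hδ,
        ← Function.iterate_succ_apply' (f := D.φ)]
      ring
    · refine sub_mem (Ideal.mul_mem_right _ _ ?_) (deltaCross_mem_left _
        (Ideal.mul_mem_right _ _ (Ideal.mem_map_of_mem _ (D.iterate_φ_mem_J hp.out D.E_mem _))) _)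
      rw [natCast_eq_C]
      exact Ideal.mem_map_of_mem _ D.p_mem

/-- The equations of the self-product, scaled to be monic modulo `(p, E)`. -/
noncomputable def monicRel (v : DeltaVar ι) : MvPolynomial (DeltaVar ι) S :=
  C (Ring.inverse (D.φ^[OrderDual.ofDual (ofLex v).2] D.b)) *
    D.rel (ofLex v).1 (OrderDual.ofDual (ofLex v).2)

/-- The ideal generated by the equations of the self-product. -/
noncomputable def relIdeal : Ideal (MvPolynomial (DeltaVar ι) S) :=
  Ideal.span (Set.range D.monicRel)

theorem rel_mem (j : ι) (n : ℕ) : D.rel j n ∈ D.relIdeal := by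
  have h : D.rel j n = C (D.φ^[n] D.b) * D.monicRel (DeltaVar.mk j n) := by
    change _ = _ * (C (Ring.inverse (D.φ^[n] D.b)) * D.rel j n)
    rw [← mul_assoc, ← C_mul, Ring.mul_inverse_cancel _ (D.isUnit_iterate_b n), C_1, one_mul]
  rw [h]
  exact Ideal.mul_mem_left _ _ (Ideal.subset_span ⟨_, rfl⟩)

theorem relIdeal_le {I : Ideal (MvPolynomial (DeltaVar ι) S)} (h : ∀ j n, D.rel j n ∈ I) :
    D.relIdeal ≤ I := by
  rw [relIdeal, Ideal.span_le]
  rintro _ ⟨v, rfl⟩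
  exact Ideal.mul_mem_left _ _ (h _ _)

theorem freeφ_mem_relIdeal {f : MvPolynomial (DeltaVar ι) S} (hf : f ∈ D.relIdeal) :
    D.freeφ f ∈ D.relIdeal := by
  refine D.relIdeal_le (I := D.relIdeal.comap D.freeφ) (fun j n => ?_) hf
  have h : D.freeφ (D.rel j n) = D.rel j n ^ p + p * D.rel j (n + 1) := by
    rw [rel, rel, Function.iterate_succ_apply' _ (n + 1), p_mul_δ]
    ring
  rw [Ideal.mem_comap, h]
  exact add_mem (Ideal.pow_mem_of_mem _ (D.rel_mem j n) _ hp.out.pos)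
    (Ideal.mul_mem_left _ _ (D.rel_mem j (n + 1)))

section Order

variable [LinearOrder ι] [Finite ι]

theorem map_monicRel_eq (v : DeltaVar ι) :
    ∃ g : MvPolynomial (DeltaVar ι) (S ⧸ D.J),
      MvPolynomial.map (Ideal.Quotient.mk D.J) (D.monicRel v) = X v ^ p + g ∧
      ∀ e ∈ g.support, MonomialOrder.lex.toSyn e < MonomialOrder.lex.toSyn (Finsupp.single v p) := by
  obtain ⟨j, n, rfl⟩ : ∃ j n, v = DeltaVar.mk j n := ⟨(ofLex v).1, OrderDual.ofDual (ofLex v).2, rfl⟩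
  obtain ⟨w, -, hrel, s, hs, t, ht, c, hc, hw⟩ := D.exists_rel_eq j n
  have hmap : ∀ {f : MvPolynomial (DeltaVar ι) S}, f ∈ below S j n →
      MvPolynomial.map (Ideal.Quotient.mk D.J) f ∈ below (S ⧸ D.J) j n := fun {f} hf => by
    rw [below, mem_supported] at hf ⊢
    exact (Finset.coe_subset.2 (vars_map _ _)).trans hf
  have hC0 : MvPolynomial.map (Ideal.Quotient.mk D.J) c = 0 := by
    rw [map_mk_eq_zero_iff, ← pow_one D.J, ← mem_map_C_pow_iff_mem_smul, pow_one]
    exact hc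
  have hE : Ideal.Quotient.mk D.J (D.φ^[n + 1] D.E) = 0 :=
    Ideal.Quotient.eq_zero_iff_mem.2 (D.iterate_φ_mem_J hp.out D.E_mem _)
  have hinv : Ring.inverse (D.φ^[n] D.b) * D.φ^[n] D.b = 1 :=
    Ring.inverse_mul_cancel _ (D.isUnit_iterate_b n)
  set β := Ring.inverse (D.φ^[n] D.b) with hβ
  refine ⟨MvPolynomial.map (Ideal.Quotient.mk D.J) (C β * s) * X (DeltaVar.mk j n) +
    MvPolynomial.map (Ideal.Quotient.mk D.J) (C β * t), ?_, ?_⟩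
  · change MvPolynomial.map _ (C β * D.rel j n) = _
    rw [hrel, hw]
    simp only [map_mul, map_add, map_C, map_pow, map_X, hC0, hE]
    have h1 : (C (Ideal.Quotient.mk D.J β) : MvPolynomial (DeltaVar ι) (S ⧸ D.J)) *
        C (Ideal.Quotient.mk D.J (D.φ^[n] D.b)) = 1 := by
      rw [← C_mul, ← map_mul, hinv, map_one, C_1]
    rw [C_0]
    linear_combination (X (DeltaVar.mk j n)) ^ p * h1
  · intro e he
    have hCb : (C β : MvPolynomial (DeltaVar ι) S) ∈ below S j n :=
      (below S j n).algebraMap_mem β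
    exact lex_lt_of_mem_support hp.out.one_lt (hmap (mul_mem hCb hs)) (hmap (mul_mem hCb ht)) he

instance : Nontrivial (S ⧸ D.J) := D.nontrivial

theorem monic_and_degree_monicRel (v : DeltaVar ι) :
    MonomialOrder.lex.Monic (MvPolynomial.map (Ideal.Quotient.mk D.J) (D.monicRel v)) ∧
    MonomialOrder.lex.degree (MvPolynomial.map (Ideal.Quotient.mk D.J) (D.monicRel v)) =
      Finsupp.single v p := by
  obtain ⟨g, hg, hlt⟩ := D.map_monicRel_eq v
  have hX : MonomialOrder.lex.Monic (X v ^ p : MvPolynomial (DeltaVar ι) (S ⧸ D.J)) :=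
    MonomialOrder.Monic.pow MonomialOrder.monic_X
  have hdX : MonomialOrder.lex.degree (X v ^ p : MvPolynomial (DeltaVar ι) (S ⧸ D.J)) =
      Finsupp.single v p := by
    classical
    rw [X_pow_eq_monomial, MonomialOrder.degree_monomial, if_neg one_ne_zero]
  have hlt' : MonomialOrder.lex.toSyn (MonomialOrder.lex.degree g) <
      MonomialOrder.lex.toSyn (MonomialOrder.lex.degree
        (X v ^ p : MvPolynomial (DeltaVar ι) (S ⧸ D.J))) := by
    rw [hdX, MonomialOrder.degree_lt_iff]
    · exact hlt
    · rw [map_zero]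
      refine bot_lt_iff_ne_bot.2 fun h => ?_
      have h2 := MonomialOrder.lex.toSyn.injective (h.trans (map_zero _).symm)
      have h3 := DFunLike.congr_fun h2 v
      rw [Finsupp.single_eq_same] at h3
      exact hp.out.ne_zero h3
  rw [hg]
  exact ⟨hX.add_of_lt hlt', by rw [MonomialOrder.degree_add_of_lt hlt', hdX]⟩

end Order

end TransversalPrism

/-! ### The self-product of a transversal prism -/

namespace TransversalPrism

open MvPolynomial

variable {p : ℕ} {S : Type u} [CommRing S] {ι : Type} (D : TransversalPrism p S ι)

theorem mem_J_pow_of_p_mul_mem {n : ℕ} {s : S} (h : (p : S) * s ∈ D.J ^ (n + 1)) : s ∈ D.J ^ n :=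
  mem_pow_of_mul_mem_pow D.torsionFree D.regular n h

theorem mem_J_pow_of_E_mul_mem {n : ℕ} {s : S} (h : D.E * s ∈ D.J ^ (n + 1)) : s ∈ D.J ^ n :=
  mem_pow_of_mul_mem_pow' D.torsionFree D.regular n h

theorem exists_sub_mem_of_E_mul_sub_mem {n : ℕ} {s t : S}
    (h : D.E * s - p * t ∈ D.J ^ (n + 1)) : ∃ z, s - p * z ∈ D.J ^ n := by
  obtain ⟨y, hy, c, hc⟩ := exists_of_mem_sup_span_pow _ _ _ _ h
  obtain ⟨z, hz⟩ := D.regular (s - y) (t + p ^ n * c) (by rw [pow_succ] at hc; linear_combination hc)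
  exact ⟨z, by rw [show s - p * z = y by linear_combination hz]; exact hy⟩

variable [hp : Fact p.Prime]

/-- The underlying ring of the self-product before completion. -/
abbrev PreEnv : Type u := MvPolynomial (DeltaVar ι) S ⧸ D.relIdeal

/-- The ideal `(p, E)` of `PreEnv`. -/
noncomputable abbrev preJ : Ideal D.PreEnv := D.J.map (algebraMap S D.PreEnv)

/-- The underlying ring of the self-product of a transversal prism: the `(p, E)`-adic completion of
the quotient of the free `δ`-ring on the `z_j` by the equations `δ^(n+1)(x_j + E z_j) = 0`. -/
abbrev Env : Type u := AdicCompletion D.preJ D.PreEnv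

/-- The natural map from the free `δ`-ring to the self-product. -/
noncomputable def toEnv : MvPolynomial (DeltaVar ι) S →+* D.Env :=
  (algebraMap D.PreEnv D.Env).comp (Ideal.Quotient.mk D.relIdeal)

/-- The first structure map of the self-product. -/
noncomputable def i₁ : S →+* D.Env := D.toEnv.comp C

/-- The ideal `(p, E)` of the self-product. -/
noncomputable def envJ : Ideal D.Env := Ideal.span {D.i₁ D.E} ⊔ Ideal.span {(p : D.Env)}

theorem preJ_fg : D.preJ.FG :=
  Ideal.FG.map (Submodule.FG.sup (fg_span_singleton _) (fg_span_singleton _)) _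

theorem preJ_eq : D.preJ =
    (D.J.map (C : S →+* MvPolynomial (DeltaVar ι) S)).map (Ideal.Quotient.mk D.relIdeal) := by
  rw [Ideal.map_map]
  rfl

theorem envJ_eq : D.envJ = D.preJ.map (algebraMap D.PreEnv D.Env) := by
  have h : D.preJ.map (algebraMap D.PreEnv D.Env) = D.J.map D.i₁ := Ideal.map_map _ _
  rw [h, J, Ideal.map_sup, Ideal.map_span, Ideal.map_span, Set.image_singleton,
    Set.image_singleton, map_natCast]
  rfl

instance : IsAdicComplete D.envJ D.Env := by
  rw [envJ_eq]
  exact isAdicComplete_map_completion D.preJ_fg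

theorem p_mem_envJ : (p : D.Env) ∈ D.envJ := right_mem_sup_span _ _

theorem E_mem_envJ : D.i₁ D.E ∈ D.envJ := left_mem_sup_span _ _

theorem toEnv_mem_iff {f : MvPolynomial (DeltaVar ι) S} {n : ℕ} :
    D.toEnv f ∈ D.envJ ^ n ↔
      f ∈ D.relIdeal ⊔ (D.J.map (C : S →+* MvPolynomial (DeltaVar ι) S)) ^ n := by
  rw [envJ_eq, toEnv, RingHom.comp_apply, algebraMap_mem_map_pow_iff D.preJ_fg, preJ_eq,
    ← Ideal.map_pow, ← Ideal.mem_comap, Ideal.comap_map_of_surjective _ Ideal.Quotient.mk_surjective,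
    ← RingHom.ker_eq_comap_bot, Ideal.mk_ker, sup_comm]

theorem exists_sub_toEnv_mem (a : D.Env) (n : ℕ) : ∃ f, a - D.toEnv f ∈ D.envJ ^ n := by
  obtain ⟨d, hd⟩ := exists_sub_algebraMap_mem D.preJ_fg a n
  obtain ⟨f, rfl⟩ := Ideal.Quotient.mk_surjective d
  exact ⟨f, by rw [envJ_eq]; exact hd⟩

theorem toEnv_rel (j : ι) (n : ℕ) : D.toEnv (D.rel j n) = 0 := by
  rw [toEnv, RingHom.comp_apply, Ideal.Quotient.eq_zero_iff_mem.2 (D.rel_mem j n), map_zero]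

theorem exists_envφ : ∃ φ : D.Env →+* D.Env, ∀ f, φ (D.toEnv f) = D.toEnv (D.freeφ f) := by
  let g : D.PreEnv →+* D.Env := Ideal.Quotient.lift D.relIdeal (D.toEnv.comp D.freeφ) fun f hf => by
    rw [RingHom.comp_apply, toEnv, RingHom.comp_apply,
      Ideal.Quotient.eq_zero_iff_mem.2 (D.freeφ_mem_relIdeal hf), map_zero]
  have hg : D.preJ ≤ D.envJ.comap g := by
    rw [Ideal.map_le_iff_le_comap]
    intro s hs
    change D.toEnv (D.freeφ (C s)) ∈ D.envJ
    rw [freeφ_C, ← pow_one D.envJ, toEnv_mem_iff, pow_one]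
    exact Ideal.mem_sup_right (Ideal.mem_map_of_mem _ (D.φ_mem_J hp.out hs))
  obtain ⟨φ, hφ⟩ := exists_extension g hg
  exact ⟨φ, fun f => hφ _⟩

/-- The Frobenius of the self-product. -/
noncomputable def envφ : D.Env →+* D.Env := D.exists_envφ.choose

theorem envφ_toEnv (f : MvPolynomial (DeltaVar ι) S) :
    D.envφ (D.toEnv f) = D.toEnv (D.freeφ f) :=
  D.exists_envφ.choose_spec f

theorem envφ_i₁ (s : S) : D.envφ (D.i₁ s) = D.i₁ (D.φ s) := by
  rw [i₁, RingHom.comp_apply, envφ_toEnv, freeφ_C, RingHom.comp_apply]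

theorem envJ_le_comap_envφ : D.envJ ≤ D.envJ.comap D.envφ := by
  rw [envJ, sup_le_iff, Ideal.span_singleton_le_iff_mem, Ideal.span_singleton_le_iff_mem]
  constructor
  · rw [Ideal.mem_comap, envφ_i₁, D.φ_E, map_add, map_pow, map_mul, map_natCast]
    exact add_mem (Ideal.pow_mem_of_mem _ D.E_mem_envJ _ hp.out.pos)
      (Ideal.mul_mem_right _ _ D.p_mem_envJ)
  · rw [Ideal.mem_comap, map_natCast]
    exact D.p_mem_envJ

section Order

variable [LinearOrder ι] [Finite ι]

/-- Elements of the self-product are approximated by polynomials in the `z_{j,n}` of degree less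
than `p` in each variable. -/
theorem exists_reducedPoly_sub_mem (a : D.Env) (n : ℕ) :
    ∃ l ∈ reducedPoly (DeltaVar ι) p S, a - D.toEnv l ∈ D.envJ ^ n := by
  obtain ⟨f, hf⟩ := D.exists_sub_toEnv_mem a n
  obtain ⟨l, hl, h⟩ := exists_reducedPoly (fun v => (D.monic_and_degree_monicRel v).1)
    (fun v => (D.monic_and_degree_monicRel v).2) hp.out.pos n f
  refine ⟨l, hl, ?_⟩
  have := add_mem hf (D.toEnv_mem_iff.2 h)
  rwa [map_sub, sub_add_sub_cancel] at this

theorem toEnv_mem_iff_of_reducedPoly {l : MvPolynomial (DeltaVar ι) S}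
    (hl : l ∈ reducedPoly (DeltaVar ι) p S) {n : ℕ} :
    D.toEnv l ∈ D.envJ ^ n ↔ ∀ e, coeff e l ∈ D.J ^ n := by
  rw [← mem_map_C_pow_iff, toEnv_mem_iff]
  exact ⟨coeff_mem_of_reducedPoly (fun v => (D.monic_and_degree_monicRel v).1)
    (fun v => (D.monic_and_degree_monicRel v).2) hp.out.pos n hl, fun h => Ideal.mem_sup_right h⟩

theorem mem_envJ_pow_of_i₁_mul_mem {t : S} (ht : ∀ n s, t * s ∈ D.J ^ (n + 1) → s ∈ D.J ^ n)
    (n : ℕ) (a : D.Env) (h : D.i₁ t * a ∈ D.envJ ^ (n + 1)) : a ∈ D.envJ ^ n := by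
  obtain ⟨l, hl, hal⟩ := D.exists_reducedPoly_sub_mem a (n + 1)
  have h1 : D.toEnv (t • l) ∈ D.envJ ^ (n + 1) := by
    have h2 := sub_mem h (Ideal.mul_mem_left _ (D.i₁ t) hal)
    rw [← mul_sub, sub_sub_cancel] at h2
    rwa [smul_eq_C_mul, map_mul]
  rw [D.toEnv_mem_iff_of_reducedPoly (Submodule.smul_mem _ _ hl)] at h1
  have h3 : D.toEnv l ∈ D.envJ ^ n := (D.toEnv_mem_iff_of_reducedPoly hl).2 fun e =>
    ht _ _ (by simpa using h1 e)
  have := add_mem (Ideal.pow_le_pow_right n.le_succ hal) h3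
  rwa [sub_add_cancel] at this

theorem mem_envJ_pow_of_p_mul_mem (n : ℕ) (a : D.Env) (h : (p : D.Env) * a ∈ D.envJ ^ (n + 1)) :
    a ∈ D.envJ ^ n :=
  D.mem_envJ_pow_of_i₁_mul_mem (t := p) (fun _ _ => D.mem_J_pow_of_p_mul_mem) n a
    (by rwa [map_natCast])

theorem mem_envJ_pow_of_E_mul_mem (n : ℕ) (a : D.Env) (h : D.i₁ D.E * a ∈ D.envJ ^ (n + 1)) :
    a ∈ D.envJ ^ n :=
  D.mem_envJ_pow_of_i₁_mul_mem (fun _ _ => D.mem_J_pow_of_E_mul_mem) n a h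

theorem env_torsionFree (a : D.Env) (h : (p : D.Env) * a = 0) : a = 0 :=
  eq_zero_of_forall_mem_pow D.envJ fun n =>
    D.mem_envJ_pow_of_p_mul_mem n a (by rw [h]; exact zero_mem _)

theorem env_E_torsionFree (a : D.Env) (h : D.i₁ D.E * a = 0) : a = 0 :=
  eq_zero_of_forall_mem_pow D.envJ fun n =>
    D.mem_envJ_pow_of_E_mul_mem n a (by rw [h]; exact zero_mem _)

theorem p_dvd_of_forall {a : D.Env} (h : ∀ n, ∃ y, a - p * y ∈ D.envJ ^ n) : (p : D.Env) ∣ a :=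
  dvd_of_forall_mem_sup_pow D.envJ D.mem_envJ_pow_of_p_mul_mem h

theorem E_dvd_of_forall {a : D.Env} (h : ∀ n, ∃ y, a - D.i₁ D.E * y ∈ D.envJ ^ n) :
    D.i₁ D.E ∣ a :=
  dvd_of_forall_mem_sup_pow D.envJ D.mem_envJ_pow_of_E_mul_mem h

theorem env_regular (a c : D.Env) (h : D.i₁ D.E * a = p * c) : (p : D.Env) ∣ a := by
  refine D.p_dvd_of_forall fun n => ?_
  obtain ⟨l, hl, hal⟩ := D.exists_reducedPoly_sub_mem a (n + 1)
  obtain ⟨l', hl', hcl⟩ := D.exists_reducedPoly_sub_mem c (n + 1)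
  have h1 : D.toEnv (D.E • l - (p : S) • l') ∈ D.envJ ^ (n + 1) := by
    have h2 := sub_mem (Ideal.mul_mem_left _ (p : D.Env) hcl) (Ideal.mul_mem_left _ (D.i₁ D.E) hal)
    rw [smul_eq_C_mul, smul_eq_C_mul, map_sub, map_mul, map_mul, map_natCast, map_natCast]
    convert h2 using 1
    rw [mul_sub, mul_sub, h, i₁, RingHom.comp_apply]
    ring
  rw [D.toEnv_mem_iff_of_reducedPoly (sub_mem (Submodule.smul_mem _ _ hl)
    (Submodule.smul_mem _ _ hl'))] at h1
  have h2 : ∀ e, ∃ z, coeff e l - p * z ∈ D.J ^ n := fun e =>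
    D.exists_sub_mem_of_E_mul_sub_mem (by simpa using h1 e)
  choose z hz using h2
  -- the coefficients of `l` are divided by `p` separately
  refine ⟨D.toEnv (∑ e ∈ l.support, monomial e (z e)), ?_⟩
  have h3 : D.toEnv (l - (p : MvPolynomial (DeltaVar ι) S) * ∑ e ∈ l.support, monomial e (z e)) ∈
      D.envJ ^ n := by
    refine D.toEnv_mem_iff.2 (Ideal.mem_sup_right ?_)
    have h4 : l - (p : MvPolynomial (DeltaVar ι) S) * ∑ e ∈ l.support, monomial e (z e) =
        ∑ e ∈ l.support, monomial e (coeff e l)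
          - (p : MvPolynomial (DeltaVar ι) S) * ∑ e ∈ l.support, monomial e (z e) :=
      congrArg (· - _) l.as_sum
    rw [h4, Finset.mul_sum, ← Finset.sum_sub_distrib]
    refine sum_mem fun e _ => ?_
    rw [natCast_eq_C, C_mul_monomial, ← map_sub, mem_map_C_pow_iff]
    intro e'
    classical
    rw [coeff_monomial]
    split_ifs
    · exact hz e
    · exact zero_mem _
  have := add_mem (Ideal.pow_le_pow_right n.le_succ hal) h3
  rwa [map_sub, map_mul, map_natCast, sub_add_sub_cancel] at this

theorem isFrobeniusLift_envφ : IsFrobeniusLift p D.envφ := by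
  intro a
  rw [Ideal.mem_span_singleton]
  refine D.p_dvd_of_forall fun n => ?_
  obtain ⟨f, hf⟩ := D.exists_sub_toEnv_mem a n
  obtain ⟨g, hg⟩ := Ideal.mem_span_singleton.1 (D.isFrobeniusLift_freeφ hp.out f)
  refine ⟨D.toEnv g, ?_⟩
  have h1 := map_mem_pow D.envJ_le_comap_envφ hf
  have h2 : a ^ p - D.toEnv f ^ p ∈ D.envJ ^ n := (D.envJ ^ n).mem_of_dvd (sub_dvd_pow_sub_pow _ _ p) hf
  have h3 := congrArg D.toEnv hg
  rw [map_sub, map_pow, map_mul, map_natCast, ← envφ_toEnv] at h3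
  have h4 := sub_mem h1 h2
  convert h4 using 1
  rw [map_sub]
  linear_combination h3

/-- The `δ`-structure of the self-product. -/
noncomputable instance envDeltaRing : DeltaRing p D.Env :=
  DeltaRing.ofFrobeniusLift hp.out D.env_torsionFree D.envφ D.isFrobeniusLift_envφ

theorem p_mul_env_delta (a : D.Env) :
    (p : D.Env) * DeltaRing.delta p a = D.envφ a - a ^ p :=
  DeltaRing.mul_delta_ofFrobeniusLift hp.out D.env_torsionFree D.envφ D.isFrobeniusLift_envφ a

theorem env_frob (a : D.Env) : DeltaRing.frob p a = D.envφ a := by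
  rw [DeltaRing.frob, p_mul_env_delta]
  ring

theorem env_cancel {a c : D.Env} (h : (p : D.Env) * a = p * c) : a = c :=
  sub_eq_zero.1 (D.env_torsionFree _ (by rw [mul_sub, h, sub_self]))

theorem delta_toEnv (f : MvPolynomial (DeltaVar ι) S) :
    DeltaRing.delta p (D.toEnv f) = D.toEnv (D.δ f) := by
  refine D.env_cancel ?_
  rw [p_mul_env_delta, envφ_toEnv, ← map_natCast D.toEnv, ← map_mul, p_mul_δ, map_sub, map_pow]

end Order

end TransversalPrism

/-! ### Bounded prisms -/

section Bounded

variable {p : ℕ} {A : Type u} [CommRing A] [DeltaRing p A]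

theorem invertible_span_singleton {A : Type u} [CommRing A] {a : A}
    (ha : ∀ x, a * x = 0 → x = 0) : Module.Invertible A (Ideal.span {a}) := by
  have hinj : Function.Injective (LinearMap.mulRight A a) := fun x y h => by
    refine sub_eq_zero.1 (ha _ ?_)
    have h' : x * a = y * a := h
    linear_combination h'
  have hrange : LinearMap.range (LinearMap.mulRight A a) = Ideal.span {a} := by
    ext x
    rw [Ideal.mem_span_singleton']
    rfl
  exact Module.Invertible.congr ((LinearEquiv.ofInjective _ hinj).trans (LinearEquiv.ofEq _ _ hrange))

/-- A criterion for a transversal pair to be a bounded prism. -/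
theorem isBoundedPrism_span_singleton {E b : A} (hE : ∀ x, E * x = 0 → x = 0)
    (hp : ∀ x : A, (p : A) * x = 0 → x = 0)
    (hreg : ∀ x y : A, E * x = p * y → (p : A) ∣ x)
    [hc : IsAdicComplete (Ideal.span {E} ⊔ Ideal.span {(p : A)}) A]
    (hφ : DeltaRing.frob p E = E ^ p + p * b) (hp0 : p ≠ 0) (hb : IsUnit b) :
    IsBoundedPrism p A (Ideal.span {E}) where
  invertible := invertible_span_singleton hE
  derivedComplete f hf := isDerivedCompleteAt_of_isAdicComplete _ hf
  mem := by
    obtain ⟨c, hbc⟩ := hb.exists_right_inv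
    have h : (p : A) = DeltaRing.frob p E * c - E ^ p * c := by
      rw [hφ]
      linear_combination -(p : A) * hbc
    rw [h]
    refine sub_mem (Ideal.mul_mem_right _ _ (Ideal.mem_sup_right (Ideal.subset_span ?_)))
      (Ideal.mul_mem_right _ _ (Ideal.mem_sup_left ?_))
    · exact ⟨E, Ideal.mem_span_singleton_self E, rfl⟩
    · exact Ideal.pow_mem_of_mem _ (Ideal.mem_span_singleton_self E) _ (Nat.pos_of_ne_zero hp0)
  bounded := by
    refine ⟨0, fun m x hx => ?_⟩
    rw [pow_zero, one_mul]
    induction m with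
    | zero => simpa using hx
    | succ m ih =>
      refine ih ?_
      obtain ⟨x, rfl⟩ := Ideal.Quotient.mk_surjective x
      rw [← map_natCast (Ideal.Quotient.mk (Ideal.span {E})), ← map_pow, ← map_mul,
        Ideal.Quotient.eq_zero_iff_mem, Ideal.mem_span_singleton] at hx ⊢
      obtain ⟨y, hy⟩ := hx
      rw [pow_succ', mul_assoc] at hy
      obtain ⟨z, rfl⟩ := hreg y _ hy.symm
      refine ⟨z, sub_eq_zero.1 (hp _ ?_)⟩
      linear_combination hy

theorem IsDerivedCompleteAt.exists_sub_mul_eq_one {A : Type u} [CommRing A] {f : A}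
    (hf : IsDerivedCompleteAt f) : ∃ x, x - f * x = 1 := by
  obtain ⟨x, hx⟩ := hf.2 fun _ => 1
  -- by uniqueness, a solution with constant right hand side is constant
  have h : (fun n => x (n + 1)) = x := hf.1 (by
    funext n
    exact (congrFun hx (n + 1)).trans (congrFun hx n).symm)
  refine ⟨x 0, ?_⟩
  have h0 := congrFun hx 0
  have h1 : x 1 = x 0 := congrFun h 0
  simpa [h1] using h0

theorem le_of_isDerivedComplete {A : Type u} [CommRing A] {J : Ideal A}
    (hJ : IsDerivedComplete J) (m : Ideal A) [hm : m.IsMaximal] : J ≤ m := by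
  intro f hf
  by_contra hfm
  obtain ⟨a, b, hb, hab⟩ := hm.exists_inv hfm
  obtain ⟨x, hx⟩ := IsDerivedCompleteAt.exists_sub_mul_eq_one
    (hJ (a * f) (Ideal.mul_mem_left _ _ hf))
  refine hm.ne_top ((Ideal.eq_top_iff_one _).2 ?_)
  have h : (1 : A) = b * x := by
    rw [← hx]
    linear_combination -x * hab
  rw [h]
  exact Ideal.mul_mem_right _ _ hb

/-- Rigidity of prisms: an element of the ideal of a prism whose `δ` is a unit is a generator. -/
theorem IsBoundedPrism.eq_span (hp : p.Prime) {I : Ideal A} (h : IsBoundedPrism p A I) {E : A} (hE : E ∈ I)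
    (hδ : IsUnit (DeltaRing.delta p E)) :
    I = Ideal.span {E} ∧ ∀ x, E * x = 0 → x = 0 := by
  have := h.invertible
  let e : I := ⟨E, hE⟩
  let T : Ideal A := LinearMap.range (Module.Dual.eval A I e)
  have hT : T = ⊤ := by
    by_contra hne
    obtain ⟨m, hm, hTm⟩ := Ideal.exists_le_maximal T hne
    have hIm : I ⊔ Ideal.span {(p : A)} ≤ m := le_of_isDerivedComplete h.derivedComplete m
    have hpm : (p : A) ∈ m := hIm (Ideal.mem_sup_right (Ideal.mem_span_singleton_self _))
    obtain ⟨t, ht⟩ := (Module.Invertible.bijective (R := A) (M := I)).2 1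
    -- since `I` has rank one, `φ(x) E = φ(E) x` for `φ` in the dual of `I` and `x` in `I`
    have hsymm : ∀ (φ : Module.Dual A I) (x : I), φ x * E = φ e * (x : A) := fun φ x => by
      have h1 := congrArg (TensorProduct.lid A I ∘ LinearMap.rTensor I φ)
        (Module.Invertible.tmul_comm (m₁ := x) (m₂ := e))
      simpa using congrArg (Subtype.val) h1
    have key : ∀ t : Module.Dual A I ⊗[A] I,
        DeltaRing.delta p (contractLeft A I t * E) ∈ m ∧ contractLeft A I t * E ∈ m := fun t => by
      induction t with
      | zero => simp [DeltaRing.delta_zero]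
      | tmul φ x =>
        have hφ : φ e ∈ m := hTm ⟨φ, rfl⟩
        have hx : (x : A) ∈ m := hIm (Ideal.mem_sup_left x.2)
        rw [contractLeft_apply, hsymm]
        refine ⟨?_, Ideal.mul_mem_right _ _ hφ⟩
        rw [DeltaRing.delta_mul]
        refine add_mem (add_mem (Ideal.mul_mem_right _ _ (Ideal.pow_mem_of_mem _ hφ _ hp.pos))
          (Ideal.mul_mem_right _ _ (Ideal.pow_mem_of_mem _ hx _ hp.pos)))
          (Ideal.mul_mem_right _ _ (Ideal.mul_mem_right _ _ hpm))
      | add s t hs ht =>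
        rw [map_add, add_mul]
        refine ⟨?_, add_mem hs.2 ht.2⟩
        rw [DeltaRing.delta_add']
        exact sub_mem (add_mem hs.1 ht.1) (deltaCross_mem_left _ hs.2 _)
    have h2 := (key t).1
    rw [ht, one_mul] at h2
    exact hm.ne_top (Ideal.eq_top_of_isUnit_mem _ h2 hδ)
  obtain ⟨φ, hφ⟩ : (1 : A) ∈ T := by rw [hT]; trivial
  have hφ' : φ e = 1 := hφ
  have hsurj : Function.Surjective φ := fun a => ⟨a • e, by rw [map_smul, hφ', smul_eq_mul, mul_one]⟩
  have hinj := (Module.Invertible.bijective_of_surjective hsurj).1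
  constructor
  · refine le_antisymm (fun x hx => ?_) ((Ideal.span_singleton_le_iff_mem _).2 hE)
    have h3 : (⟨x, hx⟩ : I) = φ ⟨x, hx⟩ • e := hinj (by rw [map_smul, hφ', smul_eq_mul, mul_one])
    exact Ideal.mem_span_singleton'.2 ⟨_, (congrArg Subtype.val h3).symm⟩
  · intro x hx
    have h3 : x • e = 0 := Subtype.ext (by simpa [e, mul_comm] using hx)
    simpa [hφ'] using congrArg φ h3

/-- A bounded prism whose ideal is generated by a nonzerodivisor is classically complete. -/
theorem IsBoundedPrism.isAdicComplete {E : A} (h : IsBoundedPrism p A (Ideal.span {E}))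
    (hE : ∀ x, E * x = 0 → x = 0) :
    IsAdicComplete (Ideal.span {E} ⊔ Ideal.span {(p : A)}) A := by
  obtain ⟨n, hn⟩ := h.bounded
  refine isAdicComplete_of_isDerivedCompleteAt hE (h.derivedComplete _ (left_mem_sup_span _ _))
    (h.derivedComplete _ (right_mem_sup_span _ _)) n fun m x hx => ?_
  have := hn m (Ideal.Quotient.mk _ x)
  rw [← map_natCast (Ideal.Quotient.mk (Ideal.span {E})), ← map_pow, ← map_pow, ← map_mul, ← map_mul,
    Ideal.Quotient.eq_zero_iff_mem, Ideal.Quotient.eq_zero_iff_mem, Ideal.mem_span_singleton,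
    Ideal.mem_span_singleton] at this
  exact this hx

end Bounded

namespace TransversalPrism

variable {p : ℕ} {S : Type u} [CommRing S] {ι : Type} (D : TransversalPrism p S ι)
  [hp : Fact p.Prime] [LinearOrder ι] [Finite ι]

theorem isBoundedPrism_env : IsBoundedPrism p D.Env (Ideal.span {D.i₁ D.E}) := by
  have : IsAdicComplete (Ideal.span {D.i₁ D.E} ⊔ Ideal.span {(p : D.Env)}) D.Env :=
    inferInstanceAs (IsAdicComplete D.envJ D.Env)
  exact isBoundedPrism_span_singleton D.env_E_torsionFree D.env_torsionFree D.env_regular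
    (b := D.i₁ D.b) (by rw [env_frob, envφ_i₁, D.φ_E]; simp) hp.out.ne_zero (D.isUnit_b.map _)

end TransversalPrism

/-! ### The universal property of the self-product -/

namespace TransversalPrism

open MvPolynomial

variable {p : ℕ} {S : Type u} [CommRing S] {ι : Type} (D : TransversalPrism p S ι)
  [hp : Fact p.Prime]

/-- The coordinate `z_j` of the self-product, for which the two copies of `x_j` differ by `E z_j`. -/
noncomputable def z (j : ι) : D.Env := D.toEnv (X (DeltaVar.mk j 0))

section

variable [LinearOrder ι] [Finite ι] {Y : Type u} [CommRing Y] [DeltaRing p Y]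

theorem map_delta_i₁ {f : D.Env →+* Y}
    (hf : ∀ a, f (DeltaRing.delta p a) = DeltaRing.delta p (f a)) {x y : S}
    (h : D.φ x = x ^ p + p * y) : f (D.i₁ y) = DeltaRing.delta p (f (D.i₁ x)) := by
  rw [← hf, i₁, RingHom.comp_apply, RingHom.comp_apply, delta_toEnv, D.δ_C h]

theorem map_toEnv_X {f : D.Env →+* Y}
    (hf : ∀ a, f (DeltaRing.delta p a) = DeltaRing.delta p (f a)) (j : ι) (n : ℕ) :
    f (D.toEnv (X (DeltaVar.mk j n))) = (DeltaRing.delta p)^[n] (f (D.z j)) := by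
  induction n with
  | zero => rfl
  | succ n ih => rw [← D.δ_X, ← delta_toEnv, hf, ih, Function.iterate_succ_apply']

theorem env_hom_ext {J : Ideal Y} [IsHausdorff J Y] {f g : D.Env →+* Y}
    (hf : ∀ a, f (DeltaRing.delta p a) = DeltaRing.delta p (f a))
    (hg : ∀ a, g (DeltaRing.delta p a) = DeltaRing.delta p (g a))
    (h₁ : ∀ s, f (D.i₁ s) = g (D.i₁ s)) (hz : ∀ j, f (D.z j) = g (D.z j))
    (hfJ : D.envJ ≤ J.comap f) : f = g := by
  have hgJ : D.envJ ≤ J.comap g := by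
    rw [envJ, sup_le_iff, Ideal.span_singleton_le_iff_mem, Ideal.span_singleton_le_iff_mem,
      Ideal.mem_comap, Ideal.mem_comap, ← h₁, map_natCast, ← map_natCast f]
    exact ⟨hfJ D.E_mem_envJ, hfJ D.p_mem_envJ⟩
  refine ringHom_ext_of_dense hfJ hgJ (Set.range D.toEnv) ?_ fun a n => ?_
  · rintro _ ⟨q, rfl⟩
    refine RingHom.congr_fun (f := f.comp D.toEnv) (g := g.comp D.toEnv) ?_ q
    refine MvPolynomial.ringHom_ext h₁ fun v => ?_
    obtain ⟨j, n, rfl⟩ : ∃ j n, v = DeltaVar.mk j n :=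
      ⟨(ofLex v).1, OrderDual.ofDual (ofLex v).2, rfl⟩
    rw [RingHom.comp_apply, RingHom.comp_apply, D.map_toEnv_X hf, D.map_toEnv_X hg, hz]
  · obtain ⟨q, hq⟩ := D.exists_sub_toEnv_mem a n
    exact ⟨_, ⟨q, rfl⟩, hq⟩

theorem exists_env_hom {F : Y} {J : Ideal Y} [IsAdicComplete J Y] (hFJ : F ∈ J) (hpJ : (p : Y) ∈ J)
    (q₁ q₂ : S →+* Y)
    (hq₁ : ∀ x y, D.φ x = x ^ p + p * y → q₁ y = DeltaRing.delta p (q₁ x))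
    (hq₂ : ∀ x y, D.φ x = x ^ p + p * y → q₂ y = DeltaRing.delta p (q₂ x))
    (hE : q₁ D.E = F) (ζ : ι → Y) (hζ : ∀ j, q₂ (D.x j) = q₁ (D.x j) + F * ζ j) :
    ∃ f : D.Env →+* Y, (∀ a, f (DeltaRing.delta p a) = DeltaRing.delta p (f a)) ∧
      (∀ s, f (D.i₁ s) = q₁ s) ∧ (∀ j, f (D.z j) = ζ j) ∧ D.envJ ≤ J.comap f := by
  let _ : DeltaRing p (MvPolynomial (DeltaVar ι) S) := D.freeDeltaRing
  have hδ : ∀ q, DeltaRing.delta p q = D.δ q := fun _ => rfl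
  let g₀ : MvPolynomial (DeltaVar ι) S →+* Y := eval₂Hom q₁ fun v =>
    (DeltaRing.delta p)^[OrderDual.ofDual (ofLex v).2] (ζ (ofLex v).1)
  have hg₀X : ∀ j n, g₀ (X (DeltaVar.mk j n)) = (DeltaRing.delta p)^[n] (ζ j) := fun j n =>
    eval₂Hom_X' _ _ _
  have hg₀C : ∀ s, g₀ (C s) = q₁ s := fun s => eval₂Hom_C _ _ _
  have hg₀ : ∀ q, g₀ (D.δ q) = DeltaRing.delta p (g₀ q) := by
    intro q
    rw [← hδ, ← DeltaRing.mem_eqSubring]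
    induction q using MvPolynomial.induction_on with
    | C s =>
      obtain ⟨t, ht⟩ := Ideal.mem_span_singleton.1 (D.frobeniusLift s)
      have ht' : D.φ s = s ^ p + p * t := by rw [← ht]; ring
      rw [DeltaRing.mem_eqSubring, hδ, D.δ_C ht', hg₀C, hg₀C, hq₁ _ _ ht']
    | add f g hf hg => exact add_mem hf hg
    | mul_X f v hf =>
      refine mul_mem hf ?_
      obtain ⟨j, n, rfl⟩ : ∃ j n, v = DeltaVar.mk j n :=
        ⟨(ofLex v).1, OrderDual.ofDual (ofLex v).2, rfl⟩
      rw [DeltaRing.mem_eqSubring, hδ, δ_X, hg₀X, hg₀X, Function.iterate_succ_apply']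
  have hδ0 : ∀ n, (DeltaRing.delta p)^[n] (0 : Y) = 0 := fun n =>
    Function.iterate_fixed DeltaRing.delta_zero n
  have hrel : ∀ j n, g₀ (D.rel j n) = 0 := by
    intro j n
    have h1 : ∀ n, g₀ (D.δ^[n] (D.y j)) = (DeltaRing.delta p)^[n] (q₂ (D.x j)) := by
      intro n
      induction n with
      | zero =>
        change g₀ (C (D.x j) + C D.E * X (DeltaVar.mk j 0)) = q₂ (D.x j)
        rw [map_add, map_mul, hg₀C, hg₀C, hg₀X, hE, hζ]
        rfl
      | succ n ih => rw [Function.iterate_succ_apply', hg₀, ih, Function.iterate_succ_apply']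
    rw [rel, h1, Function.iterate_succ_apply, ← hq₂ (D.x j) 0 (by rw [D.φ_x]; ring), map_zero, hδ0]
  let g : D.PreEnv →+* Y := Ideal.Quotient.lift D.relIdeal g₀ fun f hf =>
    D.relIdeal_le (I := RingHom.ker g₀) hrel hf
  have hg : D.preJ ≤ J.comap g := by
    rw [Ideal.map_le_iff_le_comap, TransversalPrism.J, sup_le_iff, Ideal.span_singleton_le_iff_mem,
      Ideal.span_singleton_le_iff_mem]
    constructor
    · change g₀ (C D.E) ∈ J
      rwa [hg₀C, hE]
    · change g₀ (C (p : S)) ∈ J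
      rwa [hg₀C, map_natCast]
  obtain ⟨f, hf⟩ := exists_extension g hg
  have hf' : ∀ q, f (D.toEnv q) = g₀ q := fun q => hf _
  have hfJ : D.envJ ≤ J.comap f := by
    rw [envJ, sup_le_iff, Ideal.span_singleton_le_iff_mem, Ideal.span_singleton_le_iff_mem,
      Ideal.mem_comap, Ideal.mem_comap, map_natCast, i₁, RingHom.comp_apply, hf', hg₀C, hE]
    exact ⟨hFJ, hpJ⟩
  refine ⟨f, fun a => ?_, fun s => (hf' _).trans (hg₀C s), fun j => (hf' _).trans (hg₀X j 0), hfJ⟩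
  refine DeltaRing.map_delta_of_dense hp.out.ne_zero f D.p_mem_envJ hpJ hfJ (Set.range D.toEnv) ?_ ?_ a
  · rintro _ ⟨q, rfl⟩
    rw [delta_toEnv, hf', hf', hg₀]
  · intro a n
    obtain ⟨q, hq⟩ := D.exists_sub_toEnv_mem a n
    exact ⟨_, ⟨q, rfl⟩, hq⟩

end

end TransversalPrism

/-! ### Power series rings -/

section PowerSeriesRing

open PowerSeries

variable {p : ℕ} {R₀ : Type u} [CommRing R₀]

theorem natCast_dvd_powerSeries_iff {f : R₀⟦X⟧} :
    (p : R₀⟦X⟧) ∣ f ↔ ∀ n, (p : R₀) ∣ coeff n f := by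
  have hC : (p : R₀⟦X⟧) = C (p : R₀) := (map_natCast _ _).symm
  constructor
  · rintro ⟨g, rfl⟩ n
    rw [hC, coeff_C_mul]
    exact dvd_mul_right _ _
  · intro h
    choose g hg using h
    refine ⟨PowerSeries.mk g, PowerSeries.ext fun n => ?_⟩
    rw [hC, coeff_C_mul, coeff_mk, hg]

theorem powerSeries_torsionFree (h : ∀ x : R₀, (p : R₀) * x = 0 → x = 0) (f : R₀⟦X⟧)
    (hf : (p : R₀⟦X⟧) * f = 0) : f = 0 := by
  ext n
  rw [← map_natCast (C : R₀ →+* R₀⟦X⟧)] at hf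
  have := congrArg (coeff n) hf
  rw [coeff_C_mul, map_zero] at this
  rw [h _ this, map_zero]

theorem map_mk_eq_zero_iff_dvd {f : R₀⟦X⟧} :
    PowerSeries.map (Ideal.Quotient.mk (Ideal.span {(p : R₀)})) f = 0 ↔ (p : R₀⟦X⟧) ∣ f := by
  rw [natCast_dvd_powerSeries_iff, PowerSeries.ext_iff]
  refine forall_congr' fun n => ?_
  rw [coeff_map, map_zero, Ideal.Quotient.eq_zero_iff_mem, Ideal.mem_span_singleton]

variable [hp : Fact p.Prime] {φ : R₀ →+* R₀}

theorem powerSeriesFrob_C (a : R₀) : powerSeriesFrob p φ (C a) = C (φ a) := by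
  simp [powerSeriesFrob, expand_C]

theorem powerSeriesFrob_X : powerSeriesFrob p φ (X : R₀⟦X⟧) = X ^ p := by
  simp [powerSeriesFrob, expand_X]

theorem constantCoeff_powerSeriesFrob (f : R₀⟦X⟧) :
    constantCoeff (powerSeriesFrob p φ f) = φ (constantCoeff f) := by
  rw [← coeff_zero_eq_constantCoeff_apply f, ← coeff_map, coeff_zero_eq_constantCoeff_apply]
  exact constantCoeff_expand p hp.out.ne_zero _

theorem isFrobeniusLift_powerSeriesFrob (hφ : IsFrobeniusLift p φ)
    (h : Nontrivial (R₀ ⧸ Ideal.span {(p : R₀)})) : IsFrobeniusLift p (powerSeriesFrob p φ) := by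
  intro f
  have hnu : (p : R₀) ∈ nonunits R₀ := fun hu =>
    Ideal.Quotient.nontrivial_iff.1 h (Ideal.span_singleton_eq_top.2 hu)
  have := CharP.quotient R₀ p hnu
  set q := Ideal.Quotient.mk (Ideal.span {(p : R₀)}) with hq
  have h1 : q.comp φ = (frobenius (R₀ ⧸ Ideal.span {(p : R₀)}) p).comp q := by
    refine RingHom.ext fun x => ?_
    rw [RingHom.comp_apply, RingHom.comp_apply, frobenius_def, ← map_pow, ← sub_eq_zero, ← map_sub,
      Ideal.Quotient.eq_zero_iff_mem]
    exact hφ x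
  have h2 : PowerSeries.map q (powerSeriesFrob p φ f) = PowerSeries.map q f ^ p := by
    change PowerSeries.map q (expand p hp.out.ne_zero (PowerSeries.map φ f)) = _
    rw [map_expand, ← RingHom.comp_apply, ← map_comp, h1, map_comp, RingHom.comp_apply,
      ← map_expand]
    exact MvPowerSeries.map_frobenius_expand p hp.out.ne_zero
  rw [Ideal.mem_span_singleton, ← map_mk_eq_zero_iff_dvd, map_sub, map_pow, h2, sub_self]

/-- Power series can be evaluated at topologically nilpotent elements. -/
theorem exists_powerSeries_hom {Y : Type u} [CommRing Y] (J : Ideal Y) [IsAdicComplete J Y]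
    (g : R₀ →+* Y) {v : Y} {e : ℕ} (hv : v ^ e ∈ J) :
    ∃ h : R₀⟦X⟧ →+* Y, (∀ a, h (C a) = g a) ∧ h X = v := by
  let ψ : Polynomial R₀ →+* Y := Polynomial.eval₂RingHom g v
  have hψ : ∀ n (q : Polynomial R₀), (∀ m < e * n, q.coeff m = 0) → ψ q ∈ J ^ n := by
    intro n q hq
    obtain ⟨r, rfl⟩ := Polynomial.X_pow_dvd_iff.2 hq
    rw [map_mul, map_pow]
    refine Ideal.mul_mem_right _ _ ?_
    change (Polynomial.eval₂ g v Polynomial.X) ^ (e * n) ∈ J ^ n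
    rw [Polynomial.eval₂_X, pow_mul]
    exact Ideal.pow_mem_pow hv n
  have hψ' : ∀ n (q r : Polynomial R₀),
      (∀ m < e * n, q.coeff m = r.coeff m) → ψ q - ψ r ∈ J ^ n := by
    intro n q r hqr
    rw [← map_sub]
    exact hψ n _ fun m hm => by rw [Polynomial.coeff_sub, hqr m hm, sub_self]
  have hex : ∀ f : R₀⟦X⟧, ∃ L, ∀ n, L - ψ (trunc (e * n) f) ∈ J ^ n := fun f => by
    refine exists_limit J (fun n => ψ (trunc (e * n) f)) fun n => hψ' n _ _ fun m hm => ?_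
    rw [coeff_trunc, coeff_trunc, if_pos hm, if_pos (hm.trans_le (Nat.mul_le_mul_left e n.le_succ))]
  choose L hL using hex
  have huniq : ∀ (f : R₀⟦X⟧) (y : Y),
      (∀ n, ∃ q : Polynomial R₀, (∀ m < e * n, q.coeff m = coeff m f) ∧ y - ψ q ∈ J ^ n) →
      L f = y := by
    intro f y hy
    refine sub_eq_zero.1 (eq_zero_of_forall_mem_pow J fun n => ?_)
    obtain ⟨q, hq, hyq⟩ := hy n
    have h1 := hψ' n (trunc (e * n) f) q fun m hm => by rw [coeff_trunc, if_pos hm, hq m hm]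
    convert sub_mem (add_mem (hL f n) h1) hyq using 1
    ring
  have hpoly : ∀ q : Polynomial R₀, L q = ψ q := fun q =>
    huniq _ _ fun n => ⟨q, fun m _ => by rw [Polynomial.coeff_coe], by simp⟩
  let h : R₀⟦X⟧ →+* Y :=
    { toFun := L
      map_zero' := by simpa using hpoly 0
      map_one' := by simpa using hpoly 1
      map_add' := fun f g => huniq _ _ fun n =>
        ⟨trunc (e * n) f + trunc (e * n) g, fun m hm => by simp [coeff_trunc, hm], by
          convert add_mem (hL f n) (hL g n) using 1
          rw [map_add]
          ring⟩
      map_mul' := fun f g => huniq _ _ fun n =>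
        ⟨trunc (e * n) f * trunc (e * n) g, fun m hm => by
          rw [coeff_mul_eq_coeff_trunc_mul_trunc f g hm, ← Polynomial.coe_mul,
            Polynomial.coeff_coe], by
          convert add_mem (Ideal.mul_mem_right (L g) _ (hL f n))
            (Ideal.mul_mem_left _ (ψ (trunc (e * n) f)) (hL g n)) using 1
          rw [map_mul]
          ring⟩ }
  refine ⟨h, fun a => ?_, ?_⟩
  · have := hpoly (Polynomial.C a)
    rw [Polynomial.coe_C] at this
    exact this.trans (Polynomial.eval₂_C _ _)
  · have := hpoly Polynomial.X
    rw [Polynomial.coe_X] at this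
    exact this.trans (Polynomial.eval₂_X _ _)

theorem map_coe_polynomial_eq {Y : Type u} [CommRing Y] {f g : R₀⟦X⟧ →+* Y}
    (hC : ∀ a, f (C a) = g (C a)) (hX : f X = g X) (q : Polynomial R₀) : f q = g q := by
  have : f.comp Polynomial.coeToPowerSeries.ringHom = g.comp Polynomial.coeToPowerSeries.ringHom :=
    Polynomial.ringHom_ext (fun a => by simpa using hC a) (by simpa using hX)
  exact RingHom.congr_fun this q

theorem powerSeries_hom_ext {Y : Type u} [CommRing Y] (J : Ideal Y) [IsHausdorff J Y]
    {f g : R₀⟦X⟧ →+* Y} (hC : ∀ a, f (C a) = g (C a)) (hX : f X = g X) {e : ℕ}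
    (he : f X ^ e ∈ J) : f = g := by
  refine RingHom.ext fun s => sub_eq_zero.1 (eq_zero_of_forall_mem_pow J fun n => ?_)
  rw [eq_X_pow_mul_shift_add_trunc (e * n) s, map_add, map_add, map_coe_polynomial_eq hC hX,
    add_sub_add_right_eq_sub, map_mul, map_mul, map_pow, map_pow, ← hX, ← mul_sub, pow_mul]
  exact Ideal.mul_mem_right _ _ (Ideal.pow_mem_pow he n)

end PowerSeriesRing

/-! ### Breuil–Kisin prisms are transversal -/

/-- `O` is generated over `W` by `π`, and the minimal polynomial of `π` is an Eisenstein polynomial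
with respect to `p`. -/
structure IsEisensteinGenerator (p : ℕ) (W : Type u) [CommRing W] {O : Type u} [CommRing O]
    [Algebra W O] (π : O) : Prop where
  monic : (minpoly W π).Monic
  natDegree_pos : 0 < (minpoly W π).natDegree
  dvd_coeff : ∀ n < (minpoly W π).natDegree, (p : W) ∣ (minpoly W π).coeff n
  coeff_zero : ∃ v : W, IsUnit v ∧ (minpoly W π).coeff 0 = p * v
  adjoin_eq_top : Algebra.adjoin W {π} = ⊤
  dvd_of_aeval_eq_zero : ∀ q : Polynomial W, Polynomial.aeval π q = 0 → minpoly W π ∣ q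

/-- A base ring of a Breuil–Kisin prism: a `p`-torsion free and `p`-adically complete `W`-algebra
with a Frobenius lift `φ`, which is formally étale modulo powers of `p` over the coordinates `T_i`,
with `φ(T_i) = T_i ^ p`. -/
structure IsBKBase (p : ℕ) (W : Type u) [CommRing W] {R₀ : Type u} [CommRing R₀] [Algebra W R₀]
    {d : ℕ} (T : Fin d → R₀) (φ : R₀ →+* R₀) : Prop where
  torsionFree : ∀ x : R₀, (p : R₀) * x = 0 → x = 0
  isAdicComplete : IsAdicComplete (Ideal.span {(p : R₀)}) R₀
  nontrivial : Nontrivial (R₀ ⧸ Ideal.span {(p : R₀)})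
  frobeniusLift : IsFrobeniusLift p φ
  φ_T : ∀ i, φ (T i) = T i ^ p
  liftsUniquely : LiftsUniquely p W T

section

open PowerSeries

variable {p : ℕ} {W : Type u} [CommRing W] {O : Type u} [CommRing O] [Algebra W O] {π : O}
  (R₀ : Type u) [CommRing R₀] [Algebra W R₀]

theorem coeff_eisenstein (n : ℕ) :
    coeff n (eisenstein W π R₀) = algebraMap W R₀ ((minpoly W π).coeff n) := by
  simp [eisenstein]

theorem IsEisensteinGenerator.exists_eisenstein_eq (hπ : IsEisensteinGenerator p W π) :
    ∃ h : R₀⟦X⟧, eisenstein W π R₀ = X ^ (minpoly W π).natDegree + (p : R₀⟦X⟧) * h := by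
  suffices (p : R₀⟦X⟧) ∣ eisenstein W π R₀ - X ^ (minpoly W π).natDegree by
    obtain ⟨h, hh⟩ := this
    exact ⟨h, by rw [← hh]; ring⟩
  refine natCast_dvd_powerSeries_iff.2 fun n => ?_
  rw [map_sub, coeff_eisenstein, coeff_X_pow]
  rcases lt_trichotomy n (minpoly W π).natDegree with h | h | h
  · rw [if_neg h.ne, sub_zero]
    simpa using map_dvd (algebraMap W R₀) (hπ.dvd_coeff n h)
  · rw [if_pos h, h, Polynomial.coeff_natDegree, hπ.monic, map_one, sub_self]
    exact dvd_zero _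
  · rw [if_neg h.ne', Polynomial.coeff_eq_zero_of_natDegree_lt h, map_zero, sub_zero]
    exact dvd_zero _

theorem IsEisensteinGenerator.constantCoeff_eisenstein (hπ : IsEisensteinGenerator p W π) :
    ∃ v : R₀, IsUnit v ∧ constantCoeff (eisenstein W π R₀) = p * v := by
  obtain ⟨v, hv, h⟩ := hπ.coeff_zero
  refine ⟨algebraMap W R₀ v, hv.map _, ?_⟩
  rw [← coeff_zero_eq_constantCoeff_apply, coeff_eisenstein, h, map_mul, map_natCast]

theorem IsEisensteinGenerator.span_eisenstein_sup (hπ : IsEisensteinGenerator p W π) :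
    Ideal.span {eisenstein W π R₀} ⊔ Ideal.span {(p : R₀⟦X⟧)} =
      Ideal.span {X ^ (minpoly W π).natDegree} ⊔ Ideal.span {(p : R₀⟦X⟧)} := by
  obtain ⟨h, hh⟩ := hπ.exists_eisenstein_eq R₀
  refine le_antisymm (sup_le ?_ le_sup_right) (sup_le ?_ le_sup_right)
  · rw [Ideal.span_singleton_le_iff_mem, hh]
    exact add_mem (left_mem_sup_span _ _) (Ideal.mul_mem_right _ _ (right_mem_sup_span _ _))
  · rw [Ideal.span_singleton_le_iff_mem, ← add_sub_cancel_right (X ^ _) ((p : R₀⟦X⟧) * h), ← hh]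
    exact sub_mem (left_mem_sup_span _ _) (Ideal.mul_mem_right _ _ (right_mem_sup_span _ _))

theorem IsEisensteinGenerator.mem_span_iff (hπ : IsEisensteinGenerator p W π) {f : R₀⟦X⟧} :
    f ∈ Ideal.span {eisenstein W π R₀} ⊔ Ideal.span {(p : R₀⟦X⟧)} ↔
      ∀ n < (minpoly W π).natDegree, (p : R₀) ∣ coeff n f := by
  rw [hπ.span_eisenstein_sup R₀]
  set e := (minpoly W π).natDegree
  have hC : (p : R₀⟦X⟧) = C (p : R₀) := (map_natCast _ _).symm
  constructor
  · intro h n hn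
    obtain ⟨s, t, rfl⟩ := mem_sup_span_singleton.1 h
    rw [map_add, coeff_X_pow_mul', if_neg (by omega), zero_add, hC, coeff_C_mul]
    exact dvd_mul_right _ _
  · intro h
    rw [eq_X_pow_mul_shift_add_trunc e f]
    refine add_mem (Ideal.mul_mem_right _ _ (left_mem_sup_span _ _)) ?_
    refine Ideal.mem_sup_right (Ideal.mem_span_singleton.2 (natCast_dvd_powerSeries_iff.2 fun n => ?_))
    rw [Polynomial.coeff_coe, coeff_trunc]
    split_ifs with hn
    · exact h n hn
    · exact dvd_zero _

theorem IsEisensteinGenerator.regular (hπ : IsEisensteinGenerator p W π) {s t : R₀⟦X⟧}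
    (h : eisenstein W π R₀ * s = p * t) : (p : R₀⟦X⟧) ∣ s := by
  obtain ⟨g, hg⟩ := hπ.exists_eisenstein_eq R₀
  refine natCast_dvd_powerSeries_iff.2 fun n => ?_
  have h1 : X ^ (minpoly W π).natDegree * s = (p : R₀⟦X⟧) * (t - g * s) := by
    rw [hg] at h
    linear_combination h
  have h2 := natCast_dvd_powerSeries_iff.1 (Dvd.intro _ h1.symm) (n + (minpoly W π).natDegree)
  rwa [coeff_X_pow_mul] at h2

/-- In a ring which is complete for an ideal containing `p`, elements of the form `v + p w` with `v`
a unit are units. -/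
theorem isUnit_add_natCast_mul {A : Type u} [CommRing A] (J : Ideal A) [IsAdicComplete J A]
    (hp : (p : A) ∈ J) {v : A} (hv : IsUnit v) (w : A) : IsUnit (v + p * w) := by
  obtain ⟨c, hc⟩ := hv.exists_right_inv
  have h := Ideal.mem_jacobson_bot.1 (IsAdicComplete.le_jacobson_bot J hp) (w * c)
  have h2 : v + p * w = v * (p * (w * c) + 1) := by linear_combination -p * w * hc
  rw [h2]
  exact hv.mul h

end

section

open PowerSeries

variable {p : ℕ} [hp : Fact p.Prime] {W : Type u} [CommRing W] {O : Type u} [CommRing O]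
  [Algebra W O] {π : O} {R₀ : Type u} [CommRing R₀] [Algebra W R₀] {d : ℕ} {T : Fin d → R₀}
  {φ : R₀ →+* R₀}

theorem IsBKBase.exists_powerSeriesFrob_eisenstein (hR : IsBKBase p W T φ)
    (hπ : IsEisensteinGenerator p W π) : ∃ b : R₀⟦X⟧, IsUnit b ∧
      powerSeriesFrob p φ (eisenstein W π R₀) = eisenstein W π R₀ ^ p + p * b := by
  obtain ⟨b, hb⟩ := Ideal.mem_span_singleton.1
    (isFrobeniusLift_powerSeriesFrob hR.frobeniusLift hR.nontrivial (eisenstein W π R₀))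
  refine ⟨b, ?_, by rw [← hb]; ring⟩
  obtain ⟨v, hv, h⟩ := hπ.constantCoeff_eisenstein R₀
  have h1 := congrArg constantCoeff hb
  rw [map_sub, map_pow, constantCoeff_powerSeriesFrob, h, map_mul, map_mul, map_natCast,
    map_natCast] at h1
  have h2 : constantCoeff b = φ v + p * (-(p : R₀) ^ (p - 2) * v ^ p) := by
    refine sub_eq_zero.1 (hR.torsionFree _ ?_)
    have hp2 := hp.out.two_le
    have h3 : (p : R₀) ^ p = p * (p * (p : R₀) ^ (p - 2)) := by
      rw [← pow_succ', ← pow_succ']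
      congr 1
      omega
    rw [mul_pow, h3] at h1
    linear_combination -h1
  have := hR.isAdicComplete
  rw [isUnit_iff_constantCoeff, h2]
  exact isUnit_add_natCast_mul _ (Ideal.mem_span_singleton_self _) (hv.map φ) _

/-- The Breuil–Kisin prism as a transversal prism, with coordinates `u, T_1, …, T_d`. -/
noncomputable def IsBKBase.transversalPrism (hR : IsBKBase p W T φ)
    (hπ : IsEisensteinGenerator p W π) : TransversalPrism p R₀⟦X⟧ (Fin (d + 1)) where
  φ := powerSeriesFrob p φ
  frobeniusLift := isFrobeniusLift_powerSeriesFrob hR.frobeniusLift hR.nontrivial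
  torsionFree := powerSeries_torsionFree hR.torsionFree
  x := Fin.cons X fun i => C (T i)
  φ_x j := by
    refine Fin.cases ?_ (fun i => ?_) j
    · exact powerSeriesFrob_X
    · rw [Fin.cons_succ, powerSeriesFrob_C, hR.φ_T, map_pow]
  E := eisenstein W π R₀
  b := (hR.exists_powerSeriesFrob_eisenstein hπ).choose
  isUnit_b := (hR.exists_powerSeriesFrob_eisenstein hπ).choose_spec.1
  φ_E := (hR.exists_powerSeriesFrob_eisenstein hπ).choose_spec.2
  regular _ _ h := hπ.regular R₀ h
  nontrivial := by
    rw [Ideal.Quotient.nontrivial_iff, Ne, Ideal.eq_top_iff_one, hπ.mem_span_iff R₀]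
    intro h
    have h1 := h 0 hπ.natDegree_pos
    rw [coeff_zero_eq_constantCoeff_apply, map_one] at h1
    exact Ideal.Quotient.nontrivial_iff.1 hR.nontrivial
      (Ideal.span_singleton_eq_top.2 (isUnit_of_dvd_one h1))

theorem IsBKBase.i₁_X_pow_mem (hR : IsBKBase p W T φ) (hπ : IsEisensteinGenerator p W π) :
    (hR.transversalPrism hπ).i₁ X ^ (minpoly W π).natDegree ∈
      (hR.transversalPrism hπ).envJ := by
  have h : (X : R₀⟦X⟧) ^ (minpoly W π).natDegree ∈
      Ideal.span {eisenstein W π R₀} ⊔ Ideal.span {(p : R₀⟦X⟧)} := by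
    rw [hπ.span_eisenstein_sup R₀]
    exact left_mem_sup_span _ _
  obtain ⟨s, t, hst⟩ := mem_sup_span_singleton.1 h
  rw [← map_pow, hst, map_add, map_mul, map_mul, map_natCast]
  exact add_mem (Ideal.mul_mem_right _ _ (hR.transversalPrism hπ).E_mem_envJ)
    (Ideal.mul_mem_right _ _ (hR.transversalPrism hπ).p_mem_envJ)

end

/-! ### Existence of the self-product of a Breuil–Kisin prism -/

section

open PowerSeries

theorem tensor_ringHom_ext {W O R₀ B : Type u} [CommRing W] [CommRing O] [Algebra W O] [CommRing R₀]
    [Algebra W R₀] [CommRing B] {π : O} (hπ : Algebra.adjoin W {π} = ⊤)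
    {f g : R₀ ⊗[W] O →+* B} (h₁ : ∀ a, f (a ⊗ₜ 1) = g (a ⊗ₜ 1)) (h₂ : f (1 ⊗ₜ π) = g (1 ⊗ₜ π)) :
    f = g := by
  have hO : ∀ o : O, f (1 ⊗ₜ o) = g (1 ⊗ₜ o) := by
    intro o
    have ho : o ∈ Algebra.adjoin W {π} := by rw [hπ]; trivial
    induction ho using Algebra.adjoin_induction with
    | mem x hx => rwa [Set.mem_singleton_iff.1 hx]
    | algebraMap w =>
      rw [Algebra.algebraMap_eq_smul_one, ← TensorProduct.smul_tmul]
      exact h₁ _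
    | add x y _ _ hx hy => rw [TensorProduct.tmul_add, map_add, map_add, hx, hy]
    | mul x y _ _ hx hy =>
      rw [← one_mul (1 : R₀), ← Algebra.TensorProduct.tmul_mul_tmul, map_mul, map_mul, hx, hy]
  refine RingHom.ext fun r => ?_
  induction r using TensorProduct.induction_on with
  | zero => rw [map_zero, map_zero]
  | tmul a o =>
    rw [← mul_one a, ← one_mul o, ← Algebra.TensorProduct.tmul_mul_tmul, map_mul, map_mul, h₁, hO]
  | add x y hx hy => rw [map_add, map_add, hx, hy]

theorem IsEisensteinGenerator.exists_algHom {p : ℕ} {W O C : Type u} [CommRing W] [CommRing O]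
    [Algebra W O] [CommRing C] [Algebra W C] {π : O} (hπ : IsEisensteinGenerator p W π) {c : C}
    (hc : Polynomial.aeval c (minpoly W π) = 0) : ∃ g : O →ₐ[W] C, g π = c := by
  have hsurj : Function.Surjective (Polynomial.aeval (R := W) π) := by
    rw [← AlgHom.range_eq_top, ← Algebra.adjoin_singleton_eq_range_aeval, hπ.adjoin_eq_top]
  have hker : ∀ q ∈ RingHom.ker (Polynomial.aeval (R := W) π), Polynomial.aeval (R := W) c q = 0 := by
    intro q hq
    obtain ⟨r, rfl⟩ := hπ.dvd_of_aeval_eq_zero q hq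
    rw [map_mul, hc, zero_mul]
  let e := Ideal.quotientKerAlgEquivOfSurjective hsurj
  refine ⟨(Ideal.Quotient.liftₐ _ (Polynomial.aeval (R := W) c) hker).comp e.symm.toAlgHom, ?_⟩
  have h1 : e.symm π = Ideal.Quotient.mk _ Polynomial.X := by
    rw [AlgEquiv.symm_apply_eq]
    exact (Polynomial.aeval_X π).symm
  change Ideal.Quotient.liftₐ _ (Polynomial.aeval (R := W) c) hker (e.symm π) = c
  rw [h1]
  exact Polynomial.aeval_X c

variable {p : ℕ} [hp : Fact p.Prime] {k : Type u} [Field k] [CharP k p] [PerfectRing k p]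
  {O : Type u} [CommRing O] [Algebra (WittVector p k) O] {π : O} {R₀ : Type u} [CommRing R₀]
  [Algebra (WittVector p k) R₀] {d : ℕ} {T : Fin d → R₀} {φ : R₀ →+* R₀}

/-- Maps from `R₀⟦u⟧` are determined by the images of the coordinates and by a reduction. -/
theorem IsBKBase.powerSeries_hom_ext (hR : IsBKBase p (WittVector p k) T φ)
    (hπ : IsEisensteinGenerator p (WittVector p k) π) {Y : Type u} [CommRing Y] (J : Ideal Y)
    [IsHausdorff J Y] (hpJ : (p : Y) ∈ J) {f g : R₀⟦X⟧ →+* Y}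
    (hC : ∀ a, f (C a) - g (C a) ∈ J)
    (hx : ∀ j, f ((hR.transversalPrism hπ).x j) = g ((hR.transversalPrism hπ).x j)) {e : ℕ}
    (he : f X ^ e ∈ J) : f = g := by
  have h1 : f.comp C = g.comp C := hR.liftsUniquely.ringHom_ext J hpJ _ _ hC fun i => hx i.succ
  exact PrismIntersection.powerSeries_hom_ext J (fun a => RingHom.congr_fun h1 a) (hx 0) he

variable (hR : IsBKBase p (WittVector p k) T φ) (hπ : IsEisensteinGenerator p (WittVector p k) π)

/-- The second structure map of the self-product: the coordinates are moved by multiples of `E`, and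
the unique lifting property of `R₀` provides the map on all of `R₀`. -/
theorem IsBKBase.exists_i₂ : ∃ i₂ : R₀⟦X⟧ →+* (hR.transversalPrism hπ).Env,
    (∀ j, i₂ ((hR.transversalPrism hπ).x j) = (hR.transversalPrism hπ).i₁
      ((hR.transversalPrism hπ).x j) + (hR.transversalPrism hπ).i₁ (hR.transversalPrism hπ).E *
        (hR.transversalPrism hπ).z j) ∧
    ∀ a, (hR.transversalPrism hπ).i₁ (hR.transversalPrism hπ).E ∣
      i₂ (C a) - (hR.transversalPrism hπ).i₁ (C a) := by
  set D := hR.transversalPrism hπ with hD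
  let _ : Algebra (WittVector p k) D.Env :=
    ((D.i₁.comp C).comp (algebraMap (WittVector p k) R₀)).toAlgebra
  let i₀ : R₀ →ₐ[WittVector p k] D.Env := { D.i₁.comp C with commutes' := fun _ => rfl }
  have hi₀ : ∀ a, i₀ a = D.i₁ (C a) := fun _ => rfl
  obtain ⟨g, hg, hgT⟩ := hR.liftsUniquely.exists_algHom D.envJ D.p_mem_envJ i₀
    (fun i => D.i₁ (D.x i.succ) + D.i₁ D.E * D.z i.succ) fun i => by
      rw [hi₀]
      change D.i₁ (D.x i.succ) + D.i₁ D.E * D.z i.succ - D.i₁ (D.x i.succ) ∈ _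
      rw [add_sub_cancel_left]
      exact Ideal.mul_mem_right _ _ D.E_mem_envJ
  have hv : (D.i₁ X + D.i₁ D.E * D.z 0) ^ (minpoly (WittVector p k) π).natDegree ∈ D.envJ := by
    have h1 := hR.i₁_X_pow_mem hπ
    have h2 := (D.envJ).mem_of_dvd (sub_dvd_pow_sub_pow (D.i₁ X + D.i₁ D.E * D.z 0) (D.i₁ X)
      (minpoly (WittVector p k) π).natDegree) (by
        rw [add_sub_cancel_left]
        exact Ideal.mul_mem_right _ _ D.E_mem_envJ)
    have := add_mem h2 h1
    rwa [sub_add_cancel] at this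
  obtain ⟨i₂, hi₂, hi₂X⟩ := exists_powerSeries_hom D.envJ (g : R₀ →+* D.Env) hv
  refine ⟨i₂, fun j => ?_, fun a => ?_⟩
  · refine Fin.cases hi₂X (fun i => ?_) j
    exact (hi₂ _).trans (hgT i)
  · -- both maps agree modulo `E`, by the uniqueness of lifts in the `p`-adically separated `A / E`
    rw [hi₂, ← Ideal.mem_span_singleton, ← Ideal.Quotient.eq]
    set q := Ideal.Quotient.mk (Ideal.span {D.i₁ D.E}) with hq
    have hqE : q (D.i₁ D.E) = 0 := Ideal.Quotient.eq_zero_iff_mem.2 (Ideal.mem_span_singleton_self _)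
    have hmem : ∀ y ∈ D.envJ, q y ∈ Ideal.span {(p : D.Env ⧸ Ideal.span {D.i₁ D.E})} := by
      intro y hy
      obtain ⟨s, t, rfl⟩ := mem_sup_span_singleton.1 hy
      rw [map_add, map_mul, map_mul, hqE, zero_mul, zero_add, map_natCast]
      exact Ideal.mul_mem_right _ _ (Ideal.mem_span_singleton_self _)
    have hH : IsHausdorff (Ideal.span {(p : D.Env ⧸ Ideal.span {D.i₁ D.E})})
        (D.Env ⧸ Ideal.span {D.i₁ D.E}) := by
      refine isHausdorff_of_forall _ fun x hx => ?_
      obtain ⟨y, rfl⟩ := Ideal.Quotient.mk_surjective x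
      rw [Ideal.Quotient.eq_zero_iff_mem, Ideal.mem_span_singleton]
      refine D.E_dvd_of_forall fun n => ?_
      have h1 := hx n
      rw [Ideal.span_singleton_pow, Ideal.mem_span_singleton] at h1
      obtain ⟨c, hc⟩ := h1
      obtain ⟨c, rfl⟩ := Ideal.Quotient.mk_surjective c
      rw [← map_natCast q, ← map_pow, ← map_mul, Ideal.Quotient.eq, Ideal.mem_span_singleton] at hc
      obtain ⟨r, hr⟩ := hc
      refine ⟨r, ?_⟩
      rw [← hr, sub_sub_cancel]
      exact Ideal.mul_mem_right _ _ (Ideal.pow_mem_pow D.p_mem_envJ n)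
    refine RingHom.congr_fun (hR.liftsUniquely.ringHom_ext _ (Ideal.mem_span_singleton_self _)
      (q.comp (g : R₀ →+* D.Env)) (q.comp (D.i₁.comp C)) (fun x => ?_) fun i => ?_) a
    · rw [RingHom.comp_apply, RingHom.comp_apply, ← map_sub]
      exact hmem _ (hg x)
    · rw [RingHom.comp_apply, RingHom.coe_coe, hgT, map_add, map_mul, hqE, zero_mul, add_zero]
      rfl

end

/-! ### The universal property for Breuil–Kisin prisms -/

section

open PowerSeries

theorem PrismOver.Hom.ext_of_toRingHom {p : ℕ} {R : Type u} [CommRing R] {X Y : PrismOver p R}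
    {f g : X.Hom Y} (h : f.toRingHom = g.toRingHom) : f = g := by
  cases f
  cases g
  cases h
  rfl

section BKHom

variable {p : ℕ} [hp : Fact p.Prime] {W : Type u} [CommRing W] {O : Type u} [CommRing O]
  [Algebra W O] {π : O} {R₀ : Type u} [CommRing R₀] [Algebra W R₀] {d : ℕ} {T : Fin d → R₀}
  {φ : R₀ →+* R₀} {Y : PrismOver p (R₀ ⊗[W] O)}

theorem BKHom.ideal_eq (q : BKHom π φ Y) (hR : IsBKBase p W T φ)
    (hπ : IsEisensteinGenerator p W π) : Y.ideal = Ideal.span {q.toRingHom (eisenstein W π R₀)} ∧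
      ∀ y, q.toRingHom (eisenstein W π R₀) * y = 0 → y = 0 := by
  obtain ⟨b, hb, h⟩ := hR.exists_powerSeriesFrob_eisenstein hπ
  refine Y.isBoundedPrism.eq_span hp.out q.map_ideal ?_
  rw [← q.map_delta _ _ h]
  exact hb.map _

theorem BKHom.isAdicComplete (q : BKHom π φ Y) (hR : IsBKBase p W T φ)
    (hπ : IsEisensteinGenerator p W π) :
    IsAdicComplete (Ideal.span {q.toRingHom (eisenstein W π R₀)} ⊔ Ideal.span {(p : Y.carrier)})
      Y.carrier := by
  obtain ⟨h1, h2⟩ := q.ideal_eq hR hπ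
  have := Y.isBoundedPrism
  rw [h1] at this
  exact this.isAdicComplete h2

theorem BKHom.sub_mem_ideal_C (q₁ q₂ : BKHom π φ Y) (a : R₀) :
    q₂.toRingHom (C a) - q₁.toRingHom (C a) ∈ Y.ideal := by
  rw [← Ideal.Quotient.eq, q₁.map_str_C, q₂.map_str_C]

theorem BKHom.sub_mem_ideal_X (q₁ q₂ : BKHom π φ Y) :
    q₂.toRingHom X - q₁.toRingHom X ∈ Y.ideal := by
  rw [← Ideal.Quotient.eq, q₁.map_str_X, q₂.map_str_X]

theorem BKHom.X_pow_mem (q₁ q₂ : BKHom π φ Y) (hR : IsBKBase p W T φ)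
    (hπ : IsEisensteinGenerator p W π) :
    q₂.toRingHom X ^ (minpoly W π).natDegree ∈
      Ideal.span {q₁.toRingHom (eisenstein W π R₀)} ⊔ Ideal.span {(p : Y.carrier)} := by
  obtain ⟨h, hh⟩ := hπ.exists_eisenstein_eq R₀
  have h1 := congrArg q₂.toRingHom hh
  rw [map_add, map_mul, map_pow, map_natCast] at h1
  rw [← (q₁.ideal_eq hR hπ).1, ← add_sub_cancel_right (q₂.toRingHom X ^ _)
    ((p : Y.carrier) * q₂.toRingHom h), ← h1]
  exact sub_mem (Ideal.mem_sup_left q₂.map_ideal)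
    (Ideal.mem_sup_right (Ideal.mul_mem_right _ _ (Ideal.mem_span_singleton_self _)))

theorem IsBKBase.exists_str (hR : IsBKBase p W T φ)
    (hπ : IsEisensteinGenerator p W π) : ∃ str : R₀ ⊗[W] O →+* (hR.transversalPrism hπ).Env ⧸
      Ideal.span {(hR.transversalPrism hπ).i₁ (hR.transversalPrism hπ).E},
    (∀ a, str (a ⊗ₜ 1) = Ideal.Quotient.mk _ ((hR.transversalPrism hπ).i₁ (C a))) ∧
    str (1 ⊗ₜ π) = Ideal.Quotient.mk _ ((hR.transversalPrism hπ).i₁ X) := by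
  set D := hR.transversalPrism hπ with hD
  set q := Ideal.Quotient.mk (Ideal.span {D.i₁ D.E}) with hq
  let f : R₀ →+* D.Env ⧸ Ideal.span {D.i₁ D.E} := q.comp (D.i₁.comp C)
  let _ : Algebra W (D.Env ⧸ Ideal.span {D.i₁ D.E}) :=
    (f.comp (algebraMap W R₀)).toAlgebra
  let f' : R₀ →ₐ[W] D.Env ⧸ Ideal.span {D.i₁ D.E} := { f with commutes' := fun _ => rfl }
  have hroot : Polynomial.aeval (q (D.i₁ X)) (minpoly W π) = 0 := by
    have h1 : ((q.comp D.i₁).comp Polynomial.coeToPowerSeries.ringHom).comp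
        (Polynomial.mapRingHom (algebraMap W R₀)) =
        (Polynomial.aeval (q (D.i₁ X))).toRingHom := by
      refine Polynomial.ringHom_ext (fun w => ?_) ?_
      · simp
        rfl
      · simp
    refine (RingHom.congr_fun h1 (minpoly W π)).symm.trans ?_
    exact Ideal.Quotient.eq_zero_iff_mem.2 (Ideal.mem_span_singleton_self _)
  obtain ⟨g, hg⟩ := hπ.exists_algHom hroot
  refine ⟨(Algebra.TensorProduct.lift f' g fun _ _ => Commute.all _ _).toRingHom, fun a => ?_, ?_⟩
  · change Algebra.TensorProduct.lift f' g _ (a ⊗ₜ 1) = _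
    rw [Algebra.TensorProduct.lift_tmul, map_one, mul_one]
    rfl
  · change Algebra.TensorProduct.lift f' g _ (1 ⊗ₜ π) = _
    rw [Algebra.TensorProduct.lift_tmul, map_one, one_mul, hg]

end BKHom

variable {p : ℕ} [hp : Fact p.Prime] {k : Type u} [Field k] [CharP k p] [PerfectRing k p]
  {O : Type u} [CommRing O] [Algebra (WittVector p k) O] {π : O} {R₀ : Type u} [CommRing R₀]
  [Algebra (WittVector p k) R₀] {d : ℕ} {T : Fin d → R₀} {φ : R₀ →+* R₀}
  (hR : IsBKBase p (WittVector p k) T φ) (hπ : IsEisensteinGenerator p (WittVector p k) π)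

namespace IsBKBase

/-- The second structure map of the self-product. -/
noncomputable def i₂ : R₀⟦X⟧ →+* (hR.transversalPrism hπ).Env :=
  (hR.exists_i₂ hπ).choose

theorem i₂_x (j : Fin (d + 1)) : hR.i₂ hπ ((hR.transversalPrism hπ).x j) =
    (hR.transversalPrism hπ).i₁ ((hR.transversalPrism hπ).x j) +
      (hR.transversalPrism hπ).i₁ (hR.transversalPrism hπ).E * (hR.transversalPrism hπ).z j :=
  (hR.exists_i₂ hπ).choose_spec.1 j

theorem E_dvd_i₂_C_sub (a : R₀) : (hR.transversalPrism hπ).i₁ (hR.transversalPrism hπ).E ∣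
    hR.i₂ hπ (C a) - (hR.transversalPrism hπ).i₁ (C a) :=
  (hR.exists_i₂ hπ).choose_spec.2 a

theorem E_dvd_i₂_X_sub : (hR.transversalPrism hπ).i₁ (hR.transversalPrism hπ).E ∣
    hR.i₂ hπ X - (hR.transversalPrism hπ).i₁ X :=
  ⟨_, sub_eq_of_eq_add' (hR.i₂_x hπ 0)⟩

theorem i₂_X_pow_mem :
    hR.i₂ hπ X ^ (minpoly (WittVector p k) π).natDegree ∈ (hR.transversalPrism hπ).envJ := by
  have h2 := ((hR.transversalPrism hπ).envJ).mem_of_dvd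
    (sub_dvd_pow_sub_pow (hR.i₂ hπ X) ((hR.transversalPrism hπ).i₁ X)
      (minpoly (WittVector p k) π).natDegree)
    (Ideal.mem_of_dvd _ (hR.E_dvd_i₂_X_sub hπ) (hR.transversalPrism hπ).E_mem_envJ)
  have := add_mem h2 (hR.i₁_X_pow_mem hπ)
  rwa [sub_add_cancel] at this

theorem envφ_i₂ (s : R₀⟦X⟧) :
    (hR.transversalPrism hπ).envφ (hR.i₂ hπ s) = hR.i₂ hπ (powerSeriesFrob p φ s) := by
  have hX : hR.i₂ hπ (powerSeriesFrob p φ X) ^ (minpoly (WittVector p k) π).natDegree ∈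
      (hR.transversalPrism hπ).envJ := by
    rw [powerSeriesFrob_X, map_pow, ← pow_mul, mul_comm, pow_mul]
    exact Ideal.pow_mem_of_mem _ (hR.i₂_X_pow_mem hπ) _ hp.out.pos
  refine (RingHom.congr_fun (f := (hR.i₂ hπ).comp (powerSeriesFrob p φ))
    (g := (hR.transversalPrism hπ).envφ.comp (hR.i₂ hπ))
    (hR.powerSeries_hom_ext hπ (hR.transversalPrism hπ).envJ (hR.transversalPrism hπ).p_mem_envJ
      (fun a => ?_) (fun j => ?_) hX) s).symm
  · -- both maps lift the Frobenius
    rw [RingHom.comp_apply, RingHom.comp_apply]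
    have hp' : Ideal.span {(p : (hR.transversalPrism hπ).Env)} ≤ (hR.transversalPrism hπ).envJ :=
      le_sup_right
    have h1 := hp' ((hR.transversalPrism hπ).isFrobeniusLift_envφ (hR.i₂ hπ (C a)))
    obtain ⟨b, hb⟩ := Ideal.mem_span_singleton.1
      ((hR.transversalPrism hπ).frobeniusLift (C a))
    have hb' : powerSeriesFrob p φ (C a) = C a ^ p + p * b := by rw [← hb]; exact (add_sub_cancel _ _).symm
    rw [hb', map_add, map_mul, map_pow, map_natCast]
    have h2 : (p : (hR.transversalPrism hπ).Env) * hR.i₂ hπ b ∈ (hR.transversalPrism hπ).envJ :=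
      Ideal.mul_mem_right _ _ (hR.transversalPrism hπ).p_mem_envJ
    convert sub_mem h2 h1 using 1
    ring
  · -- the image of `x_j` is `x_j + E z_j`, and `δ(x_j + E z_j) = 0`
    have h1 : hR.i₂ hπ ((hR.transversalPrism hπ).x j) =
        (hR.transversalPrism hπ).toEnv ((hR.transversalPrism hπ).y j) := by
      rw [i₂_x, TransversalPrism.y, map_add, map_mul]
      rfl
    have h2 : (hR.transversalPrism hπ).envφ (hR.i₂ hπ ((hR.transversalPrism hπ).x j)) =
        hR.i₂ hπ ((hR.transversalPrism hπ).x j) ^ p := by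
      rw [← sub_eq_zero, ← TransversalPrism.p_mul_env_delta, h1, TransversalPrism.delta_toEnv,
        show (hR.transversalPrism hπ).δ ((hR.transversalPrism hπ).y j) =
          (hR.transversalPrism hπ).rel j 0 from rfl, (hR.transversalPrism hπ).toEnv_rel j 0, mul_zero]
    rw [RingHom.comp_apply, RingHom.comp_apply, h2, ← map_pow, ← (hR.transversalPrism hπ).φ_x]
    rfl

theorem i₂_eq_delta {x y : R₀⟦X⟧} (h : powerSeriesFrob p φ x = x ^ p + p * y) :
    hR.i₂ hπ y = DeltaRing.delta p (hR.i₂ hπ x) := by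
  refine (hR.transversalPrism hπ).env_cancel ?_
  rw [(hR.transversalPrism hπ).p_mul_env_delta, envφ_i₂, h, map_add, map_mul, map_pow, map_natCast,
    add_sub_cancel_left]

/-- The self-product of the Breuil–Kisin prism. -/
noncomputable def selfProduct : PrismOver p (R₀ ⊗[WittVector p k] O) where
  carrier := (hR.transversalPrism hπ).Env
  ideal := Ideal.span {(hR.transversalPrism hπ).i₁ (hR.transversalPrism hπ).E}
  isBoundedPrism := (hR.transversalPrism hπ).isBoundedPrism_env
  str := (hR.exists_str hπ).choose

/-- The first structure map of the self-product of the Breuil–Kisin prism. -/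
noncomputable def fst : BKHom π φ (hR.selfProduct hπ) where
  toRingHom := (hR.transversalPrism hπ).i₁
  map_delta _ _ h := (hR.transversalPrism hπ).map_delta_i₁ (f := RingHom.id _) (fun _ => rfl) h
  map_ideal := Ideal.mem_span_singleton_self _
  map_str_C a := ((hR.exists_str hπ).choose_spec.1 a).symm
  map_str_X := (hR.exists_str hπ).choose_spec.2.symm

/-- The second structure map of the self-product of the Breuil–Kisin prism. -/
noncomputable def snd : BKHom π φ (hR.selfProduct hπ) where
  toRingHom := hR.i₂ hπ
  map_delta _ _ h := hR.i₂_eq_delta hπ h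
  map_ideal := by
    set q := Ideal.Quotient.mk (hR.selfProduct hπ).ideal with hq
    have h1 := map_coe_polynomial_eq (f := q.comp (hR.i₂ hπ))
      (g := q.comp (hR.transversalPrism hπ).i₁)
      (fun a => Ideal.Quotient.eq.2 (Ideal.mem_span_singleton.2 (hR.E_dvd_i₂_C_sub hπ a)))
      (Ideal.Quotient.eq.2 (Ideal.mem_span_singleton.2 (hR.E_dvd_i₂_X_sub hπ)))
      ((minpoly (WittVector p k) π).map (algebraMap (WittVector p k) R₀))
    exact Ideal.Quotient.eq_zero_iff_mem.1
      (h1.trans (Ideal.Quotient.eq_zero_iff_mem.2 (Ideal.mem_span_singleton_self _)))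
  map_str_C a := (Ideal.Quotient.eq.2 (Ideal.mem_span_singleton.2 (hR.E_dvd_i₂_C_sub hπ a))).trans
    ((hR.exists_str hπ).choose_spec.1 a).symm
  map_str_X := (Ideal.Quotient.eq.2 (Ideal.mem_span_singleton.2 (hR.E_dvd_i₂_X_sub hπ))).trans
    (hR.exists_str hπ).choose_spec.2.symm

theorem isSelfProduct : IsSelfProduct (hR.fst hπ) (hR.snd hπ) := by
  intro Y q₁ q₂
  set D := hR.transversalPrism hπ with hD
  set F := q₁.toRingHom (eisenstein (WittVector p k) π R₀) with hF
  have := q₁.isAdicComplete hR hπ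
  obtain ⟨hI, hnzd⟩ := q₁.ideal_eq hR hπ
  set J := Ideal.span {F} ⊔ Ideal.span {(p : Y.carrier)} with hJ
  have hYJ : Y.ideal ≤ J := by rw [hI]; exact le_sup_left
  have hpJ : (p : Y.carrier) ∈ J := right_mem_sup_span _ _
  have hx : ∀ j, ∃ c, q₂.toRingHom (D.x j) = q₁.toRingHom (D.x j) + F * c := by
    intro j
    have : q₂.toRingHom (D.x j) - q₁.toRingHom (D.x j) ∈ Y.ideal := by
      refine Fin.cases ?_ (fun i => ?_) j
      · exact q₁.sub_mem_ideal_X q₂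
      · exact q₁.sub_mem_ideal_C q₂ _
    rw [hI, Ideal.mem_span_singleton] at this
    obtain ⟨c, hc⟩ := this
    exact ⟨c, by rw [← hc]; ring⟩
  choose ζ hζ using hx
  obtain ⟨f, hfδ, hf₁, hfz, hfJ⟩ := D.exists_env_hom (left_mem_sup_span F _) hpJ q₁.toRingHom
    q₂.toRingHom q₁.map_delta q₂.map_delta rfl ζ hζ
  have hf₂x : ∀ j, f (hR.i₂ hπ (D.x j)) = q₂.toRingHom (D.x j) := by
    intro j
    rw [i₂_x, map_add, map_mul, hf₁, hf₁, hfz, hζ]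
    rfl
  have hf₂ : f.comp (hR.i₂ hπ) = q₂.toRingHom := by
    refine hR.powerSeries_hom_ext hπ J hpJ (fun a => ?_) hf₂x (e := (minpoly (WittVector p k) π).natDegree) ?_
    · obtain ⟨c, hc⟩ := hR.E_dvd_i₂_C_sub hπ a
      rw [RingHom.comp_apply, sub_eq_iff_eq_add.1 hc, map_add, map_mul, hf₁, hf₁]
      have h1 := hYJ (q₁.sub_mem_ideal_C q₂ a)
      have h2 : F * f c ∈ J := Ideal.mul_mem_right _ _ (left_mem_sup_span _ _)
      convert sub_mem h2 h1 using 1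
      rw [hF]
      change q₁.toRingHom (eisenstein _ _ _) * _ + _ - _ = _
      ring
    · rw [RingHom.comp_apply]
      have h1 := hf₂x 0
      change f (hR.i₂ hπ X) = q₂.toRingHom X at h1
      rw [h1]
      exact q₁.X_pow_mem q₂ hR hπ
  have hfI : (hR.selfProduct hπ).ideal ≤ Y.ideal.comap f := by
    refine (Ideal.span_singleton_le_iff_mem _).2 ?_
    rw [Ideal.mem_comap, hf₁]
    exact q₁.map_ideal
  let fP : (hR.selfProduct hπ).carrier →+* Y.carrier := f
  let f' : (hR.selfProduct hπ).Hom Y :=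
    { toRingHom := fP
      map_delta := hfδ
      map_ideal := hfI
      map_str := RingHom.congr_fun (f := (Ideal.quotientMap Y.ideal fP hfI).comp
        (hR.selfProduct hπ).str) (g := Y.str) (tensor_ringHom_ext hπ.adjoin_eq_top
          (fun a => (congrArg (Ideal.quotientMap Y.ideal fP hfI) ((hR.fst hπ).map_str_C a).symm).trans
            ((congrArg (Ideal.Quotient.mk Y.ideal) (hf₁ _)).trans (q₁.map_str_C a)))
          ((congrArg (Ideal.quotientMap Y.ideal fP hfI) (hR.fst hπ).map_str_X.symm).trans
            ((congrArg (Ideal.Quotient.mk Y.ideal) (hf₁ _)).trans q₁.map_str_X))) }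
  refine ⟨f', ⟨RingHom.ext hf₁, hf₂⟩, ?_⟩
  rintro g ⟨hg₁, hg₂⟩
  let g₀ : D.Env →+* Y.carrier := g.toRingHom
  have hg₁' : ∀ s, g₀ (D.i₁ s) = q₁.toRingHom s := fun s => RingHom.congr_fun hg₁ s
  have hg₂' : ∀ s, g₀ (hR.i₂ hπ s) = q₂.toRingHom s := fun s => RingHom.congr_fun hg₂ s
  refine PrismOver.Hom.ext_of_toRingHom (D.env_hom_ext (J := J) (g := g₀) hfδ g.map_delta
    (fun s => (hf₁ s).trans (hg₁' s).symm) (fun j => ?_) hfJ).symm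
  refine sub_eq_zero.1 (hnzd _ ?_)
  have h1 := hg₂' (D.x j)
  rw [← hf₂x, i₂_x, map_add, map_add, map_mul, map_mul, hg₁', hf₁, hg₁', hf₁] at h1
  rw [mul_sub, sub_eq_zero]
  exact (add_left_cancel h1).symm

end IsBKBase

end

/-! ### The intersection for an abstract map of transversal rings -/

section Intersection

variable {p : ℕ} {A : Type u} [CommRing A]

theorem pow_natCast_dvd_of_E_pow_mul {E : A} (htf : ∀ x : A, (p : A) * x = 0 → x = 0)
    (hreg : ∀ x y : A, E * x = p * y → (p : A) ∣ x) (n m : ℕ) {x : A}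
    (h : (p : A) ^ n ∣ E ^ m * x) : (p : A) ^ n ∣ x := by
  have hone : ∀ n x, (p : A) ^ n ∣ E * x → (p : A) ^ n ∣ x := by
    intro n
    induction n with
    | zero => simp
    | succ n ih =>
      rintro x ⟨c, hc⟩
      obtain ⟨z, rfl⟩ := hreg x ((p : A) ^ n * c) (by rw [hc]; ring)
      rw [pow_succ']
      refine mul_dvd_mul_left _ (ih z ⟨c, sub_eq_zero.1 (htf _ ?_)⟩)
      linear_combination hc
  induction m with
  | zero => simpa using h
  | succ m ih => exact ih (hone n _ (by rwa [pow_succ', mul_assoc] at h))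

theorem pow_natCast_dvd_algebraMap_pCompl {X : Type u} [CommRing X] {n : ℕ} {x : X} :
    (p : PCompl p X) ^ n ∣ algebraMap X (PCompl p X) x ↔ (p : X) ^ n ∣ x := by
  rw [← Ideal.mem_span_singleton, ← Ideal.mem_span_singleton, ← Ideal.span_singleton_pow,
    ← Ideal.span_singleton_pow, ← algebraMap_mem_map_pow_iff (fg_span_singleton _) x n,
    map_span_natCast]

theorem pCompl_eq_zero_of_forall {X : Type u} [CommRing X] {x : PCompl p X}
    (h : ∀ n, (p : PCompl p X) ^ n ∣ x) : x = 0 := by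
  have := isAdicComplete_map_completion (fg_span_singleton (p : X))
  refine eq_zero_of_forall_mem_pow
    ((Ideal.span {(p : X)}).map (algebraMap X (PCompl p X))) fun n => ?_
  rw [map_span_natCast, Ideal.span_singleton_pow, Ideal.mem_span_singleton]
  exact h n

theorem pow_natCast_dvd_away_iff {E : A} (htf : ∀ x : A, (p : A) * x = 0 → x = 0)
    (hreg : ∀ x y : A, E * x = p * y → (p : A) ∣ x) {n : ℕ} {x : A} :
    (p : AwayCompl p E) ^ n ∣ AwayCompl.of p E x ↔ (p : A) ^ n ∣ x := by
  rw [AwayCompl.of, RingHom.comp_apply, pow_natCast_dvd_algebraMap_pCompl]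
  constructor
  · rintro ⟨c, hc⟩
    obtain ⟨m, y, hy⟩ := IsLocalization.Away.surj E c
    have h1 : algebraMap A (Localization.Away E) (E ^ m * x) =
        algebraMap A (Localization.Away E) (p ^ n * y) := by
      rw [map_mul, map_mul, map_pow, map_pow, map_natCast, ← hy, hc]
      ring
    obtain ⟨r, hr⟩ := IsLocalization.Away.exists_of_eq E h1
    refine pow_natCast_dvd_of_E_pow_mul htf hreg n (r + m) ⟨E ^ r * y, ?_⟩
    rw [pow_add]
    linear_combination hr
  · rintro ⟨c, rfl⟩
    rw [map_mul, map_pow, map_natCast]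
    exact dvd_mul_right _ _

theorem AwayCompl.exists_eq (E : A) (x : AwayCompl p E) (n : ℕ) :
    ∃ (a : A) (m : ℕ) (z : AwayCompl p E),
      AwayCompl.of p E E ^ m * x = AwayCompl.of p E a + (p : AwayCompl p E) ^ n * z := by
  obtain ⟨c, z, hz⟩ := PCompl.exists_eq_add x n
  obtain ⟨m, y, hy⟩ := IsLocalization.Away.surj E c
  refine ⟨y, m, AwayCompl.of p E E ^ m * z, ?_⟩
  rw [hz, AwayCompl.of, RingHom.comp_apply, RingHom.comp_apply, ← hy, map_mul, map_pow]
  ring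

theorem AwayCompl.isUnit_of (E : A) : IsUnit (AwayCompl.of p E E) :=
  (IsLocalization.Away.algebraMap_isUnit (S := Localization.Away E) E).map (algebraMap _ _)

theorem AwayCompl.map_of {B : Type u} [CommRing B] (f : A →+* B) {E : A} {F : B} (h : f E = F)
    (a : A) : AwayCompl.map p f h (AwayCompl.of p E a) = AwayCompl.of p F (f a) := by
  rw [AwayCompl.map, AwayCompl.of, RingHom.comp_apply, PCompl.map_algebraMap,
    IsLocalization.Away.lift_eq]
  rfl

/-- Let `f` be a map of `p`-torsion free rings, with `E` a nonzerodivisor modulo `p` in both of them,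
which is injective modulo `(p, E)`. Under the stated completeness conditions, `A` is the intersection
of `B` and `A[1/E]^∧_p` inside `B[1/E]^∧_p`. -/
theorem intersection_of_injective_mod {B : Type u} [CommRing B] (f : A →+* B) {E : A} {F : B}
    (hf : f E = F) [hc : IsAdicComplete (Ideal.span {(p : A)}) A]
    (hAtf : ∀ x : A, (p : A) * x = 0 → x = 0)
    (hAreg : ∀ x y : A, E * x = p * y → (p : A) ∣ x)
    (hAsep : ∀ x : A, (∀ n, x ∈ Ideal.span {E ^ n} ⊔ Ideal.span {(p : A)}) → (p : A) ∣ x)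
    (hBtf : ∀ x : B, (p : B) * x = 0 → x = 0)
    (hBreg : ∀ x y : B, F * x = p * y → (p : B) ∣ x)
    (hBsep : ∀ x : B, (∀ n, (p : B) ^ n ∣ x) → x = 0)
    (hinj : ∀ x, f x ∈ Ideal.span {F} ⊔ Ideal.span {(p : B)} →
      x ∈ Ideal.span {E} ⊔ Ideal.span {(p : A)}) :
    Function.Injective f ∧ Function.Injective (AwayCompl.of p E) ∧
      Function.Injective (AwayCompl.of p F) ∧ Function.Injective (AwayCompl.map p f hf) ∧
      ((AwayCompl.of p F).comp f).range =
        (AwayCompl.of p F).range ⊓ (AwayCompl.map p f hf).range := by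
  have hAsep' : ∀ x : A, (∀ n, (p : A) ^ n ∣ x) → x = 0 := fun x hx =>
    eq_zero_of_forall_mem_pow (Ideal.span {(p : A)}) fun n => by
      rw [Ideal.span_singleton_pow, Ideal.mem_span_singleton]
      exact hx n
  have hmodp : ∀ x, (p : B) ∣ f x → (p : A) ∣ x := by
    intro x hx
    refine hAsep x fun n => ?_
    induction n with
    | zero => exact Ideal.mem_sup_left (by simp)
    | succ n ih =>
      obtain ⟨a, b, rfl⟩ := mem_sup_span_singleton.1 ih
      have h1 : (p : B) ^ 1 ∣ F ^ n * f a := by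
        rw [map_add, map_mul, map_mul, map_pow, hf, map_natCast] at hx
        rw [pow_one]
        exact (dvd_add_left (dvd_mul_right _ _)).1 hx
      have h2 := pow_natCast_dvd_of_E_pow_mul hBtf hBreg 1 n h1
      rw [pow_one] at h2
      obtain ⟨s, t, rfl⟩ := mem_sup_span_singleton.1
        (hinj a (Ideal.mem_sup_right (Ideal.mem_span_singleton.2 h2)))
      exact mem_sup_span_singleton.2 ⟨s, E ^ n * t + b, by ring⟩
  have hmodpn : ∀ n x, (p : B) ^ n ∣ f x → (p : A) ^ n ∣ x := by
    intro n
    induction n with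
    | zero => simp
    | succ n ih =>
      rintro x ⟨c, hx⟩
      obtain ⟨y, rfl⟩ := hmodp x ⟨(p : B) ^ n * c, by rw [hx]; ring⟩
      rw [pow_succ']
      refine mul_dvd_mul_left _ (ih y ⟨c, sub_eq_zero.1 (hBtf _ ?_)⟩)
      rw [map_mul, map_natCast] at hx
      linear_combination hx
  have hofA : Function.Injective (AwayCompl.of p E) := by
    rw [injective_iff_map_eq_zero]
    refine fun x hx => hAsep' x fun n => (pow_natCast_dvd_away_iff hAtf hAreg).1 ?_
    rw [hx]
    exact dvd_zero _
  have hofB : Function.Injective (AwayCompl.of p F) := by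
    rw [injective_iff_map_eq_zero]
    refine fun x hx => hBsep x fun n => (pow_natCast_dvd_away_iff hBtf hBreg).1 ?_
    rw [hx]
    exact dvd_zero _
  -- approximation by `f(A)` is not destroyed by dividing by `E`
  have hdiv : ∀ n b a c, F * b = f a + (p : B) ^ n * c → ∃ a' c', b = f a' + (p : B) ^ n * c' := by
    intro n
    induction n with
    | zero => exact fun b a c _ => ⟨0, b, by simp⟩
    | succ n ih =>
      intro b a c h
      obtain ⟨s, t, rfl⟩ := mem_sup_span_singleton.1 (hinj a (mem_sup_span_singleton.2
        ⟨b, -((p : B) ^ n * c), by linear_combination -h⟩))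
      rw [map_add, map_mul, map_mul, hf, map_natCast] at h
      obtain ⟨b', hb'⟩ := hBreg (b - f s) (f t + (p : B) ^ n * c) (by linear_combination h)
      obtain ⟨a'', c'', h''⟩ := ih b' t c (sub_eq_zero.1 (hBtf _ (by linear_combination h - F * hb')))
      refine ⟨s + p * a'', c'', ?_⟩
      rw [map_add, map_mul, map_natCast]
      linear_combination hb' + p * h''
  have hdiv' : ∀ n m b a c, F ^ m * b = f a + (p : B) ^ n * c →
      ∃ a' c', b = f a' + (p : B) ^ n * c' := by
    intro n m
    induction m with
    | zero => exact fun b a c h => ⟨a, c, by simpa using h⟩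
    | succ m ih =>
      intro b a c h
      obtain ⟨a', c', h'⟩ := hdiv n (F ^ m * b) a c (by rw [← h]; ring)
      exact ih b a' c' h'
  refine ⟨?_, hofA, hofB, ?_, le_antisymm ?_ ?_⟩
  · rw [injective_iff_map_eq_zero]
    refine fun x hx => hAsep' x fun n => hmodpn n x ?_
    rw [hx]
    exact dvd_zero _
  · rw [injective_iff_map_eq_zero]
    refine fun x hx => pCompl_eq_zero_of_forall fun n => ?_
    obtain ⟨a, m, z, h⟩ := AwayCompl.exists_eq E x n
    have h1 := congrArg (AwayCompl.map p f hf) h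
    rw [map_mul, hx, mul_zero, map_add, AwayCompl.map_of, map_mul, map_pow, map_natCast] at h1
    have h2 : (p : AwayCompl p F) ^ n ∣ AwayCompl.of p F (f a) :=
      ⟨-AwayCompl.map p f hf z, by linear_combination -h1⟩
    have h3 := (pow_natCast_dvd_away_iff hAtf hAreg).2
      (hmodpn n a ((pow_natCast_dvd_away_iff hBtf hBreg).1 h2))
    have h4 : (p : AwayCompl p E) ^ n ∣ AwayCompl.of p E E ^ m * x := by
      rw [h]
      exact dvd_add h3 (dvd_mul_right _ _)
    exact ((AwayCompl.isUnit_of E).pow m).dvd_mul_left.1 h4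
  · rintro _ ⟨x, rfl⟩
    exact ⟨⟨f x, rfl⟩, ⟨AwayCompl.of p E x, AwayCompl.map_of f hf x⟩⟩
  · rintro _ ⟨⟨b, rfl⟩, ⟨x, hx⟩⟩
    have happ : ∀ n, ∃ a, (p : B) ^ n ∣ b - f a := by
      intro n
      obtain ⟨a, m, z, h⟩ := AwayCompl.exists_eq E x n
      have h1 := congrArg (AwayCompl.map p f hf) h
      rw [map_mul, hx, map_add, map_pow, AwayCompl.map_of, AwayCompl.map_of, hf, map_mul, map_pow,
        map_natCast] at h1
      have h2 : (p : AwayCompl p F) ^ n ∣ AwayCompl.of p F (F ^ m * b - f a) := by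
        rw [map_sub, map_mul, map_pow]
        exact ⟨AwayCompl.map p f hf z, by linear_combination h1⟩
      obtain ⟨c, hc⟩ := (pow_natCast_dvd_away_iff hBtf hBreg).1 h2
      obtain ⟨a', c', h'⟩ := hdiv' n m b a c (by linear_combination hc)
      exact ⟨a', c', by rw [h']; ring⟩
    choose a ha using happ
    obtain ⟨L, hL⟩ := exists_limit (Ideal.span {(p : A)}) a fun n => by
      rw [Ideal.span_singleton_pow, Ideal.mem_span_singleton]
      refine hmodpn n _ ?_
      have := dvd_sub (ha n) ((pow_dvd_pow _ n.le_succ).trans (ha (n + 1)))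
      rwa [sub_sub_sub_cancel_left, ← map_sub] at this
    refine ⟨L, congrArg (AwayCompl.of p F) (sub_eq_zero.1 (hBsep _ fun n => ?_)).symm⟩
    have h1 := hL n
    rw [Ideal.span_singleton_pow, Ideal.mem_span_singleton] at h1
    have h2 := map_dvd f h1
    rw [map_pow, map_natCast, map_sub] at h2
    have := dvd_sub (ha n) h2
    rwa [sub_sub, add_sub_cancel] at this

end Intersection

/-! ### The intersection for self-products of Breuil–Kisin prisms -/

section

open PowerSeries

section Iso

variable {p : ℕ} [hp : Fact p.Prime] {W : Type u} [CommRing W] {O : Type u} [CommRing O]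
  [Algebra W O] {π : O} {R₀ : Type u} [CommRing R₀] [Algebra W R₀] {φ : R₀ →+* R₀}

/-- The identity of a prism. -/
def PrismOver.Hom.id {R : Type u} [CommRing R] (X : PrismOver p R) : X.Hom X where
  toRingHom := RingHom.id _
  map_delta _ := rfl
  map_ideal := le_rfl
  map_str r := by
    obtain ⟨x, hx⟩ := Ideal.Quotient.mk_surjective (X.str r)
    rw [← hx]
    rfl

/-- The composition of maps of prisms. -/
def PrismOver.Hom.comp {R : Type u} [CommRing R] {X Y Z : PrismOver p R} (g : Y.Hom Z)
    (f : X.Hom Y) : X.Hom Z where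
  toRingHom := g.toRingHom.comp f.toRingHom
  map_delta x := by rw [RingHom.comp_apply, f.map_delta, g.map_delta, RingHom.comp_apply]
  map_ideal x hx := g.map_ideal (f.map_ideal hx)
  map_str r := by
    rw [← g.map_str, ← f.map_str]
    obtain ⟨x, hx⟩ := Ideal.Quotient.mk_surjective (X.str r)
    rw [← hx]
    rfl

theorem IsSelfProduct.hom_eq_id {P : PrismOver p (R₀ ⊗[W] O)} {i₁ i₂ : BKHom π φ P}
    (hP : IsSelfProduct i₁ i₂) {f : P.Hom P} (h₁ : f.toRingHom.comp i₁.toRingHom = i₁.toRingHom)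
    (h₂ : f.toRingHom.comp i₂.toRingHom = i₂.toRingHom) : f.toRingHom = RingHom.id _ :=
  congrArg PrismOver.Hom.toRingHom
    ((hP P i₁ i₂).unique ⟨h₁, h₂⟩ (y₂ := PrismOver.Hom.id P) ⟨rfl, rfl⟩)

/-- Two self-products are isomorphic. -/
theorem IsSelfProduct.exists_iso {P P' : PrismOver p (R₀ ⊗[W] O)} {i₁ i₂ : BKHom π φ P}
    {i₁' i₂' : BKHom π φ P'} (hP : IsSelfProduct i₁ i₂) (hP' : IsSelfProduct i₁' i₂') :
    ∃ (u : P.Hom P') (v : P'.Hom P),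
      (∀ x, v.toRingHom (u.toRingHom x) = x) ∧ (∀ x, u.toRingHom (v.toRingHom x) = x) ∧
      (∀ s, u.toRingHom (i₁.toRingHom s) = i₁'.toRingHom s) ∧
      (∀ s, u.toRingHom (i₂.toRingHom s) = i₂'.toRingHom s) ∧
      (∀ s, v.toRingHom (i₁'.toRingHom s) = i₁.toRingHom s) ∧
      (∀ s, v.toRingHom (i₂'.toRingHom s) = i₂.toRingHom s) := by
  obtain ⟨u, ⟨hu₁, hu₂⟩, -⟩ := hP P' i₁' i₂'
  obtain ⟨v, ⟨hv₁, hv₂⟩, -⟩ := hP' P i₁ i₂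
  have h₁ := hP.hom_eq_id (f := v.comp u) (by
    change (v.toRingHom.comp u.toRingHom).comp _ = _
    rw [RingHom.comp_assoc, hu₁, hv₁]) (by
    change (v.toRingHom.comp u.toRingHom).comp _ = _
    rw [RingHom.comp_assoc, hu₂, hv₂])
  have h₂ := hP'.hom_eq_id (f := u.comp v) (by
    change (u.toRingHom.comp v.toRingHom).comp _ = _
    rw [RingHom.comp_assoc, hv₁, hu₁]) (by
    change (u.toRingHom.comp v.toRingHom).comp _ = _
    rw [RingHom.comp_assoc, hv₂, hu₂])
  exact ⟨u, v, RingHom.congr_fun h₁, RingHom.congr_fun h₂, RingHom.congr_fun hu₁,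
    RingHom.congr_fun hu₂, RingHom.congr_fun hv₁, RingHom.congr_fun hv₂⟩

end Iso

theorem isAdicComplete_span_natCast {p : ℕ} {A : Type u} [CommRing A] (J : Ideal A)
    [IsAdicComplete J A] (hp : (p : A) ∈ J) : IsAdicComplete (Ideal.span {(p : A)}) A := by
  have hmem : ∀ {n : ℕ} {x : A}, x ∈ Ideal.span {(p : A)} ^ n ↔ (p : A) ^ n ∣ x := fun {n x} => by
    rw [Ideal.span_singleton_pow, Ideal.mem_span_singleton]
  have hH : IsHausdorff (Ideal.span {(p : A)}) A := isHausdorff_of_forall _ fun x hx =>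
    eq_zero_of_forall_mem_pow J fun n =>
      Ideal.pow_right_mono ((Ideal.span_singleton_le_iff_mem _).2 hp) n (hx n)
  have hP : IsPrecomplete (Ideal.span {(p : A)}) A := by
    refine isPrecomplete_of_exists_limit _ fun y hy => ?_
    have h : ∀ n, ∃ c, y (n + 1) - y n = (p : A) ^ n * c := fun n => hmem.1 (hy n)
    choose c hc using h
    obtain ⟨s, hs⟩ := (isDerivedCompleteAt_of_isAdicComplete J hp).exists_sum c
    refine ⟨y 0 + s, fun n => hmem.2 ?_⟩
    obtain ⟨t, ht⟩ := hs n
    have h1 : ∑ k ∈ Finset.range n, (p : A) ^ k * c k = y n - y 0 := by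
      rw [← Finset.sum_range_sub]
      exact Finset.sum_congr rfl fun k _ => (hc k).symm
    exact ⟨t, by rw [ht, h1]; ring⟩
  exact { hH, hP with }

variable {p : ℕ} [hp : Fact p.Prime] {k : Type u} [Field k] [CharP k p] [PerfectRing k p]
  {O : Type u} [CommRing O] [Algebra (WittVector p k) O] {π : O} {R₀ : Type u} [CommRing R₀]
  [Algebra (WittVector p k) R₀] {d : ℕ} {T : Fin d → R₀} {φ : R₀ →+* R₀}

/-- The properties of the self-product which enter into the intersection statement. -/
theorem IsSelfProduct.transversal (hR : IsBKBase p (WittVector p k) T φ)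
    (hπ : IsEisensteinGenerator p (WittVector p k) π)
    {P : PrismOver p (R₀ ⊗[WittVector p k] O)} {i₁ i₂ : BKHom π φ P} (hP : IsSelfProduct i₁ i₂) :
    IsAdicComplete (Ideal.span {(p : P.carrier)}) P.carrier ∧
    (∀ x : P.carrier, (p : P.carrier) * x = 0 → x = 0) ∧
    (∀ x y : P.carrier, i₁.toRingHom (eisenstein (WittVector p k) π R₀) * x = p * y →
      (p : P.carrier) ∣ x) ∧
    (∀ x : P.carrier, (∀ n, x ∈ Ideal.span {i₁.toRingHom (eisenstein (WittVector p k) π R₀) ^ n} ⊔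
      Ideal.span {(p : P.carrier)}) → (p : P.carrier) ∣ x) := by
  have hc := i₁.isAdicComplete hR hπ
  obtain ⟨uP, vP, hvu, -, hu₁, -⟩ := hP.exists_iso (hR.isSelfProduct hπ)
  set D := hR.transversalPrism hπ with hD
  let u : P.carrier →+* D.Env := uP.toRingHom
  let v : D.Env →+* P.carrier := vP.toRingHom
  have hvu' : ∀ x, v (u x) = x := hvu
  have hinj : Function.Injective u := Function.LeftInverse.injective hvu'
  have hE : u (i₁.toRingHom (eisenstein (WittVector p k) π R₀)) = D.i₁ D.E := hu₁ _
  have hdvd : ∀ x, (p : D.Env) ∣ u x → (p : P.carrier) ∣ x := fun x hx => by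
    have := map_dvd v hx
    rwa [map_natCast, hvu'] at this
  refine ⟨isAdicComplete_span_natCast _ (right_mem_sup_span
    (i₁.toRingHom (eisenstein (WittVector p k) π R₀)) _), fun x hx => ?_, fun x y hxy => ?_,
    fun x hx => ?_⟩
  · refine hinj ((D.env_torsionFree _ ?_).trans (map_zero u).symm)
    rw [← map_natCast u, ← map_mul, hx, map_zero]
  · have h1 := congrArg u hxy
    rw [map_mul, map_mul, hE, map_natCast] at h1
    exact hdvd x (D.env_regular _ _ h1)
  · refine hdvd x (D.p_dvd_of_forall fun n => ?_)
    obtain ⟨s, t, hst⟩ := mem_sup_span_singleton.1 (hx n)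
    refine ⟨u t, ?_⟩
    rw [hst, map_add, map_mul, map_mul, map_pow, hE, map_natCast, add_sub_cancel_right]
    exact Ideal.mul_mem_right _ _ (Ideal.pow_mem_pow D.E_mem_envJ n)

variable {R₁ : Type u} [CommRing R₁] [Algebra (WittVector p k) R₁] {φ₁ : R₁ →+* R₁}

/-- A map between self-products of transversal prisms is injective modulo `(p, E)` if the map of
prisms is, since modulo `(p, E)` the self-products are free with compatible bases, consisting of
monomials in the `z_{j,n}`. -/
theorem TransversalPrism.mem_envJ_of_map_mem {S S₁ : Type u} [CommRing S] [CommRing S₁] {ι : Type}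
    [LinearOrder ι] [Finite ι] (D : TransversalPrism p S ι) (D₁ : TransversalPrism p S₁ ι)
    (g : S →+* S₁) (hE : g D.E = D₁.E) (hg : ∀ s, g s ∈ D₁.J → s ∈ D.J)
    (f : D.Env →+* D₁.Env) (hδ : ∀ a, f (DeltaRing.delta p a) = DeltaRing.delta p (f a))
    (hf₁ : ∀ s, f (D.i₁ s) = D₁.i₁ (g s)) (hz : ∀ j, f (D.z j) = D₁.z j)
    {a : D.Env} (ha : f a ∈ D₁.envJ) : a ∈ D.envJ := by
  have hpoly : ∀ q, f (D.toEnv q) = D₁.toEnv (MvPolynomial.map g q) := by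
    refine RingHom.congr_fun (f := f.comp D.toEnv) (g := D₁.toEnv.comp (MvPolynomial.map g))
      (MvPolynomial.ringHom_ext (fun s => ?_) fun v => ?_)
    · rw [RingHom.comp_apply, RingHom.comp_apply, MvPolynomial.map_C]
      exact hf₁ s
    · obtain ⟨j, n, rfl⟩ : ∃ j n, v = DeltaVar.mk j n :=
        ⟨(ofLex v).1, OrderDual.ofDual (ofLex v).2, rfl⟩
      rw [RingHom.comp_apply, RingHom.comp_apply, MvPolynomial.map_X, D.map_toEnv_X hδ, hz]
      exact (D₁.map_toEnv_X (f := RingHom.id _) (fun _ => rfl) j n).symm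
  have hJ : D.envJ ≤ D₁.envJ.comap f := by
    rw [TransversalPrism.envJ, sup_le_iff, Ideal.span_singleton_le_iff_mem,
      Ideal.span_singleton_le_iff_mem, Ideal.mem_comap, Ideal.mem_comap, map_natCast, hf₁, hE]
    exact ⟨D₁.E_mem_envJ, D₁.p_mem_envJ⟩
  obtain ⟨l, hl, hal⟩ := D.exists_reducedPoly_sub_mem a 1
  rw [pow_one] at hal
  have h1 : D₁.toEnv (MvPolynomial.map g l) ∈ D₁.envJ ^ 1 := by
    have := sub_mem ha (hJ hal)
    rwa [map_sub, sub_sub_cancel, hpoly, ← pow_one D₁.envJ] at this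
  rw [D₁.toEnv_mem_iff_of_reducedPoly
    (fun e he => by rw [MvPolynomial.coeff_map, hl e he, map_zero])] at h1
  have h2 : D.toEnv l ∈ D.envJ ^ 1 := by
    refine (D.toEnv_mem_iff_of_reducedPoly hl).2 fun e => ?_
    have h3 := h1 e
    rw [MvPolynomial.coeff_map, pow_one] at h3
    rw [pow_one]
    exact hg _ h3
  rw [pow_one] at h2
  have := add_mem hal h2
  rwa [sub_add_cancel] at this

theorem IsBKBase.map_z (hR : IsBKBase p (WittVector p k) T φ) (g : R₀ →ₐ[WittVector p k] R₁)
    (hL : IsBKBase p (WittVector p k) (fun i => g (T i)) φ₁)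
    (hπ : IsEisensteinGenerator p (WittVector p k) π)
    (f : (hR.transversalPrism hπ).Env →+* (hL.transversalPrism hπ).Env)
    (hf₁ : ∀ s, f ((hR.transversalPrism hπ).i₁ s) =
      (hL.transversalPrism hπ).i₁ (PowerSeries.map (g : R₀ →+* R₁) s))
    (hf₂ : ∀ s, f (hR.i₂ hπ s) = hL.i₂ hπ (PowerSeries.map (g : R₀ →+* R₁) s)) (j : Fin (d + 1)) :
    f ((hR.transversalPrism hπ).z j) = (hL.transversalPrism hπ).z j := by
  have hE : PowerSeries.map (g : R₀ →+* R₁) (hR.transversalPrism hπ).E =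
      (hL.transversalPrism hπ).E := map_eisenstein g
  have hx : PowerSeries.map (g : R₀ →+* R₁) ((hR.transversalPrism hπ).x j) =
      (hL.transversalPrism hπ).x j := by
    refine Fin.cases ?_ (fun i => ?_) j
    · exact PowerSeries.map_X _
    · exact PowerSeries.map_C _ _
  refine sub_eq_zero.1 ((hL.transversalPrism hπ).env_E_torsionFree _ ?_)
  have h1 := hf₂ ((hR.transversalPrism hπ).x j)
  rw [hx, hR.i₂_x, hL.i₂_x, map_add, map_mul, hf₁, hf₁, hx, hE] at h1
  rw [mul_sub, sub_eq_zero]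
  exact add_left_cancel h1

/-- The intersection statement for the self-products of the Breuil–Kisin prisms of two bases, one of
which is injective modulo `p` into the other. -/
theorem intersection_selfProduct (hR : IsBKBase p (WittVector p k) T φ)
    (g : R₀ →ₐ[WittVector p k] R₁) (hL : IsBKBase p (WittVector p k) (fun i => g (T i)) φ₁)
    (hg : (g : R₀ →+* R₁).comp φ = φ₁.comp (g : R₀ →+* R₁))
    (hπ : IsEisensteinGenerator p (WittVector p k) π) (hginj : ∀ x, (p : R₁) ∣ g x → (p : R₀) ∣ x)
    {P : PrismOver p (R₀ ⊗[WittVector p k] O)} {i₁ i₂ : BKHom π φ P} (hP : IsSelfProduct i₁ i₂)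
    {Q : PrismOver p (R₁ ⊗[WittVector p k] O)} {j₁ j₂ : BKHom π φ₁ Q} (hQ : IsSelfProduct j₁ j₂) :
    let f := selfProductMap g hg hP j₁ j₂
    let E := i₁.toRingHom (eisenstein (WittVector p k) π R₀)
    let EL := j₁.toRingHom (eisenstein (WittVector p k) π R₁)
    let fE : AwayCompl p E →+* AwayCompl p EL :=
      AwayCompl.map p f (selfProductMap_eisenstein _ _ hP j₁ j₂)
    Function.Injective f ∧ Function.Injective (AwayCompl.of p E) ∧
      Function.Injective (AwayCompl.of p EL) ∧ Function.Injective fE ∧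
      ((AwayCompl.of p EL).comp f).range = (AwayCompl.of p EL).range ⊓ fE.range := by
  intro f E EL fE
  obtain ⟨hPc, hPtf, hPreg, hPsep⟩ := hP.transversal hR hπ
  obtain ⟨hQc, hQtf, hQreg, -⟩ := hQ.transversal hL hπ
  refine intersection_of_injective_mod f (selfProductMap_eisenstein _ _ hP j₁ j₂) hPtf hPreg hPsep
    hQtf hQreg (fun x hx => eq_zero_of_forall_mem_pow (Ideal.span {(p : Q.carrier)}) fun n => by
      rw [Ideal.span_singleton_pow, Ideal.mem_span_singleton]
      exact hx n) fun x hx => ?_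
  obtain ⟨uP, vP, hvuP, -, huP₁, -, hvP₁, hvP₂⟩ := hP.exists_iso (hR.isSelfProduct hπ)
  obtain ⟨uQ, vQ, -, -, huQ₁, huQ₂, -, -⟩ := hQ.exists_iso (hL.isSelfProduct hπ)
  have hspec := (hP _ (j₁.restrict g hg) (j₂.restrict g hg)).choose_spec.1
  have hfδ : ∀ a, f (DeltaRing.delta p a) = DeltaRing.delta p (f a) :=
    (hP _ (j₁.restrict g hg) (j₂.restrict g hg)).choose.map_delta
  have hf₁ : ∀ s, f (i₁.toRingHom s) = j₁.toRingHom (PowerSeries.map (g : R₀ →+* R₁) s) :=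
    RingHom.congr_fun hspec.1
  have hf₂ : ∀ s, f (i₂.toRingHom s) = j₂.toRingHom (PowerSeries.map (g : R₀ →+* R₁) s) :=
    RingHom.congr_fun hspec.2
  let u : P.carrier →+* (hR.transversalPrism hπ).Env := uP.toRingHom
  let v : (hR.transversalPrism hπ).Env →+* P.carrier := vP.toRingHom
  let w : Q.carrier →+* (hL.transversalPrism hπ).Env := uQ.toRingHom
  have hvδ : ∀ a, v (DeltaRing.delta p a) = DeltaRing.delta p (v a) := vP.map_delta
  have hwδ : ∀ a, w (DeltaRing.delta p a) = DeltaRing.delta p (w a) := uQ.map_delta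
  have hvu : ∀ x, v (u x) = x := hvuP
  have hv₁ : ∀ s, v ((hR.transversalPrism hπ).i₁ s) = i₁.toRingHom s := hvP₁
  have hv₂ : ∀ s, v (hR.i₂ hπ s) = i₂.toRingHom s := hvP₂
  have hw₁ : ∀ s, w (j₁.toRingHom s) = (hL.transversalPrism hπ).i₁ s := huQ₁
  have hw₂ : ∀ s, w (j₂.toRingHom s) = hL.i₂ hπ s := huQ₂
  have hc₁ : ∀ s, (w.comp (f.comp v)) ((hR.transversalPrism hπ).i₁ s) =
      (hL.transversalPrism hπ).i₁ (PowerSeries.map (g : R₀ →+* R₁) s) := fun s => by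
    simp only [RingHom.comp_apply, hv₁, hf₁, hw₁]
  have hc₂ : ∀ s, (w.comp (f.comp v)) (hR.i₂ hπ s) =
      hL.i₂ hπ (PowerSeries.map (g : R₀ →+* R₁) s) := fun s => by
    simp only [RingHom.comp_apply, hv₂, hf₂, hw₂]
  have hmem := (hR.transversalPrism hπ).mem_envJ_of_map_mem (hL.transversalPrism hπ)
    (PowerSeries.map (g : R₀ →+* R₁)) (map_eisenstein g)
    (fun s hs => (hπ.mem_span_iff R₀).2 fun n hn => hginj _ (by
      have := (hπ.mem_span_iff R₁).1 hs n hn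
      rwa [PowerSeries.coeff_map] at this))
    (w.comp (f.comp v)) (fun a => by simp only [RingHom.comp_apply, hvδ, hfδ, hwδ]) hc₁
    (hR.map_z g hL hπ _ hc₁ hc₂) (a := u x) (by
      rw [RingHom.comp_apply, RingHom.comp_apply, hvu]
      obtain ⟨s, t, hst⟩ := mem_sup_span_singleton.1 hx
      rw [hst, map_add, map_mul, map_mul, map_natCast, hw₁]
      exact add_mem (Ideal.mul_mem_right _ _ (hL.transversalPrism hπ).E_mem_envJ)
        (Ideal.mul_mem_right _ _ (hL.transversalPrism hπ).p_mem_envJ))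
  obtain ⟨s, t, hst⟩ := mem_sup_span_singleton.1 hmem
  have h1 := congrArg v hst
  rw [hvu, map_add, map_mul, map_mul, map_natCast, hv₁] at h1
  exact mem_sup_span_singleton.2 ⟨v s, v t, h1⟩

end

/-! ### The base rings -/

section BaseRings

variable {p : ℕ}

theorem pCompl_torsionFree {X : Type u} [CommRing X] (h : ∀ x : X, (p : X) * x = 0 → x = 0)
    (x : PCompl p X) (hx : (p : PCompl p X) * x = 0) : x = 0 := by
  refine pCompl_eq_zero_of_forall fun n => ?_
  obtain ⟨a, z, rfl⟩ := PCompl.exists_eq_add x n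
  have h1 : (p : PCompl p X) ^ (n + 1) ∣ algebraMap X (PCompl p X) (p * a) := by
    refine ⟨-z, ?_⟩
    rw [map_mul, map_natCast]
    linear_combination hx
  obtain ⟨b, hb⟩ := pow_natCast_dvd_algebraMap_pCompl.1 h1
  have h2 : a = (p : X) ^ n * b := sub_eq_zero.1 (h _ (by linear_combination hb))
  exact dvd_add (pow_natCast_dvd_algebraMap_pCompl.2 ⟨b, h2⟩) (dvd_mul_right _ _)

theorem isAdicComplete_pCompl (p : ℕ) (X : Type u) [CommRing X] :
    IsAdicComplete (Ideal.span {(p : PCompl p X)}) (PCompl p X) := by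
  have := isAdicComplete_map_completion (fg_span_singleton (p : X))
  rwa [map_span_natCast] at this

theorem torsionFree_of_flat {A B : Type u} [CommRing A] [CommRing B] [Algebra A B] [Module.Flat A B]
    (h : ∀ x : A, (p : A) * x = 0 → x = 0) (x : B) (hx : (p : B) * x = 0) : x = 0 := by
  have hreg : IsSMulRegular A (p : A) := fun a b hab => sub_eq_zero.1 (h _ (by
    have hab' : (p : A) * a = p * b := hab
    rw [mul_sub, hab', sub_self]))
  have := hreg.of_flat (S := B)
  rw [map_natCast] at this
  refine this (?_ : (p : B) * x = p * 0)
  rw [hx, mul_zero]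

theorem natCast_dvd_of_toOL₀ {W : Type u} [CommRing W] {R₀ : Type u} [CommRing R₀] [Algebra W R₀]
    [hprime : (Ideal.span {(p : R₀)}).IsPrime] {x : R₀} (h : (p : OL₀ p R₀) ∣ toOL₀ p R₀ W x) :
    (p : R₀) ∣ x := by
  rw [← pow_one (p : OL₀ p R₀)] at h
  obtain ⟨c, hc⟩ := pow_natCast_dvd_algebraMap_pCompl.1 h
  obtain ⟨⟨r, s⟩, hrs⟩ := IsLocalization.surj (Ideal.span {(p : R₀)}).primeCompl c
  have h1 : algebraMap R₀ (Localization.AtPrime (Ideal.span {(p : R₀)})) (x * s) =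
      algebraMap R₀ (Localization.AtPrime (Ideal.span {(p : R₀)})) (p * r) := by
    rw [map_mul, map_mul, map_natCast, ← hrs, hc]
    ring
  obtain ⟨t, ht⟩ := (IsLocalization.eq_iff_exists (Ideal.span {(p : R₀)}).primeCompl _).1 h1
  have h2 : x * (s * t) ∈ Ideal.span {(p : R₀)} :=
    Ideal.mem_span_singleton.2 ⟨r * t, by linear_combination ht⟩
  exact Ideal.mem_span_singleton.1 ((hprime.mem_or_mem h2).resolve_right (s * t).2)

variable [hp : Fact p.Prime]

theorem wittVector_torsionFree {k : Type u} [Field k] [CharP k p] (x : WittVector p k)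
    (hx : (p : WittVector p k) * x = 0) : x = 0 :=
  (mul_eq_zero.1 hx).resolve_left (WittVector.p_nonzero p k)

theorem isBKBase_pCompl {k : Type u} [Field k] [CharP k p] {d : ℕ} {S : Type u} [CommRing S]
    [Algebra (WittVector p k) S]
    [Algebra (TateLaurent p (WittVector p k) d) S]
    [IsScalarTower (WittVector p k) (TateLaurent p (WittVector p k) d) S]
    [Algebra.Etale (TateLaurent p (WittVector p k) d) S]
    [hprime : (Ideal.span {(p : PCompl p S)}).IsPrime]
    {φ : PCompl p S →+* PCompl p S} (hφ : IsFrobeniusLift p φ)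
    (hT : ∀ i : Fin d,
      φ (algebraMap S (PCompl p S) (algebraMap _ S (TateLaurent.coord p (WittVector p k) i))) =
        algebraMap S (PCompl p S) (algebraMap _ S (TateLaurent.coord p (WittVector p k) i)) ^ p) :
    IsBKBase p (WittVector p k) (fun i : Fin d => algebraMap S (PCompl p S)
      (algebraMap _ S (TateLaurent.coord p (WittVector p k) i))) φ where
  torsionFree := by
    have : Module.Flat (TateLaurent p (WittVector p k) d) S := Algebra.Smooth.flat _ _
    exact pCompl_torsionFree (torsionFree_of_flat (A := TateLaurent p (WittVector p k) d)
      (pCompl_torsionFree (torsionFree_of_flat (A := WittVector p k) wittVector_torsionFree)))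
  isAdicComplete := isAdicComplete_pCompl p S
  nontrivial := Ideal.Quotient.nontrivial_iff.2 hprime.ne_top
  frobeniusLift := hφ
  φ_T := hT
  liftsUniquely := (liftsUniquely_laurent p (WittVector p k) d).pCompl.etale.pCompl

theorem IsFrobeniusLift.localRingHom {R₀ : Type u} [CommRing R₀]
    [hprime : (Ideal.span {(p : R₀)}).IsPrime] {φ : R₀ →+* R₀} (hφ : IsFrobeniusLift p φ) :
    IsFrobeniusLift p (Localization.localRingHom _ _ φ (hφ.span_eq_comap p)) := by
  intro x
  rw [Ideal.mem_span_singleton]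
  obtain ⟨r, s, rfl⟩ := IsLocalization.exists_mk'_eq (Ideal.span {(p : R₀)}).primeCompl x
  set L := Localization.AtPrime (Ideal.span {(p : R₀)})
  set x := IsLocalization.mk' L r s with hx
  set Φ := Localization.localRingHom _ _ φ (hφ.span_eq_comap p) with hΦ
  have hs : ∀ r, r ∈ (Ideal.span {(p : R₀)}).primeCompl → IsUnit (algebraMap R₀ L r) := fun r hr =>
    IsLocalization.map_units L (⟨r, hr⟩ : (Ideal.span {(p : R₀)}).primeCompl)
  have hxs : x * algebraMap R₀ L s = algebraMap R₀ L r := IsLocalization.mk'_spec L r s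
  have hΦxs : Φ x * algebraMap R₀ L (φ s) = algebraMap R₀ L (φ r) := by
    rw [← Localization.localRingHom_to_map _ _ φ (hφ.span_eq_comap p),
      ← Localization.localRingHom_to_map _ _ φ (hφ.span_eq_comap p), ← map_mul, hxs]
  obtain ⟨a, ha⟩ := Ideal.mem_span_singleton.1 (hφ r)
  obtain ⟨b, hb⟩ := Ideal.mem_span_singleton.1 (hφ s)
  have hb' : algebraMap R₀ L (φ s) = algebraMap R₀ L s ^ p + p * algebraMap R₀ L b := by
    rw [← map_pow, ← map_natCast (algebraMap R₀ L), ← map_mul, ← map_add, ← hb, add_sub_cancel]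
  have ha' : algebraMap R₀ L (φ r) = algebraMap R₀ L r ^ p + p * algebraMap R₀ L a := by
    rw [← map_pow, ← map_natCast (algebraMap R₀ L), ← map_mul, ← map_add, ← ha, add_sub_cancel]
  have h1 : (p : L) ∣ algebraMap R₀ L s ^ p * (Φ x - x ^ p) := by
    refine ⟨algebraMap R₀ L a - Φ x * algebraMap R₀ L b, ?_⟩
    rw [hb', ha'] at hΦxs
    have h2 : x ^ p * algebraMap R₀ L s ^ p = algebraMap R₀ L r ^ p := by rw [← mul_pow, hxs]
    linear_combination hΦxs - h2
  exact ((hs s s.2).pow p).dvd_mul_left.1 h1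

theorem IsFrobeniusLift.frobL {R₀ : Type u} [CommRing R₀]
    [hprime : (Ideal.span {(p : R₀)}).IsPrime] {φ : R₀ →+* R₀} (hφ : IsFrobeniusLift p φ) :
    IsFrobeniusLift p (frobL p hφ) := by
  intro x
  rw [Ideal.mem_span_singleton]
  obtain ⟨a, z, rfl⟩ := PCompl.exists_eq_add x 1
  obtain ⟨b, hb⟩ := Ideal.mem_span_singleton.1 (hφ.localRingHom a)
  have h1 := congrArg (algebraMap _ (OL₀ p R₀)) hb
  rw [map_sub, map_pow, map_mul, map_natCast] at h1
  have h2 : PrismIntersection.frobL p hφ (algebraMap _ (OL₀ p R₀) a) = algebraMap _ (OL₀ p R₀)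
      (Localization.localRingHom _ _ φ (hφ.span_eq_comap p) a) := PCompl.map_algebraMap _ _ _
  rw [map_add, map_mul, map_pow, map_natCast, pow_one, h2,
    add_pow_eq_deltaCross hp.out, mul_pow]
  have h3 : (p : OL₀ p R₀) ^ p = p * (p : OL₀ p R₀) ^ (p - 1) :=
    (mul_pow_sub_one hp.out.ne_zero _).symm
  rw [h3]
  refine ⟨algebraMap _ (OL₀ p R₀) b + PrismIntersection.frobL p hφ z - (p : OL₀ p R₀) ^ (p - 1) * z ^ p -
    deltaCross p (algebraMap _ (OL₀ p R₀) a) (p * z), ?_⟩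
  linear_combination h1

theorem IsBKBase.oL₀ {W : Type u} [CommRing W] {R₀ : Type u} [CommRing R₀] [Algebra W R₀] {d : ℕ}
    {T : Fin d → R₀} {φ : R₀ →+* R₀} (hR : IsBKBase p W T φ)
    [hprime : (Ideal.span {(p : R₀)}).IsPrime] :
    IsBKBase p W (fun i => toOL₀ p R₀ W (T i))
      (frobL p hR.frobeniusLift) where
  torsionFree := by
    have : Module.Flat R₀ (Localization.AtPrime (Ideal.span {(p : R₀)})) :=
      IsLocalization.flat _ (Ideal.span {(p : R₀)}).primeCompl
    exact pCompl_torsionFree (torsionFree_of_flat hR.torsionFree)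
  isAdicComplete := isAdicComplete_pCompl p _
  nontrivial := by
    rw [Ideal.Quotient.nontrivial_iff]
    intro h
    refine hprime.ne_top (Ideal.span_singleton_eq_top.2 (isUnit_of_dvd_one ?_))
    refine natCast_dvd_of_toOL₀ (W := W) ?_
    rw [map_one]
    exact (Ideal.span_singleton_eq_top.1 h).dvd
  frobeniusLift := hR.frobeniusLift.frobL
  φ_T i := by
    rw [← map_pow, ← hR.φ_T]
    exact (RingHom.congr_fun (toOL₀_comp p W hR.frobeniusLift) (T i)).symm
  liftsUniquely := (hR.liftsUniquely.localization (Ideal.span {(p : R₀)}).primeCompl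
    (Localization.AtPrime (Ideal.span {(p : R₀)}))).pCompl

end BaseRings

/-! ### Totally ramified extensions -/

section Ramified

/-- In a local domain, a prime ideal with a principal power is generated by any irreducible element
it contains: such an ideal is invertible, hence principal. -/
theorem span_eq_of_irreducible {O : Type u} [CommRing O] [IsDomain O] [IsLocalRing O] {P : Ideal O}
    (hP : P = IsLocalRing.maximalIdeal O) {a : O} (ha : a ≠ 0) {n : ℕ}
    (h : Ideal.span {a} = P ^ (n + 1)) {π : O} (hπ : Irreducible π) : P = Ideal.span {π} := by
  have haP : ∀ {z}, z ∈ P ^ (n + 1) → ∃ c, z = a * c := fun {z} hz => by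
    rw [← h, Ideal.mem_span_singleton] at hz
    exact hz
  have hunit : ∀ {c}, c ∉ P → IsUnit c := fun {c} hc => by
    rw [hP, IsLocalRing.mem_maximalIdeal] at hc
    exact not_not.1 hc
  -- some product of elements of `P` and of `P ^ n` is `a` up to a unit
  obtain ⟨x, hx, y, hy, c, hc, hxy⟩ : ∃ x ∈ P, ∃ y ∈ P ^ n, ∃ c, IsUnit c ∧ x * y = a * c := by
    by_contra! hcon
    have hle : P ^ (n + 1) ≤ Ideal.span {a} * P := by
      rw [pow_succ', Ideal.mul_le]
      intro x hx y hy
      obtain ⟨c, hc⟩ := haP (z := x * y) (by rw [pow_succ']; exact Ideal.mul_mem_mul hx hy)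
      rw [hc]
      refine Ideal.mul_mem_mul (Ideal.mem_span_singleton_self a) ?_
      by_contra hcP
      exact hcon x hx y hy c (hunit hcP) hc
    have h1 : a ∈ Ideal.span {a} * P := hle (h ▸ Ideal.mem_span_singleton_self a)
    obtain ⟨z, hz, hza⟩ := Ideal.mem_span_singleton_mul.1 h1
    have h2 : z = 1 := mul_left_cancel₀ ha (by rw [hza, mul_one])
    rw [hP, h2] at hz
    exact (IsLocalRing.mem_maximalIdeal _).1 hz isUnit_one
  have hy0 : y ≠ 0 := by
    rintro rfl
    rw [mul_zero] at hxy
    exact mul_ne_zero ha hc.ne_zero hxy.symm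
  have hPx : ∀ z ∈ P, x ∣ z := by
    intro z hz
    obtain ⟨w, hw⟩ := haP (z := z * y) (by rw [pow_succ']; exact Ideal.mul_mem_mul hz hy)
    obtain ⟨c', hc'⟩ := hc.exists_right_inv
    refine ⟨c' * w, mul_right_cancel₀ hy0 ?_⟩
    linear_combination hw - c' * w * hxy - a * w * hc'
  have hπP : π ∈ P := by
    rw [hP, IsLocalRing.mem_maximalIdeal]
    exact hπ.not_isUnit
  obtain ⟨s, hs⟩ := hPx π hπP
  have hxu : ¬ IsUnit x := by
    rw [hP] at hx
    exact (IsLocalRing.mem_maximalIdeal _).1 hx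
  obtain ⟨s', hs'⟩ := ((hπ.isUnit_or_isUnit hs).resolve_left hxu).exists_right_inv
  refine le_antisymm (fun z hz => ?_) ((Ideal.span_singleton_le_iff_mem _).2 hπP)
  refine Ideal.mem_span_singleton.2 (Dvd.dvd.trans ⟨s', ?_⟩ (hPx z hz))
  linear_combination -s' * hs - x * hs'

/-- The terms of a `π`-adic expansion with coefficients in `W` have distinct valuations. -/
theorem dvd_of_sum_mem {p : ℕ} {W : Type u} [CommRing W] {O : Type u} [CommRing O] [IsDomain O]
    [Algebra W O] {π : O} {n : ℕ} (hπ0 : π ≠ 0) (hp : Associated (p : O) (π ^ n))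
    (hW : ∀ w, π ∣ algebraMap W O w → (p : W) ∣ w) {r : ℕ} (hr : r ≤ n) (c : ℕ → W)
    (h : π ^ r ∣ ∑ i ∈ Finset.range r, algebraMap W O (c i) * π ^ i) :
    ∀ i < r, (p : W) ∣ c i := by
  induction r generalizing c with
  | zero => exact fun i hi => absurd hi (Nat.not_lt_zero i)
  | succ r ih =>
    have hsum : ∑ i ∈ Finset.range (r + 1), algebraMap W O (c i) * π ^ i =
        π * ∑ i ∈ Finset.range r, algebraMap W O (c (i + 1)) * π ^ i + algebraMap W O (c 0) := by
      rw [Finset.sum_range_succ', Finset.mul_sum, pow_zero, mul_one]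
      congr 1
      exact Finset.sum_congr rfl fun i _ => by ring
    rw [hsum] at h
    have h0 : (p : W) ∣ c 0 := by
      refine hW _ ((dvd_add_right (dvd_mul_right _ _)).1 (Dvd.dvd.trans ?_ h))
      exact dvd_pow_self π r.succ_ne_zero
    have h1 : π ^ (r + 1) ∣ algebraMap W O (c 0) := by
      have h2 := map_dvd (algebraMap W O) h0
      rw [map_natCast] at h2
      exact ((pow_dvd_pow π hr).trans hp.symm.dvd).trans h2
    rw [dvd_add_left h1, pow_succ', mul_dvd_mul_iff_left hπ0] at h
    intro i hi
    cases i with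
    | zero => exact h0
    | succ i => exact ih (by omega) _ h i (by omega)

variable {p : ℕ} {W : Type u} [CommRing W] [IsDomain W] [IsDiscreteValuationRing W]

theorem isLocalRing_of_span_eq_pow {O : Type u} [CommRing O] [Algebra W O] [Algebra.IsIntegral W O]
    (hpW : Irreducible (p : W)) {P : Ideal O} [hP : P.IsPrime] {n : ℕ}
    (h : Ideal.span {(p : O)} = P ^ (n + 1)) : ∃ _ : IsLocalRing O,
      P = IsLocalRing.maximalIdeal O ∧ ∀ w, algebraMap W O w ∈ P → (p : W) ∣ w := by
  have hpP : (p : O) ∈ P :=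
    Ideal.pow_le_self n.succ_ne_zero (h ▸ Ideal.mem_span_singleton_self (p : O))
  have hmax : IsLocalRing.maximalIdeal W = Ideal.span {(p : W)} :=
    (IsDiscreteValuationRing.irreducible_iff_uniformizer _).1 hpW
  have hcomap : P.comap (algebraMap W O) = IsLocalRing.maximalIdeal W := by
    refine ((IsLocalRing.maximalIdeal.isMaximal W).eq_of_le (Ideal.IsPrime.ne_top inferInstance)
      ?_).symm
    rw [hmax, Ideal.span_singleton_le_iff_mem, Ideal.mem_comap, map_natCast]
    exact hpP
  have hPmax : P.IsMaximal := Ideal.isMaximal_of_isIntegral_of_isMaximal_comap (R := W) P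
    (hcomap ▸ IsLocalRing.maximalIdeal.isMaximal W)
  have huniq : ∀ M : Ideal O, M.IsMaximal → M = P := by
    intro M hM
    have hMc : M.comap (algebraMap W O) = IsLocalRing.maximalIdeal W :=
      IsLocalRing.eq_maximalIdeal (Ideal.isMaximal_comap_of_isIntegral_of_isMaximal M)
    have hpM : (p : O) ∈ M := by
      have : (p : W) ∈ M.comap (algebraMap W O) := by
        rw [hMc, hmax]
        exact Ideal.mem_span_singleton_self _
      rwa [Ideal.mem_comap, map_natCast] at this
    have hle : P ^ (n + 1) ≤ M := by
      rwa [← h, Ideal.span_singleton_le_iff_mem]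
    exact (hPmax.eq_of_le hM.ne_top (Ideal.IsPrime.le_of_pow_le hle)).symm
  have hloc : IsLocalRing O := IsLocalRing.of_unique_max_ideal ⟨P, hPmax, huniq⟩
  refine ⟨hloc, IsLocalRing.eq_maximalIdeal hPmax, fun w hw => ?_⟩
  rwa [← Ideal.mem_comap, hcomap, hmax, Ideal.mem_span_singleton] at hw

variable {O : Type u} [CommRing O] [IsDomain O] [Algebra W O] {π : O} {n : ℕ}

theorem isEisensteinGenerator_of_associated [FaithfulSMul W O] (hpW : Irreducible (p : W))
    (hπu : ¬ IsUnit π) (hπ0 : π ≠ 0) (hp : Associated (p : O) (π ^ n))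
    (hW : ∀ w, π ∣ algebraMap W O w → (p : W) ∣ w) (hn : 0 < n) (hint : IsIntegral W π)
    (hdeg : (minpoly W π).natDegree ≤ n)
    (hgen : (minpoly W π).natDegree = n →
      ∀ o : O, ∃ (b : W) (q : Polynomial W), b ≠ 0 ∧ algebraMap W O b * o = Polynomial.aeval π q) :
    IsEisensteinGenerator p W π := by
  set m := minpoly W π with hm
  have hmonic : m.Monic := minpoly.monic hint
  have hroot : ∑ i ∈ Finset.range m.natDegree, algebraMap W O (m.coeff i) * π ^ i +
      π ^ m.natDegree = 0 := by
    have h1 := minpoly.aeval W π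
    rw [← hm, Polynomial.aeval_eq_sum_range, Finset.sum_range_succ, Polynomial.coeff_natDegree,
      hmonic.leadingCoeff, one_smul] at h1
    simpa only [Algebra.smul_def] using h1
  have hcoeff : ∀ i < m.natDegree, (p : W) ∣ m.coeff i :=
    dvd_of_sum_mem hπ0 hp hW hdeg _ ⟨-1, by linear_combination hroot⟩
  have hpmap : ∀ {w : W}, (p : W) ∣ w → π ^ n ∣ algebraMap W O w := fun {w} hw => by
    have := map_dvd (algebraMap W O) hw
    rw [map_natCast] at this
    exact hp.symm.dvd.trans this
  have hdeg' : m.natDegree = n := by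
    refine le_antisymm hdeg ((pow_dvd_pow_iff hπ0 hπu).1 ?_)
    rw [← dvd_add_right (a := π ^ n) (b := ∑ i ∈ Finset.range m.natDegree, algebraMap W O (m.coeff i) * π ^ i), hroot]
    · exact dvd_zero _
    · exact Finset.dvd_sum fun i hi =>
        (hpmap (hcoeff i (Finset.mem_range.1 hi))).mul_right _
  have hpO : (p : O) ≠ 0 := fun h => by
    rw [h] at hp
    exact pow_ne_zero n hπ0 (hp.symm.eq_zero_iff.2 rfl)
  refine ⟨hmonic, hdeg' ▸ hn, hcoeff, ?_, ?_, fun q hq => minpoly.isIntegrallyClosed_dvd hint hq⟩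
  · obtain ⟨v, hv⟩ := hcoeff 0 (hdeg' ▸ hn)
    refine ⟨v, ?_, hv⟩
    by_contra hvu
    have hpv : (p : W) ∣ v := by
      have h1 : v ∈ IsLocalRing.maximalIdeal W := (IsLocalRing.mem_maximalIdeal _).2 hvu
      rwa [(IsDiscreteValuationRing.irreducible_iff_uniformizer _).1 hpW,
        Ideal.mem_span_singleton] at h1
    have h2 : π ^ (n + 1) ∣ π ^ n := by
      obtain ⟨n', rfl⟩ := Nat.exists_eq_add_of_le' hn
      rw [hdeg', Finset.sum_range_succ', pow_zero, mul_one] at hroot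
      have h3 : π ^ (n' + 1 + 1) ∣ algebraMap W O (m.coeff 0) := by
        rw [hv, map_mul, map_natCast, pow_succ]
        refine mul_dvd_mul hp.symm.dvd ((dvd_pow_self π n'.succ_ne_zero).trans (hpmap hpv))
      have h4 : π ^ (n' + 1 + 1) ∣
          ∑ i ∈ Finset.range n', algebraMap W O (m.coeff (i + 1)) * π ^ (i + 1) := by
        refine Finset.dvd_sum fun i hi => ?_
        rw [pow_succ]
        refine mul_dvd_mul (hpmap (hcoeff _ ?_)) (dvd_pow_self π i.succ_ne_zero)
        have := Finset.mem_range.1 hi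
        omega
      exact (dvd_add_right (dvd_add h4 h3)).1 (by rw [hroot]; exact dvd_zero _)
    have := (pow_dvd_pow_iff hπ0 hπu).1 h2
    omega
  · have hstep : ∀ (N : ℕ) (o : O), (p : O) ^ N * o ∈ (Polynomial.aeval (R := W) π).range →
        o ∈ (Polynomial.aeval (R := W) π).range := by
      intro N
      induction N with
      | zero => exact fun o ho => by simpa using ho
      | succ N ih =>
        rintro o ⟨q, hq⟩
        refine ih o ?_
        have h1 : Polynomial.aeval π (q %ₘ m) = p * ((p : O) ^ N * o) := by
          have h2 := congrArg (Polynomial.aeval π) (Polynomial.modByMonic_add_div q m)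
          have h3 : Polynomial.aeval π m = 0 := minpoly.aeval W π
          rw [map_add, map_mul, h3, zero_mul, add_zero] at h2
          rw [h2]
          exact hq.trans (by ring)
        have hlt : (q %ₘ m).natDegree < n := by
          rw [← hdeg']
          refine Polynomial.natDegree_modByMonic_lt q hmonic fun h => ?_
          rw [h, Polynomial.natDegree_one] at hdeg'
          omega
        have h4 : ∀ i, (p : W) ∣ (q %ₘ m).coeff i := by
          intro i
          by_cases hi : i < n
          · refine dvd_of_sum_mem hπ0 hp hW le_rfl _ ?_ i hi
            have h5 := Polynomial.aeval_eq_sum_range' hlt π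
            simp only [Algebra.smul_def] at h5
            rw [← h5, h1]
            exact hp.symm.dvd.mul_right _
          · rw [Polynomial.coeff_eq_zero_of_natDegree_lt (by omega)]
            exact dvd_zero _
        obtain ⟨r, hr⟩ := (Polynomial.C_dvd_iff_dvd_coeff _ _).2 h4
        refine ⟨r, mul_left_cancel₀ hpO ?_⟩
        rw [← h1, hr, map_mul, Polynomial.aeval_C, map_natCast]
        rfl
    rw [Algebra.adjoin_singleton_eq_range_aeval, eq_top_iff]
    intro o _
    obtain ⟨b, q, hb, hq⟩ := hgen hdeg' o
    obtain ⟨N, u, hu⟩ := IsDiscreteValuationRing.associated_pow_irreducible hb hpW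
    refine hstep N o ⟨Polynomial.C (u : W) * q, ?_⟩
    have h1 := congrArg (algebraMap W O) hu
    rw [map_mul, map_pow, map_natCast] at h1
    change Polynomial.aeval π _ = _
    rw [map_mul, Polynomial.aeval_C, ← hq, ← h1]
    ring

/-- A uniformizer of a totally ramified extension is a root of an Eisenstein polynomial, and
generates the ring of integers. -/
theorem IsTotallyRamified.isEisensteinGenerator {K : Type u} [Field K] [Algebra W K]
    [Algebra (FractionRing W) K] [IsScalarTower W (FractionRing W) K]
    [FiniteDimensional (FractionRing W) K] (hpW : Irreducible (p : W))
    (hK : IsTotallyRamified W (p : W) K) {π : integralClosure W K} (hπ : Irreducible π) :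
    IsEisensteinGenerator p W π := by
  obtain ⟨P, hP, h⟩ := hK
  obtain ⟨n, hn⟩ := Nat.exists_eq_add_of_le' (Module.finrank_pos (R := FractionRing W) (M := K))
  have hinjK : Function.Injective (algebraMap W K) := by
    rw [IsScalarTower.algebraMap_eq W (FractionRing W) K]
    exact (algebraMap (FractionRing W) K).injective.comp (IsFractionRing.injective W _)
  have hinjO : Function.Injective (algebraMap W (integralClosure W K)) := fun x y hxy =>
    hinjK (congrArg (algebraMap (integralClosure W K) K) hxy)
  have : FaithfulSMul W (integralClosure W K) := (faithfulSMul_iff_algebraMap_injective _ _).2 hinjO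
  rw [hn, map_natCast] at h
  obtain ⟨hloc, hPm, hPW⟩ := isLocalRing_of_span_eq_pow hpW h
  have hpO : (p : integralClosure W K) ≠ 0 := fun h0 => hpW.ne_zero (hinjO (by
    rw [map_natCast, h0, map_zero]))
  have hPπ := span_eq_of_irreducible hPm hpO h hπ
  rw [hPπ, Ideal.span_singleton_pow, Ideal.span_singleton_eq_span_singleton] at h
  have hint : IsIntegral W π := Algebra.IsIntegral.isIntegral π
  have hmin : minpoly (FractionRing W) (π : K) =
      (minpoly W π).map (algebraMap W (FractionRing W)) :=
    minpoly.isIntegrallyClosed_eq_field_fractions (FractionRing W) K hint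
  have hdeg : (minpoly (FractionRing W) (π : K)).natDegree = (minpoly W π).natDegree := by
    rw [hmin, (minpoly.monic hint).natDegree_map]
  refine isEisensteinGenerator_of_associated hpW hπ.not_isUnit hπ.ne_zero h
    (fun w hw => hPW w (by rwa [hPπ, Ideal.mem_span_singleton])) n.succ_pos hint ?_ ?_
  · rw [← hdeg, ← hn]
    exact minpoly.natDegree_le _
  · intro hd o
    have htop := (Field.primitive_element_iff_minpoly_natDegree_eq (FractionRing W) (π : K)).2
      (by rw [hdeg, hd, hn])
    have ho : (o : K) ∈ Algebra.adjoin (FractionRing W) {(π : K)} := by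
      rw [← IntermediateField.adjoin_simple_toSubalgebra_of_isAlgebraic
        (Algebra.IsAlgebraic.isAlgebraic _), htop]
      trivial
    rw [Algebra.adjoin_singleton_eq_range_aeval] at ho
    obtain ⟨f, hf⟩ := ho
    obtain ⟨b, hb, hbf⟩ := IsLocalization.integerNormalization_spec (nonZeroDivisors W) f
    refine ⟨b, IsLocalization.integerNormalization (nonZeroDivisors W) f,
      nonZeroDivisors.ne_zero hb, Subtype.ext ?_⟩
    have h1 : algebraMap W K b * (o : K) =
        Polynomial.aeval (π : K) (IsLocalization.integerNormalization (nonZeroDivisors W) f) := by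
      rw [← Polynomial.aeval_map_algebraMap (FractionRing W), hbf, Algebra.smul_def, map_mul,
        Polynomial.algebraMap_apply, Polynomial.aeval_C,
        ← IsScalarTower.algebraMap_apply W (FractionRing W) K]
      exact congrArg _ hf.symm
    refine h1.trans ?_
    exact (Polynomial.aeval_algebraMap_apply K π _)

end Ramified

end PrismIntersection

open PrismIntersection in
theorem mainTheorem3 (p : ℕ) [Fact p.Prime]
    -- the perfect field `k`, the totally ramified extension `K` of `W(k)[1/p]`, the uniformizer `π`
    (k : Type u) [Field k] [CharP k p] [PerfectRing k p]
    (K : Type u) [Field K] [Algebra (WittVector p k) K] [Algebra (FractionRing (WittVector p k)) K]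
    [IsScalarTower (WittVector p k) (FractionRing (WittVector p k)) K]
    [FiniteDimensional (FractionRing (WittVector p k)) K]
    (hK : IsTotallyRamified (WittVector p k) (p : WittVector p k) K)
    (π : integralClosure (WittVector p k) K) (hπ : Irreducible π)
    -- `R₀`, the `p`-adic completion of an étale algebra `S` over `W(k)⟨T₁^{±1}, …, T_d^{±1}⟩`,
    -- such that `(p)` is a prime ideal of `R₀`
    (d : ℕ) (S : Type u) [CommRing S] [Algebra (WittVector p k) S]
    [Algebra (TateLaurent p (WittVector p k) d) S]
    [IsScalarTower (WittVector p k) (TateLaurent p (WittVector p k) d) S]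
    [Algebra.Etale (TateLaurent p (WittVector p k) d) S]
    [(Ideal.span {(p : PCompl p S)}).IsPrime]
    -- the lift of Frobenius on `R₀` with `φ(T_i) = T_i ^ p`
    (φ : PCompl p S →+* PCompl p S) (hφ : IsFrobeniusLift p φ)
    (hT : ∀ i : Fin d,
      φ (algebraMap S (PCompl p S) (algebraMap _ S (TateLaurent.coord p (WittVector p k) i))) =
        algebraMap S (PCompl p S) (algebraMap _ S (TateLaurent.coord p (WittVector p k) i)) ^ p) :
    -- the two self-products exist
    (∃ (P : PrismOver p (PCompl p S ⊗[WittVector p k] integralClosure (WittVector p k) K))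
      (i₁ i₂ : BKHom π φ P), IsSelfProduct i₁ i₂) ∧
    (∃ (Q : PrismOver p
        (OL₀ p (PCompl p S) ⊗[WittVector p k] integralClosure (WittVector p k) K))
      (j₁ j₂ : BKHom π (frobL p hφ) Q), IsSelfProduct j₁ j₂) ∧
    -- and the first one is the intersection
    ∀ (P : PrismOver p (PCompl p S ⊗[WittVector p k] integralClosure (WittVector p k) K))
      (i₁ i₂ : BKHom π φ P) (hP : IsSelfProduct i₁ i₂)
      (Q : PrismOver p
        (OL₀ p (PCompl p S) ⊗[WittVector p k] integralClosure (WittVector p k) K))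
      (j₁ j₂ : BKHom π (frobL p hφ) Q) (_ : IsSelfProduct j₁ j₂),
      let f : P.carrier →+* Q.carrier :=
        selfProductMap (toOL₀ p (PCompl p S) (WittVector p k)) (toOL₀_comp p _ hφ) hP j₁ j₂
      let E : P.carrier := i₁.toRingHom (eisenstein (WittVector p k) π (PCompl p S))
      let EL : Q.carrier := j₁.toRingHom (eisenstein (WittVector p k) π (OL₀ p (PCompl p S)))
      let fE : AwayCompl p E →+* AwayCompl p EL :=
        AwayCompl.map p f (selfProductMap_eisenstein _ _ hP j₁ j₂)
      Function.Injective f ∧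
      Function.Injective (AwayCompl.of p E) ∧
      Function.Injective (AwayCompl.of p EL) ∧
      Function.Injective fE ∧
      ((AwayCompl.of p EL).comp f).range = (AwayCompl.of p EL).range ⊓ fE.range := by
  have hR := isBKBase_pCompl hφ hT
  have hE := hK.isEisensteinGenerator (WittVector.irreducible p) hπ
  exact ⟨⟨_, _, _, hR.isSelfProduct hE⟩, ⟨_, _, _, hR.oL₀.isSelfProduct hE⟩,
    fun P i₁ i₂ hP Q j₁ j₂ hQ => intersection_selfProduct hR
      (toOL₀ p (PCompl p S) (WittVector p k)) hR.oL₀ (toOL₀_comp p _ hφ) hE (fun _ => natCast_dvd_of_toOL₀)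
      hP hQ⟩
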